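/- Fix an integer $n\ge 1$. For each prime power $p^v$ ($v\ge 1$) let $A_{p^v}\subseteq(\mathbf Z/p^v\mathbf Z)^n$ be an arbitrary (possibly empty) set. For each positive integer $q$ let $A_q\subseteq(\mathbf Z/q\mathbf Z)^n$ be the set of $x$ such that $x \bmod p^v\in A_{p^v}$ for every prime power $p^v$ exactly dividing $q$ (that is, $p^v\mid q$ and $p^{v+1}\nmid q$), and put $\rho(q)=|A_q|$ (so $\rho(1)=1$). For real $x\ge 1$ let $\mathcal Q(x)$ be the set of positive integers $q\le x$ with $\rho(q)\ge 1$. If $\rho(q)\ge1$, let $$\Delta_q=\frac1{\rho(q)}\sum_{a\in A_q}\delta_{\{a/q\}},$$ a probability measure on $(\mathbf R/\mathbf Z)^n$ ($\delta_{\{a/q\}}$ is the Dirac mass at the class of $a/q$), and let $$\operatorname{disc}(\Delta_q)=\sup_B|\Delta_q(B)-\operatorname{vol}(B)|,$$ where $B$ runs over all boxes, i.e. images in $(\mathbf R/\mathbf Z)^n$ of products of $n$ closed intervals of $\mathbf R$ of length at most $1$, and $\operatorname{vol}$ is Lebesgue measure. For a prime $p$ let $$\lambda(p)=\max_H|H\cap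 A_p|,$$ where $H$ runs over all affine hyperplanes of $(\mathbf Z/p\mathbf Z)^n$, i.e. sets $\{y: h_1y_1+\cdots+h_ny_n=a\}$ with $a\in\mathbf Z/p\mathbf Z$ and $(h_i)\in(\mathbf Z/p\mathbf Z)^n\setminus\{0\}$. Suppose that there are constants $\alpha>0$ and $x_0\ge 2$ such that for all real $y\ge x_0$ $$\sum_{p\le y,\ \rho(p)\ge1}\log p\ge\alpha y .$$ Then there is a constant $C(n)$ depending only on $n$ such that, for all real $x$ that are large enough in terms of $\alpha$ and $x_0$ only, $$\frac1{|\mathcal Q(x)|}\sum_{q\in\mathcal Q(x)}\operatorname{disc}(\Delta_q)\le\frac{C(n)}{\alpha}\exp\Big(-\frac13\sum_{p\le x,\ \rho(p)\ge1}\Big(1-\frac{\lambda(p)}{\rho(p)}\Big)\frac1p\Big).$$ (Sums over $p$ are over primes.) -/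

import Mathlib

open MeasureTheory

namespace CRTSets

variable {n : ℕ}

/-- Reduction modulo a divisor `d` of `q`, coordinate by coordinate. -/
def reduce {q d : ℕ} (h : d ∣ q) (x : Fin n → ZMod q) : Fin n → ZMod d :=
  fun i => ZMod.castHom h (ZMod d) (x i)

/-- The set `A_q ⊆ (ℤ/qℤ)ⁿ` attached by the Chinese Remainder Theorem to the sets
`A (p ^ v) ⊆ (ℤ/p^vℤ)ⁿ` : the classes `x` mod `q` such that `x` mod `p ^ v` lies in `A (p ^ v)` for
all prime powers `p ^ v` (`v ≥ 1`) exactly dividing `q`. Only the values of `A` at prime powers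
are used. -/
def crtSet (A : (m : ℕ) → Set (Fin n → ZMod m)) (q : ℕ) : Set (Fin n → ZMod q) :=
  {x | ∀ (p v : ℕ) (h : p ^ v ∣ q), p.Prime → 1 ≤ v → ¬ p ^ (v + 1) ∣ q →
    reduce h x ∈ A (p ^ v)}

/-- At a prime power the Chinese Remainder set is the given set. -/
theorem crtSet_prime_pow (A : (m : ℕ) → Set (Fin n → ZMod m)) {p v : ℕ} (hp : p.Prime)
    (hv : 1 ≤ v) : crtSet A (p ^ v) = A (p ^ v) := by
  have key : ∀ (h : p ^ v ∣ p ^ v) (x : Fin n → ZMod (p ^ v)), reduce h x = x := by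
    intro h x
    funext i
    simp [reduce]
  ext x
  constructor
  · intro hx
    have := hx p v dvd_rfl hp hv
      (by rw [Nat.pow_dvd_pow_iff_le_right hp.one_lt]; omega)
    rwa [key] at this
  · intro hx r w h hr hw hnot
    have hrp : r = p := (Nat.prime_dvd_prime_iff_eq hr hp).1
      (hr.dvd_of_dvd_pow ((dvd_pow_self r (by omega)).trans h))
    subst hrp
    rw [Nat.pow_dvd_pow_iff_le_right hp.one_lt] at h hnot
    obtain rfl : w = v := by omega
    rwa [key]

/-- `ρ(q) = |A_q|`. -/
noncomputable def rho (A : (m : ℕ) → Set (Fin n → ZMod m)) (q : ℕ) : ℕ :=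
  (crtSet A q).ncard

open Classical in
/-- `𝒬(x)`: the positive integers `q ≤ x` with `ρ(q) ≥ 1`. -/
noncomputable def modsUpTo (A : (m : ℕ) → Set (Fin n → ZMod m)) (x : ℝ) : Finset ℕ :=
  (Finset.Icc 1 ⌊x⌋₊).filter fun q => 1 ≤ rho A q

open Classical in
/-- The primes `p ≤ x` with `ρ(p) ≥ 1`. -/
noncomputable def primesUpTo (A : (m : ℕ) → Set (Fin n → ZMod m)) (x : ℝ) : Finset ℕ :=
  (Finset.Icc 1 ⌊x⌋₊).filter fun p => p.Prime ∧ 1 ≤ rho A p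

/-- The density assumption on the primes with `ρ(p) ≥ 1`, with constants `α > 0` and `x₀ ≥ 2`. -/
def DensityAssumption (A : (m : ℕ) → Set (Fin n → ZMod m)) (α x₀ : ℝ) : Prop :=
  0 < α ∧ 2 ≤ x₀ ∧ ∀ x : ℝ, x₀ ≤ x → α * x ≤ ∑ p ∈ primesUpTo A x, Real.log p

/-- Affine hyperplanes in `(ℤ/qℤ)ⁿ`: solution sets of `h₁ x₁ + ⋯ + hₙ xₙ = a` with `h ≠ 0`. -/
def IsAffineHyperplane {q : ℕ} (H : Set (Fin n → ZMod q)) : Prop :=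
  ∃ (h : Fin n → ZMod q) (a : ZMod q), h ≠ 0 ∧ H = {x | ∑ i, h i * x i = a}

/-- `λ(p)`: the maximal number of points of `A_p` on an affine hyperplane of `(ℤ/pℤ)ⁿ`. -/
noncomputable def lam (A : (m : ℕ) → Set (Fin n → ZMod m)) (p : ℕ) : ℕ :=
  sSup {m | ∃ H : Set (Fin n → ZMod p), IsAffineHyperplane H ∧ m = (H ∩ A p).ncard}

/-- For `n ≥ 1` and `p` prime, `λ(p)` is a genuine maximum. -/
theorem lam_isGreatest (A : (m : ℕ) → Set (Fin n → ZMod m)) (hn : 1 ≤ n) {p : ℕ}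
    (hp : p.Prime) :
    IsGreatest {m | ∃ H : Set (Fin n → ZMod p), IsAffineHyperplane H ∧ m = (H ∩ A p).ncard}
      (lam A p) := by
  have : Fact p.Prime := ⟨hp⟩
  have hne : {m | ∃ H : Set (Fin n → ZMod p),
      IsAffineHyperplane H ∧ m = (H ∩ A p).ncard}.Nonempty :=
    ⟨_, _, ⟨fun _ => 1, 0, fun h => one_ne_zero (congrFun h ⟨0, hn⟩), rfl⟩, rfl⟩
  have hb : BddAbove {m | ∃ H : Set (Fin n → ZMod p),
      IsAffineHyperplane H ∧ m = (H ∩ A p).ncard} := by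
    refine ⟨(A p).ncard, ?_⟩
    rintro m ⟨H, -, rfl⟩
    exact Set.ncard_le_ncard Set.inter_subset_right (Set.toFinite _)
  exact ⟨Nat.sSup_mem hne hb, fun m hm => le_csSup hb hm⟩

/-- The torus `(ℝ/ℤ)ⁿ`; its `volume` is the Lebesgue measure, of total mass `1`. -/
abbrev Torus (n : ℕ) : Type := Fin n → UnitAddCircle

/-- The projection `ℝⁿ → (ℝ/ℤ)ⁿ`. -/
def proj (t : Fin n → ℝ) : Torus n := fun i => (t i : UnitAddCircle)

/-- The point `{a/q}` of the torus, for `a ∈ (ℤ/qℤ)ⁿ`. -/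
noncomputable def torusPoint (q : ℕ) (a : Fin n → ZMod q) : Torus n :=
  proj fun i => ((a i).val : ℝ) / (q : ℝ)

/-- The measure `Δ_q = ρ(q)⁻¹ ∑_{a ∈ A_q} δ_{a/q}` on the torus. -/
noncomputable def Delta (A : (m : ℕ) → Set (Fin n → ZMod m)) (q : ℕ) : Measure (Torus n) :=
  (rho A q : ENNReal)⁻¹ •
    Measure.sum fun a : crtSet A q => Measure.dirac (torusPoint q (a : Fin n → ZMod q))

/-- Boxes in the torus: projections of closed boxes of `ℝⁿ` with all side lengths at most `1`. -/
def IsBox (B : Set (Torus n)) : Prop :=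
  ∃ s t : Fin n → ℝ, (∀ i, s i ≤ t i) ∧ (∀ i, t i - s i ≤ 1) ∧
    B = proj '' (Set.univ.pi fun i => Set.Icc (s i) (t i))

/-- The box discrepancy of a measure on the torus. -/
noncomputable def disc (μ : Measure (Torus n)) : ℝ :=
  sSup {r | ∃ B : Set (Torus n), IsBox B ∧ r = |μ.real B - volume.real B|}

end CRTSets

/-! The discrepancy of `Δ_q` is controlled by the normalised exponential sums over `A_q` with
nonzero frequencies `h`, so everything rests on averaging these over the moduli `q ≤ N`. They are
not multiplicative: by the Chinese Remainder Theorem the sum modulo `r * s` splits as a product in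
which the sum modulo `r` is twisted by the inverse of `s`. This twist is what is exploited. Let `r`
be the `z`-smooth part of `q` and `s` its rough part, and bound the factor at `s` trivially. For
fixed `r`, Selberg's sieve shows that no reduced class modulo `r` receives more than its expected
share of rough `s`, up to a constant, so the average over `s` becomes an average over all unit
twists. That average, `meanWeyl`, is multiplicative (`meanWeyl_mul`), and at a prime Parseval and
Cauchy–Schwarz bound it by `√(λ/ρ) ≤ 1 - (1 - λ/ρ)/2` (`meanWeyl_prime_le`). An Euler product then
saves `exp(-S/2)`, where `S` is the sum in the theorem.

The sieve needs the smooth part to be at most `N^(1/4)`; the remaining moduli are rare by Rankin's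
trick (`card_large_smoothPart_le`). Choosing `log z` near `log N / (8 (S + 1))` makes Rankin's
saving large enough and loses only a factor `S + 1` (`sum_weylNorm_le_mul_exp`). The main term has
size `(N / log N) exp(L)`, with `L` the sum of `1/p` over the admissible primes. The density
assumption gives `|𝒬(N)|` at least a constant times `α` times this quantity, by counting products `m
* p` (`card_modsUpTo_ge`); this is the source of the factor `1/α`.

To pass from exponential sums to boxes, arcs are majorised by trigonometric polynomials of degree `M
^ 2`, giving upper bounds for the measure of boxes; lower bounds follow by covering the complement
with `n` boxes (`disc_le`). With `M` about `exp S` the frequency weights cost a further power of `S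
+ 1`, and `(S + 1) ^ (n + 2)` is absorbed by weakening the exponent from `1/2` to `1/3`. -/

namespace CRTSets

/-! ### Mertens-type bounds and Euler product majorants -/

open Finset in
/-- An upper bound of Mertens type. -/
theorem sum_log_div_primesLE_le {N : ℕ} (hN : 1 ≤ N) :
    ∑ p ∈ N.primesLE, Real.log p / p ≤ 2 * Real.log N := by
  -- The inner sum is the logarithm of the radical of `m`. Exchanging sums produces `⌊N/p⌋ log p`,
  -- and `⌊N/p⌋ ≥ N/(2p)` because `p ≤ N`.
  have h1 : ∑ m ∈ Ioc 0 N, ∑ p ∈ m.primeFactors, Real.log p ≤ N * Real.log N := by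
    calc ∑ m ∈ Ioc 0 N, ∑ p ∈ m.primeFactors, Real.log p
        ≤ ∑ m ∈ Ioc 0 N, Real.log N := by
          refine sum_le_sum fun m hm => ?_
          rw [mem_Ioc] at hm
          rw [← Real.log_prod fun p hp => by
            exact_mod_cast (Nat.prime_of_mem_primeFactors hp).ne_zero]
          refine Real.log_le_log ?_ ?_
          · exact prod_pos fun p hp => by exact_mod_cast (Nat.prime_of_mem_primeFactors hp).pos
          · have := Nat.le_of_dvd hm.1 (Nat.prod_primeFactors_dvd m)
            rw [← Nat.cast_prod]
            exact Nat.cast_le.2 (this.trans hm.2)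
      _ = N * Real.log N := by simp
  have h2 : ∑ m ∈ Ioc 0 N, ∑ p ∈ m.primeFactors, Real.log p
      = ∑ p ∈ N.primesLE, ((N / p : ℕ) : ℝ) * Real.log p := by
    rw [sum_comm' (t' := N.primesLE) (s' := fun p => (Ioc 0 N).filter (p ∣ ·))]
    · refine sum_congr rfl fun p _ => ?_
      rw [sum_const, Nat.Ioc_filter_dvd_card_eq_div, nsmul_eq_mul]
    · intro m p
      simp only [mem_Ioc, Nat.mem_primeFactors, Nat.mem_primesLE, mem_filter]
      constructor
      · rintro ⟨⟨h0, hm⟩, hp, hd, _⟩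
        exact ⟨⟨⟨h0, hm⟩, hd⟩, (Nat.le_of_dvd h0 hd).trans hm, hp⟩
      · rintro ⟨⟨⟨h0, hm⟩, hd⟩, _, hp⟩
        exact ⟨⟨h0, hm⟩, hp, hd, by omega⟩
  have h3 : ∀ p ∈ N.primesLE, (N / 2 : ℝ) * (Real.log p / p)
      ≤ ((N / p : ℕ) : ℝ) * Real.log p := by
    intro p hp
    rw [Nat.mem_primesLE] at hp
    have hp0 : (0 : ℝ) < p := by exact_mod_cast hp.2.pos
    have hq1 : 1 ≤ N / p := (Nat.one_le_div_iff hp.2.pos).2 hp.1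
    have hq : (N : ℝ) ≤ 2 * p * ((N / p : ℕ) : ℝ) := by
      have := Nat.lt_mul_div_succ N hp.2.pos
      have h4 : N ≤ 2 * p * (N / p) := by nlinarith
      exact_mod_cast h4
    have hl : 0 ≤ Real.log p := Real.log_natCast_nonneg p
    calc (N / 2 : ℝ) * (Real.log p / p) ≤ (2 * p * ((N / p : ℕ) : ℝ) / 2) * (Real.log p / p) := by
          gcongr
      _ = _ := by field_simp
  have h4 := sum_le_sum h3
  rw [← mul_sum, ← h2] at h4
  have hN0 : (0 : ℝ) < N := by exact_mod_cast hN
  have h5 := h4.trans h1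
  have : (N : ℝ) * (∑ p ∈ N.primesLE, Real.log p / p) ≤ N * (2 * Real.log N) := by linarith
  exact le_of_mul_le_mul_left this hN0

/-- Reciprocals of primes in a logarithmic window. -/
theorem sum_inv_primes_window_le {w N : ℕ} (hw : 2 ≤ w) (hN : 1 ≤ N) :
    ∑ p ∈ N.primesLE.filter (w ≤ ·), 1 / (p : ℝ) ≤ 2 * Real.log N / Real.log w := by
  have hlw : 0 < Real.log w := Real.log_pos (by exact_mod_cast hw)
  rw [le_div_iff₀ hlw, Finset.sum_mul]
  refine le_trans ?_ (sum_log_div_primesLE_le hN)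
  refine (Finset.sum_le_sum fun p hp => ?_).trans
    (Finset.sum_le_sum_of_subset_of_nonneg (Finset.filter_subset (w ≤ ·) _) fun p _ _ =>
      div_nonneg (Real.log_natCast_nonneg p) (Nat.cast_nonneg p))
  rw [Finset.mem_filter] at hp
  rw [one_div, inv_mul_eq_div]
  gcongr
  exact hp.2

/-- Primes below `w` are counted trivially. With `w` a large constant the sum becomes a small
multiple of `log N`, which is all that is needed in place of the true order `log log N`. -/
theorem sum_inv_primesLE_le {w N : ℕ} (hw : 2 ≤ w) (hN : 1 ≤ N) :
    ∑ p ∈ N.primesLE, 1 / (p : ℝ) ≤ w + 2 * Real.log N / Real.log w := by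
  rw [← Finset.sum_filter_add_sum_filter_not N.primesLE (w ≤ ·), add_comm]
  refine add_le_add ?_ (sum_inv_primes_window_le hw hN)
  calc ∑ p ∈ N.primesLE.filter (¬ w ≤ ·), 1 / (p : ℝ)
      ≤ ∑ p ∈ N.primesLE.filter (¬ w ≤ ·), 1 := by
        refine Finset.sum_le_sum fun p hp => ?_
        rw [Finset.mem_filter, Nat.mem_primesLE] at hp
        rw [div_le_one (by exact_mod_cast hp.1.2.pos)]
        exact_mod_cast hp.1.2.one_lt.le
    _ = ((N.primesLE.filter (¬ w ≤ ·)).card : ℝ) := by simp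
    _ ≤ ((Finset.range w).card : ℝ) := by
        refine Nat.cast_le.2 (Finset.card_le_card fun p hp => ?_)
        rw [Finset.mem_filter] at hp
        simpa using hp.2
    _ = w := by simp

theorem rpow_neg_nine_tenths_le {p : ℕ} (hp : 2 ≤ p) : (p : ℝ) ^ (-(9 / 10) : ℝ) ≤ 2 / 3 := by
  have hp2 : (2 : ℝ) ≤ p := by exact_mod_cast hp
  refine le_of_pow_le_pow_left₀ (n := 10) (by norm_num) (by norm_num) ?_
  rw [← Real.rpow_natCast, ← Real.rpow_mul (by positivity)]
  calc (p : ℝ) ^ (-(9 / 10) * ((10 : ℕ) : ℝ)) = ((p : ℝ) ^ 9)⁻¹ := by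
        rw [show (-(9 / 10) * ((10 : ℕ) : ℝ) : ℝ) = -((9 : ℕ) : ℝ) by norm_num,
          Real.rpow_neg (by positivity), Real.rpow_natCast]
    _ ≤ ((2 : ℝ) ^ 9)⁻¹ := by gcongr
    _ ≤ (2 / 3) ^ 10 := by norm_num

/-- The sum that bounds the contribution of proper prime powers to Euler products. -/
noncomputable def primePowerConst : ℝ := ∑' m : ℕ, 3 * (m : ℝ) ^ (-(9 / 5) : ℝ)

theorem summable_primePowerConst : Summable fun m : ℕ => 3 * (m : ℝ) ^ (-(9 / 5) : ℝ) :=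
  (Real.summable_nat_rpow.2 (by norm_num)).mul_left 3

theorem primePowerConst_nonneg : 0 ≤ primePowerConst :=
  tsum_nonneg fun m => by positivity

theorem sum_primePowerConst_le (s : Finset ℕ) :
    ∑ p ∈ s, 3 * (p : ℝ) ^ (-(9 / 5) : ℝ) ≤ primePowerConst :=
  summable_primePowerConst.sum_le_tsum s fun _ _ => by positivity

/-- The ratio is at most `2/3`, whence the factor `3`. The exponent `9/10` leaves room for weights
as large as `q ^ (1/10)`, while its double `9/5` still exceeds `1`, so that the tails can be summed
over all primes. -/
theorem tsum_geometric_tail_le {p : ℕ} (hp : 2 ≤ p) :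
    Summable (fun k : ℕ => ((p : ℝ) ^ (-(9 / 10) : ℝ)) ^ (k + 2)) ∧
    ∑' k : ℕ, ((p : ℝ) ^ (-(9 / 10) : ℝ)) ^ (k + 2) ≤ 3 * (p : ℝ) ^ (-(9 / 5) : ℝ) := by
  set u := (p : ℝ) ^ (-(9 / 10) : ℝ) with hu
  have hu0 : 0 ≤ u := by positivity
  have hu1 : u ≤ 2 / 3 := rpow_neg_nine_tenths_le hp
  have hu2 : u ^ 2 = (p : ℝ) ^ (-(9 / 5) : ℝ) := by
    rw [hu, ← Real.rpow_natCast, ← Real.rpow_mul (by positivity)]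
    norm_num
  have hs := hasSum_geometric_of_lt_one hu0 (by linarith : u < 1)
  have hs2 : HasSum (fun k : ℕ => u ^ (k + 2)) ((1 - u)⁻¹ * u ^ 2) := by
    simpa only [pow_add] using hs.mul_right (u ^ 2)
  refine ⟨hs2.summable, ?_⟩
  rw [hs2.tsum_eq, ← hu2]
  gcongr
  rw [inv_le_comm₀ (by linarith) (by norm_num)]
  linarith

/-- Upper bound for sums of a nonnegative multiplicative function over integers composed of given
primes. -/
theorem sum_factoredNumbers_le {f : ℕ → ℝ} (h0 : ∀ m, 0 ≤ f m) (h1 : f 1 = 1)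
    (hmul : ∀ {m k : ℕ}, m.Coprime k → f (m * k) = f m * f k)
    (hpow : ∀ p : ℕ, p.Prime → ∀ k, 2 ≤ k → f (p ^ k) ≤ ((p : ℝ) ^ (-(9 / 10) : ℝ)) ^ k)
    (s T : Finset ℕ) (hT : ∀ m ∈ T, m ∈ Nat.factoredNumbers s) :
    ∑ m ∈ T, f m ≤ Real.exp primePowerConst * Real.exp (∑ p ∈ s with p.Prime, f p) := by
  have hsum2 : ∀ {p : ℕ}, p.Prime → Summable (fun k : ℕ => f (p ^ (k + 2))) := fun {p} hp =>
    (tsum_geometric_tail_le hp.two_le).1.of_nonneg_of_le (fun _ => h0 _)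
      fun k => hpow p hp (k + 2) (by omega)
  have hsum : ∀ {p : ℕ}, p.Prime → Summable (fun k : ℕ => f (p ^ k)) := fun hp =>
    (summable_nat_add_iff 2).1 (hsum2 hp)
  have hsumn : ∀ {p : ℕ}, p.Prime → Summable (fun k : ℕ => ‖f (p ^ k)‖) := fun hp =>
    (hsum hp).norm
  obtain ⟨hS, hH⟩ :=
    EulerProduct.summable_and_hasSum_factoredNumbers_prod_filter_prime_tsum h1 hmul hsumn s
  have hle : ∑ m ∈ T, f m ≤ ∏ p ∈ s with p.Prime, ∑' k : ℕ, f (p ^ k) := by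
    rw [← Finset.sum_attach]
    have hinj : Function.Injective
        (fun m : T => (⟨m.1, hT m.1 m.2⟩ : Nat.factoredNumbers s)) := by
      intro a b hab
      exact Subtype.ext (congrArg (fun t : Nat.factoredNumbers s => t.1) hab)
    have := sum_le_hasSum (T.attach.map ⟨_, hinj⟩) (fun m _ => h0 m) hH
    rw [Finset.sum_map] at this
    exact this
  -- Each Euler factor is `1 + f p` plus the tail from proper powers, hence at most the exponential
  -- of `f p + 3 p ^ (-9/5)`.
  refine hle.trans ?_
  rw [← Real.exp_add]
  calc ∏ p ∈ s with p.Prime, ∑' k : ℕ, f (p ^ k)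
      ≤ ∏ p ∈ s with p.Prime, Real.exp (f p + 3 * (p : ℝ) ^ (-(9 / 5) : ℝ)) := by
        refine Finset.prod_le_prod (fun p _ => tsum_nonneg fun _ => h0 _) fun p hp => ?_
        have hp := (Finset.mem_filter.1 hp).2
        rw [← (hsum hp).sum_add_tsum_nat_add 2]
        have := (hsum2 hp).tsum_le_tsum (fun k => hpow p hp (k + 2) (by omega))
          (tsum_geometric_tail_le hp.two_le).1
        have h4 := this.trans (tsum_geometric_tail_le hp.two_le).2
        have h5 := Real.add_one_le_exp (f p + 3 * (p : ℝ) ^ (-(9 / 5) : ℝ))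
        simp only [Finset.sum_range_succ, Finset.sum_range_zero, pow_zero, pow_one, h1]
        linarith
    _ = Real.exp (∑ p ∈ s with p.Prime, (f p + 3 * (p : ℝ) ^ (-(9 / 5) : ℝ))) :=
        (Real.exp_sum _ _).symm
    _ ≤ _ := by
        rw [Real.exp_le_exp, Finset.sum_add_distrib]
        linarith [sum_primePowerConst_le (s.filter Nat.Prime)]

end CRTSets

/-! ### Selberg's upper bound sieve -/

namespace CRTSets

section Selberg

open Finset ArithmeticFunction BoundingSieve

open scoped ArithmeticFunction.Moebius

theorem filter_and_right {ι : Type*} (t : Finset ι) (p q : ι → Prop) [DecidablePred p]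
    [DecidablePred q] : t.filter (fun a => p a ∧ q a) = (t.filter q).filter p := by
  ext a
  simp only [mem_filter]
  tauto

/-- Writing `d = l * e` with `e ∣ m / l`, the factors being coprime as `m` is squarefree, reduces
this to the basic identity for `∑ μ(e)`. It is the inversion that identifies the diagonal
coefficients of Selberg's quadratic form. -/
theorem sum_moebius_multiples {m l : ℕ} (hm : Squarefree m) :
    ∑ d ∈ m.divisors with l ∣ d, (μ d : ℝ) = if m = l then (μ l : ℝ) else 0 := by
  by_cases hl : l ∣ m
  · obtain ⟨k, rfl⟩ := hl
    have hlk : l.Coprime k := Nat.coprime_of_squarefree_mul hm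
    have hl0 : l ≠ 0 := left_ne_zero_of_mul hm.ne_zero
    have hk0 : k ≠ 0 := right_ne_zero_of_mul hm.ne_zero
    have himg : (l * k).divisors.filter (l ∣ ·) = k.divisors.image (l * ·) := by
      ext d
      simp only [mem_filter, Nat.mem_divisors, mem_image]
      constructor
      · rintro ⟨⟨hd, -⟩, e, rfl⟩
        exact ⟨e, ⟨Nat.dvd_of_mul_dvd_mul_left (Nat.pos_of_ne_zero hl0) hd, hk0⟩, rfl⟩
      · rintro ⟨e, ⟨he, -⟩, rfl⟩
        exact ⟨⟨mul_dvd_mul_left l he, hm.ne_zero⟩, dvd_mul_right l e⟩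
    rw [himg, sum_image fun a _ b _ h => Nat.eq_of_mul_eq_mul_left (Nat.pos_of_ne_zero hl0) h]
    have h1 : ∀ e ∈ k.divisors, (μ (l * e) : ℝ) = μ l * μ e := by
      intro e he
      rw [isMultiplicative_moebius.map_mul_of_coprime
        (hlk.coprime_dvd_right (Nat.dvd_of_mem_divisors he)), Int.cast_mul]
    rw [sum_congr rfl h1, ← mul_sum]
    have h2 : ∑ e ∈ k.divisors, (μ e : ℝ) = if k = 1 then 1 else 0 := by
      have := congrArg (fun f : ArithmeticFunction ℤ => f k) moebius_mul_coe_zeta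
      simp only [coe_mul_zeta_apply, one_apply] at this
      exact_mod_cast this
    rw [h2]
    by_cases hk : k = 1
    · simp [hk]
    · have : l * k ≠ l := fun h => hk (by
        simpa [hl0] using h)
      simp [hk, this]
  · rw [if_neg (fun h : m = l => hl (h ▸ dvd_rfl)), filter_false_of_mem, sum_empty]
    intro d hd hld
    exact hl (hld.trans (Nat.dvd_of_mem_divisors hd))

variable (s : BoundingSieve) (D : ℕ)

/-- The denominator of the main term in Selberg's sieve. -/
noncomputable def selbergDenom : ℝ := ∑ l ∈ s.prodPrimes.divisors with l ≤ D, s.selbergTerms l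

/-- Selberg's optimal weights. -/
noncomputable def selbergWeight (d : ℕ) : ℝ :=
  if d ∣ s.prodPrimes then
    μ d * (s.nu d)⁻¹ * (selbergDenom s D)⁻¹ *
      ∑ m ∈ s.prodPrimes.divisors with d ∣ m ∧ m ≤ D, s.selbergTerms m
  else 0

variable {s D}

theorem selbergDenom_pos (hD : 1 ≤ D) : 0 < selbergDenom s D := by
  refine sum_pos (fun l hl => ?_) ⟨1, ?_⟩
  · exact selbergTerms_pos (Nat.dvd_of_mem_divisors (mem_filter.1 hl).1)
  · simp [hD, prodPrimes_ne_zero]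

theorem selbergWeight_one (hD : 1 ≤ D) : selbergWeight s D 1 = 1 := by
  have h := (selbergDenom_pos (s := s) hD).ne'
  simp only [selbergWeight, one_dvd, if_true, true_and]
  rw [moebius_apply_one, s.nu_mult.map_one]
  simp only [Int.cast_one, inv_one, mul_one, one_mul]
  exact inv_mul_cancel₀ h

theorem selbergWeight_eq_zero {d : ℕ} (hd : D < d) : selbergWeight s D d = 0 := by
  unfold selbergWeight
  split_ifs with h
  · rw [filter_false_of_mem, sum_empty, mul_zero]
    rintro m hm ⟨hdm, hmD⟩
    have hm0 : 0 < m := Nat.pos_of_mem_divisors hm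
    exact absurd ((Nat.le_of_dvd hm0 hdm).trans hmD) (by omega)
  · rfl

/-- The identity `g(d)/ν(d) = ∑_{l ∣ d} g(l)`, for `g` the Selberg terms, turns the left side into a
sum of `g(l * (m/d))`. The integers `l * (m/d)` are at most `m ≤ D` and pairwise distinct, so this
is a subsum of the denominator. It yields weights bounded by `1`. -/
theorem nu_inv_mul_sum_selbergTerms_le {d : ℕ} (hd : d ∣ s.prodPrimes) :
    (s.nu d)⁻¹ * ∑ m ∈ s.prodPrimes.divisors with d ∣ m ∧ m ≤ D, s.selbergTerms m
      ≤ selbergDenom s D := by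
  have hd0 : 0 < d := Nat.pos_of_dvd_of_pos hd (Nat.pos_of_ne_zero prodPrimes_ne_zero)
  have hfac : ∀ m ∈ s.prodPrimes.divisors.filter (fun m => d ∣ m ∧ m ≤ D),
      (s.nu d)⁻¹ * s.selbergTerms m = ∑ l ∈ d.divisors, s.selbergTerms (l * (m / d)) := by
    intro m hm
    simp only [mem_filter, Nat.mem_divisors] at hm
    obtain ⟨⟨hmP, -⟩, ⟨k, rfl⟩, -⟩ := hm
    have hdk : d.Coprime k := Nat.coprime_of_squarefree_mul (squarefree_of_dvd_prodPrimes hmP)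
    rw [Nat.mul_div_cancel_left k hd0, selbergTerms_isMultiplicative.map_mul_of_coprime hdk,
      ← mul_assoc, mul_comm (s.nu d)⁻¹, ← sum_divisors_selbergTerms_eq_selbergTerms_mul_nu_inv hd,
      ← sum_filter, Nat.divisors_filter_dvd_of_dvd prodPrimes_ne_zero hd, sum_mul]
    refine sum_congr rfl fun l hl => ?_
    rw [selbergTerms_isMultiplicative.map_mul_of_coprime
      (hdk.coprime_dvd_left (Nat.dvd_of_mem_divisors hl))]
  rw [mul_sum, sum_congr rfl hfac, ← sum_product', selbergDenom]
  rw [← sum_image (f := s.selbergTerms) (g := fun x : ℕ × ℕ => x.2 * (x.1 / d))]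
  · refine sum_le_sum_of_subset_of_nonneg ?_ fun l hl _ =>
      (selbergTerms_pos (Nat.dvd_of_mem_divisors (mem_filter.1 hl).1)).le
    intro t ht
    simp only [mem_image, mem_product, mem_filter, Nat.mem_divisors, Prod.exists] at ht
    obtain ⟨m, l, ⟨⟨⟨hmP, hP⟩, ⟨k, rfl⟩, hmD⟩, hl, -⟩, rfl⟩ := ht
    rw [Nat.mul_div_cancel_left k hd0]
    have h1 : l * k ∣ d * k := mul_dvd_mul_right hl k
    have h2 : 0 < d * k := Nat.pos_of_dvd_of_pos hmP (Nat.pos_of_ne_zero hP)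
    simp only [mem_filter, Nat.mem_divisors]
    exact ⟨⟨h1.trans hmP, hP⟩, (Nat.le_of_dvd h2 h1).trans hmD⟩
  · rintro ⟨m, l⟩ hm ⟨m', l'⟩ hm' h
    simp only [coe_product, Set.mem_prod, mem_coe, mem_filter, Nat.mem_divisors] at hm hm'
    obtain ⟨⟨⟨hmP, hP⟩, ⟨k, rfl⟩, hmD⟩, hl, -⟩ := hm
    obtain ⟨⟨⟨hmP', -⟩, ⟨k', rfl⟩, hmD'⟩, hl', -⟩ := hm'
    simp only [Nat.mul_div_cancel_left _ hd0] at h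
    have hdk : d.Coprime k := Nat.coprime_of_squarefree_mul (squarefree_of_dvd_prodPrimes hmP)
    have hdk' : d.Coprime k' := Nat.coprime_of_squarefree_mul (squarefree_of_dvd_prodPrimes hmP')
    -- Injectivity: `l` is recovered as a gcd with `d`, since `k` is coprime to `d`.
    have e1 : Nat.gcd (l * k) d = l := by
      rw [Nat.Coprime.gcd_mul_right_cancel _ hdk.symm, Nat.gcd_eq_left hl]
    have e2 : Nat.gcd (l' * k') d = l' := by
      rw [Nat.Coprime.gcd_mul_right_cancel _ hdk'.symm, Nat.gcd_eq_left hl']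
    have hll : l = l' := by rw [← e1, ← e2, h]
    subst hll
    have hl0 : 0 < l := Nat.pos_of_dvd_of_pos hl hd0
    have hkk : k = k' := Nat.eq_of_mul_eq_mul_left hl0 h
    rw [hkk]

theorem abs_selbergWeight_le_one (hD : 1 ≤ D) (d : ℕ) : |selbergWeight s D d| ≤ 1 := by
  unfold selbergWeight
  split_ifs with hd
  · have hG := selbergDenom_pos (s := s) hD
    have hμ : |(μ d : ℝ)| ≤ 1 := by exact_mod_cast abs_moebius_le_one
    have h0 : 0 ≤ (s.nu d)⁻¹ * ∑ m ∈ s.prodPrimes.divisors with d ∣ m ∧ m ≤ D,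
        s.selbergTerms m :=
      mul_nonneg (inv_nonneg.2 (nu_pos_of_dvd_prodPrimes hd).le) (sum_nonneg fun m hm =>
        (selbergTerms_pos (Nat.dvd_of_mem_divisors (mem_filter.1 hm).1)).le)
    have h1 := nu_inv_mul_sum_selbergTerms_le (D := D) hd
    rw [show (μ d : ℝ) * (s.nu d)⁻¹ * (selbergDenom s D)⁻¹ *
      ∑ m ∈ s.prodPrimes.divisors with d ∣ m ∧ m ≤ D, s.selbergTerms m = μ d *
      (((s.nu d)⁻¹ * ∑ m ∈ s.prodPrimes.divisors with d ∣ m ∧ m ≤ D, s.selbergTerms m) /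
        selbergDenom s D) by field_simp, abs_mul, abs_of_nonneg (div_nonneg h0 hG.le)]
    exact mul_le_one₀ hμ (div_nonneg h0 hG.le) ((div_le_one hG).2 h1)
  · simp

/-- In diagonal form the main sum is `∑ g(l)⁻¹ y_l ^ 2`, and the weights were designed so that `y_l
= μ(l) g(l) / G` for `l ≤ D` and `0` beyond, where `G` is the denominator. -/
theorem mainSum_selbergWeight (hD : 1 ≤ D) :
    s.mainSum (lambdaSquared (selbergWeight s D)) = (selbergDenom s D)⁻¹ := by
  have hG := (selbergDenom_pos (s := s) hD).ne'
  rw [mainSum_lambdaSquared_eq_sum_mul_sum_sq]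
  have hinner : ∀ l ∈ s.prodPrimes.divisors,
      (∑ d ∈ s.prodPrimes.divisors, if l ∣ d then s.nu d * selbergWeight s D d else 0)
        = (selbergDenom s D)⁻¹ * if l ≤ D then μ l * s.selbergTerms l else 0 := by
    intro l hl
    have h1 : ∀ d ∈ s.prodPrimes.divisors,
        (if l ∣ d then s.nu d * selbergWeight s D d else 0) = (selbergDenom s D)⁻¹ *
          ∑ m ∈ s.prodPrimes.divisors.filter (· ≤ D),
            s.selbergTerms m * if l ∣ d ∧ d ∣ m then (μ d : ℝ) else 0 := by
      intro d hd
      have hdP := Nat.dvd_of_mem_divisors hd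
      have hν := nu_ne_zero hdP
      split_ifs with hld
      · rw [selbergWeight, if_pos hdP, filter_and_right, sum_filter]
        simp only [hld, true_and]
        rw [mul_sum, mul_sum, mul_sum]
        refine sum_congr rfl fun m _ => ?_
        split_ifs
        · field_simp
        · simp
      · simp [hld]
    rw [sum_congr rfl h1, ← mul_sum, sum_comm]
    congr 1
    simp_rw [← mul_sum, ← sum_filter]
    have h2 : ∀ m ∈ s.prodPrimes.divisors.filter (· ≤ D),
        s.selbergTerms m * ∑ d ∈ s.prodPrimes.divisors with l ∣ d ∧ d ∣ m, (μ d : ℝ)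
          = if m = l then μ l * s.selbergTerms l else 0 := by
      intro m hm
      have hmP := Nat.dvd_of_mem_divisors (mem_filter.1 hm).1
      rw [filter_and_right, Nat.divisors_filter_dvd_of_dvd prodPrimes_ne_zero hmP,
        sum_moebius_multiples (squarefree_of_dvd_prodPrimes hmP)]
      split_ifs with h
      · rw [h, mul_comm]
      · simp
    rw [sum_congr rfl h2, sum_ite_eq']
    simp [hl]
  have h3 : ∀ l ∈ s.prodPrimes.divisors, (s.selbergTerms l)⁻¹ *
      (∑ d ∈ s.prodPrimes.divisors, if l ∣ d then s.nu d * selbergWeight s D d else 0) ^ 2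
        = (selbergDenom s D)⁻¹ ^ 2 * if l ≤ D then s.selbergTerms l else 0 := by
    intro l hl
    rw [hinner l hl]
    have hlP := Nat.dvd_of_mem_divisors hl
    have hg := (selbergTerms_pos hlP).ne'
    have hμ : (μ l : ℝ) ^ 2 = 1 := by
      have := moebius_sq_eq_one_of_squarefree (squarefree_of_dvd_prodPrimes hlP)
      exact_mod_cast this
    split_ifs
    · rw [mul_pow, mul_pow, hμ]
      field_simp
    · simp
  rw [sum_congr rfl h3, ← mul_sum, ← sum_filter, ← selbergDenom]
  field_simp

/-- With remainders at most `1`, the error is at most the square of the `ℓ¹` norm of the weights,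
and these are bounded by `1` and vanish beyond `D`. -/
theorem errSum_selbergWeight_le (hD : 1 ≤ D) (hrem : ∀ d, d ∣ s.prodPrimes → |s.rem d| ≤ 1) :
    s.errSum (lambdaSquared (selbergWeight s D)) ≤ (D : ℝ) ^ 2 := by
  set w := selbergWeight s D
  have h1 : ∀ d ∈ s.prodPrimes.divisors, |lambdaSquared w d| * |s.rem d| ≤
      ∑ d1 ∈ s.prodPrimes.divisors, ∑ d2 ∈ s.prodPrimes.divisors,
        if d = Nat.lcm d1 d2 then |w d1| * |w d2| else 0 := by
    intro d hd
    have hdP := Nat.dvd_of_mem_divisors hd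
    have hsub : d.divisors ⊆ s.prodPrimes.divisors := Nat.divisors_subset_of_dvd
      prodPrimes_ne_zero hdP
    calc |lambdaSquared w d| * |s.rem d| ≤ |lambdaSquared w d| * 1 := by
          gcongr
          exact hrem d hdP
      _ ≤ ∑ d1 ∈ d.divisors, ∑ d2 ∈ d.divisors,
          if d = Nat.lcm d1 d2 then |w d1| * |w d2| else 0 := by
          rw [mul_one, lambdaSquared]
          refine (abs_sum_le_sum_abs _ _).trans (sum_le_sum fun d1 _ => ?_)
          refine (abs_sum_le_sum_abs _ _).trans (sum_le_sum fun d2 _ => ?_)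
          split_ifs
          · rw [abs_mul]
          · simp
      _ ≤ ∑ d1 ∈ d.divisors, ∑ d2 ∈ s.prodPrimes.divisors,
          if d = Nat.lcm d1 d2 then |w d1| * |w d2| else 0 := by
          gcongr
      _ ≤ _ := sum_le_sum_of_subset_of_nonneg hsub fun _ _ _ => by positivity
  have h2 : ∑ d ∈ s.prodPrimes.divisors, |w d| ≤ D := by
    have hz : ∑ d ∈ s.prodPrimes.divisors, |w d|
        = ∑ d ∈ s.prodPrimes.divisors with d ≤ D, |w d| := by
      rw [sum_filter]
      refine sum_congr rfl fun d _ => ?_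
      split_ifs with h
      · rfl
      · rw [show w d = 0 from selbergWeight_eq_zero (by omega), abs_zero]
    rw [hz]
    calc ∑ d ∈ s.prodPrimes.divisors with d ≤ D, |w d|
        ≤ ∑ d ∈ s.prodPrimes.divisors with d ≤ D, (1 : ℝ) :=
          sum_le_sum fun d _ => abs_selbergWeight_le_one hD d
      _ = ((s.prodPrimes.divisors.filter (· ≤ D)).card : ℝ) := by simp
      _ ≤ ((Ioc 0 D).card : ℝ) := by
          refine Nat.cast_le.2 (card_le_card fun d hd => ?_)
          rw [mem_filter] at hd
          exact mem_Ioc.2 ⟨Nat.pos_of_mem_divisors hd.1, hd.2⟩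
      _ = D := by simp
  calc s.errSum (lambdaSquared w)
      ≤ ∑ d ∈ s.prodPrimes.divisors, ∑ d1 ∈ s.prodPrimes.divisors,
          ∑ d2 ∈ s.prodPrimes.divisors, if d = Nat.lcm d1 d2 then |w d1| * |w d2| else 0 :=
        sum_le_sum h1
    _ = ∑ d1 ∈ s.prodPrimes.divisors, ∑ d2 ∈ s.prodPrimes.divisors,
          ∑ d ∈ s.prodPrimes.divisors, if d = Nat.lcm d1 d2 then |w d1| * |w d2| else 0 := by
        rw [sum_comm]
        exact sum_congr rfl fun _ _ => sum_comm
    _ ≤ ∑ d1 ∈ s.prodPrimes.divisors, ∑ d2 ∈ s.prodPrimes.divisors, |w d1| * |w d2| := by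
        gcongr
        rw [sum_ite_eq']
        split_ifs
        · rfl
        · positivity
    _ = (∑ d ∈ s.prodPrimes.divisors, |w d|) ^ 2 := by
        rw [sq, sum_mul_sum]
    _ ≤ (D : ℝ) ^ 2 := by
        gcongr

/-- Selberg's upper bound sieve, for remainders bounded by `1`. -/
theorem siftedSum_le_selberg (hD : 1 ≤ D) (hrem : ∀ d, d ∣ s.prodPrimes → |s.rem d| ≤ 1) :
    s.siftedSum ≤ s.totalMass * (selbergDenom s D)⁻¹ + (D : ℝ) ^ 2 := by
  have h := siftedSum_le_mainSum_errSum_of_upperMoebius (s := s) _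
    (upperMoebius_lambdaSquared (selbergWeight s D) (selbergWeight_one hD))
  rw [mainSum_selbergWeight hD] at h
  exact h.trans (by gcongr; exact errSum_selbergWeight_le hD hrem)

end Selberg

end CRTSets

/-! ### Rough numbers in residue classes -/

namespace CRTSets

section RoughNumbers

open Finset

theorem sum_inv_factoredNumbers_le (s T : Finset ℕ) (hT : ∀ m ∈ T, m ∈ Nat.factoredNumbers s) :
    ∑ m ∈ T, (m : ℝ)⁻¹ ≤ ∏ p ∈ s with p.Prime, (1 - (p : ℝ)⁻¹)⁻¹ := by
  let f : ℕ →* ℝ := (invMonoidHom : ℝ →* ℝ).comp (Nat.castRingHom ℝ).toMonoidHom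
  have hf : ∀ m, f m = (m : ℝ)⁻¹ := fun m => rfl
  obtain ⟨-, hH⟩ := EulerProduct.summable_and_hasSum_factoredNumbers_prod_filter_prime_geometric
    (f := f) (fun {p} hp => by
      rw [hf, norm_inv, Real.norm_natCast]
      exact inv_lt_one_of_one_lt₀ (by exact_mod_cast hp.one_lt)) s
  rw [← sum_attach]
  have hinj : Function.Injective
      (fun m : T => (⟨m.1, hT m.1 m.2⟩ : Nat.factoredNumbers s)) := by
    intro a b hab
    exact Subtype.ext (congrArg (fun t : Nat.factoredNumbers s => t.1) hab)
  have := sum_le_hasSum (T.attach.map ⟨_, hinj⟩) (fun m _ => by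
    rw [hf]; positivity) hH
  rw [sum_map] at this
  exact this

/-- The count is a difference of floors of two numbers that differ by exactly `Y / m`. -/
theorem abs_card_modEq_sub_le (Y c : ℕ) {m : ℕ} (hm : 0 < m) :
    |(((Ioc 0 Y).filter (· ≡ c [MOD m])).card : ℝ) - Y / m| ≤ 1 := by
  have h := Nat.Ioc_filter_modEq_card 0 Y hm c
  have hm0 : (0 : ℚ) < m := by exact_mod_cast hm
  have h1 : (((Nat.cast 0 : ℚ) - c) / m) ≤ ((Y : ℚ) - c) / m := by
    gcongr
    simp
  rw [max_eq_left (sub_nonneg.2 (Int.floor_mono h1))] at h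
  have h2 : ((((Ioc 0 Y).filter (· ≡ c [MOD m])).card : ℤ) : ℚ)
      = (⌊((Y : ℚ) - c) / m⌋ : ℚ) - (⌊((Nat.cast 0 : ℚ) - c) / m⌋ : ℚ) := by
    rw [h]
    push_cast
    rfl
  have h3 : |((((Ioc 0 Y).filter (· ≡ c [MOD m])).card : ℤ) : ℚ) - Y / m| ≤ 1 := by
    rw [h2, abs_le]
    have a1 := Int.floor_le (((Y : ℚ) - c) / m)
    have a2 := Int.lt_floor_add_one (((Y : ℚ) - c) / m)
    have a3 := Int.floor_le (((Nat.cast 0 : ℚ) - c) / m)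
    have a4 := Int.lt_floor_add_one (((Nat.cast 0 : ℚ) - c) / m)
    have a5 : ((Y : ℚ) - c) / m - ((Nat.cast 0 : ℚ) - c) / m = Y / m := by
      rw [← sub_div]; simp
    constructor <;> linarith
  have h4 := (Rat.cast_le (K := ℝ)).2 h3
  push_cast at h4
  exact h4

/-- The product of the primes up to `z` that do not divide `r`. -/
def siftPrimes (r z : ℕ) : ℕ := ∏ p ∈ z.primesLE with ¬ p ∣ r, p

theorem squarefree_prod_primes {s : Finset ℕ} (hs : ∀ p ∈ s, p.Prime) :
    Squarefree (∏ p ∈ s, p) := by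
  refine Finset.squarefree_prod_of_pairwise_isCoprime ?_ fun _ hp => (hs _ hp).squarefree
  intro p hp q hq hpq
  exact Nat.coprime_iff_isRelPrime.1 ((Nat.coprime_primes (hs p hp) (hs q hq)).2 hpq)

theorem siftPrimes_squarefree (r z : ℕ) : Squarefree (siftPrimes r z) :=
  squarefree_prod_primes fun _ hp => (Nat.mem_primesLE.1 (mem_filter.1 hp).1).2

theorem siftPrimes_coprime (r z : ℕ) : (siftPrimes r z).Coprime r := by
  refine Nat.Coprime.prod_left fun p hp => ?_
  rw [mem_filter, Nat.mem_primesLE] at hp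
  exact (Nat.Prime.coprime_iff_not_dvd hp.1.2).2 hp.2

/-- The arithmetic function `1 / d`. -/
noncomputable def invArith : ArithmeticFunction ℝ := ⟨fun d => (d : ℝ)⁻¹, by simp⟩

theorem invArith_apply (d : ℕ) : invArith d = (d : ℝ)⁻¹ := rfl

/-- Sieving the residue class `b` modulo `r` by the primes up to `z` prime to `r`. -/
noncomputable def progressionSieve (r b Y z : ℕ) : BoundingSieve where
  support := (Ioc 0 Y).filter (· ≡ b [MOD r])
  prodPrimes := siftPrimes r z
  prodPrimes_squarefree := siftPrimes_squarefree r z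
  weights := fun _ => 1
  weights_nonneg := fun _ => zero_le_one
  totalMass := Y / r
  nu := invArith
  nu_mult := ⟨by simp [invArith_apply], fun _ => by
    simp [invArith_apply, mul_comm]⟩
  nu_pos_of_prime := fun _ hp _ => by
    rw [invArith_apply]
    exact inv_pos.2 (by exact_mod_cast hp.pos)
  nu_lt_one_of_prime := fun _ hp _ => by
    rw [invArith_apply]
    exact inv_lt_one_of_one_lt₀ (by exact_mod_cast hp.one_lt)

/-- As `d` is coprime to `r`, the conditions `d ∣ s` and `s ≡ b` modulo `r` merge into one class
modulo `d * r`. -/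
theorem progressionSieve_rem_le {r b Y z d : ℕ} (hr : 1 ≤ r) (hd : d ∣ siftPrimes r z) :
    |(progressionSieve r b Y z).rem d| ≤ 1 := by
  have hd0 : 0 < d := Nat.pos_of_dvd_of_pos hd (siftPrimes_squarefree r z).ne_zero.bot_lt
  have hcop : d.Coprime r := (siftPrimes_coprime r z).coprime_dvd_left hd
  obtain ⟨c, hc1, hc2⟩ := Nat.chineseRemainder hcop 0 b
  have hset : ((Ioc 0 Y).filter (· ≡ b [MOD r])).filter (d ∣ ·)
      = (Ioc 0 Y).filter (· ≡ c [MOD d * r]) := by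
    rw [filter_filter]
    refine filter_congr fun s _ => ?_
    rw [← Nat.modEq_and_modEq_iff_modEq_mul hcop, ← Nat.modEq_zero_iff_dvd]
    exact ⟨fun h => ⟨h.2.trans hc1.symm, h.1.trans hc2.symm⟩,
      fun h => ⟨h.2.trans hc2, h.1.trans hc1⟩⟩
  have hms : (progressionSieve r b Y z).multSum d
      = (((Ioc 0 Y).filter (· ≡ c [MOD d * r])).card : ℝ) := by
    rw [← hset]
    simp [BoundingSieve.multSum, progressionSieve]
  rw [BoundingSieve.rem, hms]
  have h := abs_card_modEq_sub_le Y c (Nat.mul_pos hd0 hr)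
  rwa [show (progressionSieve r b Y z).nu d * (progressionSieve r b Y z).totalMass
    = Y / ((d * r : ℕ) : ℝ) by
      simp only [progressionSieve, invArith_apply]
      push_cast
      field_simp]

theorem totient_inv_eq {r : ℕ} (hr : 1 ≤ r) :
    (r : ℝ) / r.totient = ∏ p ∈ r.primeFactors, (1 - (p : ℝ)⁻¹)⁻¹ := by
  have h : (r.totient : ℝ) = r * ∏ p ∈ r.primeFactors, (1 - (p : ℝ)⁻¹) := by
    have := congrArg (fun t : ℚ => (t : ℝ)) (Nat.totient_eq_mul_prod_factors r)
    push_cast at this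
    exact this
  have hr0 : (r : ℝ) ≠ 0 := by positivity
  rw [h, prod_inv_distrib, div_mul_eq_div_div, div_self hr0, one_div]

/-- Bound `log z` by the harmonic sum and group `m ≤ z` by the product `l m` of its primes not
dividing `r`. In the group of `d` the cofactors `m / d` have all their primes in `d` or `r`, so
their reciprocals sum to at most an Euler product; the primes of `d` build the Selberg term of `d`
and those of `r` give `r / φ(r)`. -/
theorem log_le_selbergDenom {r b Y z : ℕ} (hr : 1 ≤ r) (hz : 1 ≤ z) :
    Real.log z ≤ r / r.totient * selbergDenom (progressionSieve r b Y z) z := by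
  set l : ℕ → ℕ := fun m => ∏ p ∈ m.primeFactors with ¬ p ∣ r, p with hl
  have hlm : ∀ m, l m ∣ m := fun m =>
    (prod_dvd_prod_of_subset _ _ _ (filter_subset _ _)).trans (Nat.prod_primeFactors_dvd m)
  have hlsq : ∀ m, Squarefree (l m) := fun m =>
    squarefree_prod_primes fun p hp => Nat.prime_of_mem_primeFactors (mem_filter.1 hp).1
  have hlpf : ∀ m, (l m).primeFactors = m.primeFactors.filter (¬ · ∣ r) := fun m =>
    Nat.primeFactors_prod fun p hp => Nat.prime_of_mem_primeFactors (mem_filter.1 hp).1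
  have hmaps : ∀ m ∈ Ioc 0 z, l m ∈ (siftPrimes r z).divisors.filter (· ≤ z) := by
    intro m hm
    rw [mem_Ioc] at hm
    rw [mem_filter, Nat.mem_divisors]
    refine ⟨⟨prod_dvd_prod_of_subset _ _ _ fun p hp => ?_, (siftPrimes_squarefree r z).ne_zero⟩,
      (Nat.le_of_dvd hm.1 (hlm m)).trans hm.2⟩
    rw [mem_filter] at hp ⊢
    exact ⟨Nat.mem_primesLE.2 ⟨(Nat.le_of_mem_primeFactors hp.1).trans hm.2,
      Nat.prime_of_mem_primeFactors hp.1⟩, hp.2⟩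
  have hharm : Real.log z ≤ ∑ m ∈ Ioc 0 z, (m : ℝ)⁻¹ := by
    have h1 := log_add_one_le_harmonic z
    rw [harmonic_eq_sum_Icc] at h1
    push_cast at h1
    refine (Real.log_le_log (by exact_mod_cast hz) (by linarith)).trans h1
  refine hharm.trans ?_
  rw [← sum_fiberwise_of_maps_to hmaps, selbergDenom, mul_sum]
  refine sum_le_sum fun d hd => ?_
  rw [mem_filter, Nat.mem_divisors] at hd
  have hd0 : d ≠ 0 := ne_zero_of_dvd_ne_zero hd.1.2 hd.1.1
  have hdr : d.Coprime r := (siftPrimes_coprime r z).coprime_dvd_left hd.1.1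
  have hterm : ∑ m ∈ Ioc 0 z with l m = d, (m : ℝ)⁻¹
      = (d : ℝ)⁻¹ * ∑ k ∈ ((Ioc 0 z).filter fun m => l m = d).image fun m => m / d, (k : ℝ)⁻¹ := by
    rw [sum_image, mul_sum]
    · refine sum_congr rfl fun m hm => ?_
      have hdm : d ∣ m := (mem_filter.1 hm).2 ▸ hlm m
      rw [← mul_inv, ← Nat.cast_mul, Nat.mul_div_cancel' hdm]
    · intro m hm m' hm' h
      have hdm : d ∣ m := (mem_filter.1 (mem_coe.1 hm)).2 ▸ hlm m
      have hdm' : d ∣ m' := (mem_filter.1 (mem_coe.1 hm')).2 ▸ hlm m'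
      rw [← Nat.mul_div_cancel' hdm, ← Nat.mul_div_cancel' hdm']
      exact congrArg (d * ·) h
  rw [hterm]
  have hbd := sum_inv_factoredNumbers_le (d.primeFactors ∪ r.primeFactors)
    (((Ioc 0 z).filter fun m => l m = d).image fun m => m / d) (by
      intro k hk
      rw [mem_image] at hk
      obtain ⟨m, hm, rfl⟩ := hk
      rw [mem_filter, mem_Ioc] at hm
      have hdm : d ∣ m := hm.2 ▸ hlm m
      have hk0 : m / d ≠ 0 := (Nat.div_pos (Nat.le_of_dvd hm.1.1 hdm) hd0.bot_lt).ne'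
      refine Nat.mem_factoredNumbers_of_primeFactors_subset hk0 fun p hp => ?_
      have hp1 : p.Prime := Nat.prime_of_mem_primeFactors hp
      have hpm : p ∣ m := (Nat.dvd_of_mem_primeFactors hp).trans (Nat.div_dvd_of_dvd hdm)
      rw [mem_union]
      by_cases hpr : p ∣ r
      · exact Or.inr (Nat.mem_primeFactors.2 ⟨hp1, hpr, by omega⟩)
      · left
        rw [← hm.2, hlpf, mem_filter]
        exact ⟨Nat.mem_primeFactors.2 ⟨hp1, hpm, by omega⟩, hpr⟩)
  rw [filter_true_of_mem (s := d.primeFactors ∪ r.primeFactors) (fun p hp => by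
    rcases mem_union.1 hp with h | h <;> exact Nat.prime_of_mem_primeFactors h),
    prod_union hdr.disjoint_primeFactors, ← totient_inv_eq hr] at hbd
  rw [BoundingSieve.selbergTerms_apply]
  simp only [progressionSieve, invArith_apply]
  calc (d : ℝ)⁻¹ * ∑ k ∈ ((Ioc 0 z).filter fun m => l m = d).image fun m => m / d, (k : ℝ)⁻¹
      ≤ (d : ℝ)⁻¹ * ((∏ p ∈ d.primeFactors, (1 - (p : ℝ)⁻¹)⁻¹) * (r / r.totient)) := by
        gcongr
    _ = _ := by ring

/-- The number of integers up to `Y` in a residue class modulo `r` without prime factors up to `z`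
not dividing `r`. -/
theorem card_rough_progression_le {r b Y z : ℕ} (hr : 1 ≤ r) (hz : 2 ≤ z) :
    (((Ioc 0 Y).filter fun s => s ≡ b [MOD r] ∧ (siftPrimes r z).Coprime s).card : ℝ)
      ≤ Y / (r.totient * Real.log z) + (z : ℝ) ^ 2 := by
  have hlog : 0 < Real.log z := Real.log_pos (by exact_mod_cast hz)
  have hφ : (0 : ℝ) < r.totient := by exact_mod_cast Nat.totient_pos.2 hr
  have hr0 : (0 : ℝ) < r := by exact_mod_cast hr
  have hG := selbergDenom_pos (s := progressionSieve r b Y z) (show 1 ≤ z by omega)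
  -- Level `z` costs an error `z ^ 2`. The factor `r / φ(r)` in `log_le_selbergDenom` turns the
  -- density `1 / r` into `1 / φ(r)`, so that a later sum over the `φ(r)` reduced classes is an
  -- exact average.
  have h := siftedSum_le_selberg (s := progressionSieve r b Y z) (D := z) (by omega)
    fun d hd => progressionSieve_rem_le hr hd
  have hs : (progressionSieve r b Y z).siftedSum = (((Ioc 0 Y).filter fun s => s ≡ b [MOD r] ∧
      (siftPrimes r z).Coprime s).card : ℝ) := by
    rw [← filter_filter, natCast_card_filter]
    rfl
  rw [hs] at h
  refine h.trans (add_le_add ?_ le_rfl)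
  have h2 := log_le_selbergDenom (b := b) (Y := Y) hr (show 1 ≤ z by omega)
  change (Y : ℝ) / r * _ ≤ _
  rw [div_mul_eq_mul_div, ← div_eq_mul_inv, div_div, div_le_div_iff₀ (by positivity) (by positivity)]
  have h3 : r.totient * Real.log z ≤ r * selbergDenom (progressionSieve r b Y z) z := by
    rw [div_mul_eq_mul_div, le_div_iff₀ hφ] at h2
    linarith
  calc (Y : ℝ) * (r.totient * Real.log z)
      ≤ Y * (r * selbergDenom (progressionSieve r b Y z) z) := by gcongr
    _ = _ := by ring

end RoughNumbers

end CRTSets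

/-! ### Exponential sums and the Chinese Remainder Theorem -/

namespace CRTSets

section WeylSums

open Finset

variable {n : ℕ} (A : (m : ℕ) → Set (Fin n → ZMod m))

theorem reduce_reduce {q r d : ℕ} (hr : r ∣ q) (hd : d ∣ r) (x : Fin n → ZMod q) :
    reduce hd (reduce hr x) = reduce (hd.trans hr) x := by
  funext i
  have h := RingHom.ext_zmod ((ZMod.castHom hd (ZMod d)).comp (ZMod.castHom hr (ZMod r)))
    (ZMod.castHom (hd.trans hr) (ZMod d))
  exact congrArg (fun f : ZMod q →+* ZMod d => f (x i)) h

-- By coprimality, a prime power exactly dividing one of the two factors exactly divides the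
-- product, so its condition is inherited.
variable {A} in
theorem reduce_mem_crtSet {r s : ℕ} (h : r.Coprime s) {x : Fin n → ZMod (r * s)} {d : ℕ}
    (hd : d ∣ r * s) (hdr : d = r ∨ d = s) (hx : x ∈ crtSet A (r * s)) :
    reduce hd x ∈ crtSet A d := by
  intro p v hv hp hv1 hnot
  rw [reduce_reduce]
  refine hx p v (hv.trans hd) hp hv1 fun hdvd => hnot ?_
  have hpd : p ∣ d := (dvd_pow_self p (by omega)).trans hv
  rcases hdr with rfl | rfl
  · have : p.Coprime s := h.coprime_dvd_left hpd
    exact (this.pow_left (v + 1)).dvd_of_dvd_mul_right hdvd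
  · have : p.Coprime r := h.symm.coprime_dvd_left hpd
    exact (this.pow_left (v + 1)).dvd_of_dvd_mul_left hdvd

theorem mem_crtSet_mul {r s : ℕ} (h : r.Coprime s) (x : Fin n → ZMod (r * s)) :
    x ∈ crtSet A (r * s) ↔
      reduce (dvd_mul_right r s) x ∈ crtSet A r ∧ reduce (dvd_mul_left s r) x ∈ crtSet A s := by
  refine ⟨fun hx => ⟨reduce_mem_crtSet h _ (Or.inl rfl) hx, reduce_mem_crtSet h _ (Or.inr rfl) hx⟩,
    fun ⟨h1, h2⟩ p v hv hp hv1 hnot => ?_⟩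
  have hprs : p ∣ r * s := (dvd_pow_self p (by omega)).trans hv
  rcases (Nat.Prime.dvd_mul hp).1 hprs with hpr | hps
  · have hps : p.Coprime s := h.coprime_dvd_left hpr
    have := h1 p v ((hps.pow_left v).dvd_of_dvd_mul_right hv) hp hv1
      fun hd => hnot (hd.trans (dvd_mul_right r s))
    rwa [reduce_reduce] at this
  · have hpr : p.Coprime r := h.symm.coprime_dvd_left hps
    have := h2 p v ((hpr.pow_left v).dvd_of_dvd_mul_left hv) hp hv1
      fun hd => hnot (hd.trans (dvd_mul_left s r))
    rwa [reduce_reduce] at this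

theorem chineseRemainder_fst {r s : ℕ} (h : r.Coprime s) (x : ZMod (r * s)) :
    (ZMod.chineseRemainder h x).1 = ZMod.castHom (dvd_mul_right r s) (ZMod r) x :=
  congrArg (fun f : ZMod (r * s) →+* ZMod r => f x) (RingHom.ext_zmod
    ((RingHom.fst (ZMod r) (ZMod s)).comp (ZMod.chineseRemainder h).toRingHom)
    (ZMod.castHom (dvd_mul_right r s) (ZMod r)))

theorem chineseRemainder_snd {r s : ℕ} (h : r.Coprime s) (x : ZMod (r * s)) :
    (ZMod.chineseRemainder h x).2 = ZMod.castHom (dvd_mul_left s r) (ZMod s) x :=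
  congrArg (fun f : ZMod (r * s) →+* ZMod s => f x) (RingHom.ext_zmod
    ((RingHom.snd (ZMod r) (ZMod s)).comp (ZMod.chineseRemainder h).toRingHom)
    (ZMod.castHom (dvd_mul_left s r) (ZMod s)))

/-- The Chinese Remainder Theorem for vectors. -/
noncomputable def crtEquiv (n : ℕ) {r s : ℕ} (h : r.Coprime s) :
    (Fin n → ZMod (r * s)) ≃ (Fin n → ZMod r) × (Fin n → ZMod s) :=
  (Equiv.piCongrRight fun _ => (ZMod.chineseRemainder h).toEquiv).trans
    (Equiv.arrowProdEquivProdArrow _ _ _)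

theorem crtEquiv_apply {r s : ℕ} (h : r.Coprime s) (x : Fin n → ZMod (r * s)) :
    crtEquiv n h x = (reduce (dvd_mul_right r s) x, reduce (dvd_mul_left s r) x) :=
  Prod.ext (funext fun i => chineseRemainder_fst h (x i))
    (funext fun i => chineseRemainder_snd h (x i))

/-- From a Bézout relation `u r + v s = 1` one gets `x/(rs) = v x/r + u x/s`, and `v`, `u` represent
the inverses of `s` modulo `r` and of `r` modulo `s`. -/
theorem stdAddChar_mul {r s : ℕ} [NeZero r] [NeZero s] [NeZero (r * s)] (h : r.Coprime s)
    (x : ZMod (r * s)) :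
    ZMod.stdAddChar x =
      ZMod.stdAddChar ((s : ZMod r)⁻¹ * ZMod.castHom (dvd_mul_right r s) (ZMod r) x) *
      ZMod.stdAddChar ((r : ZMod s)⁻¹ * ZMod.castHom (dvd_mul_left s r) (ZMod s) x) := by
  obtain ⟨j, rfl⟩ := ZMod.intCast_surjective x
  obtain ⟨u, v, huv⟩ := Nat.isCoprime_iff_coprime.2 h
  have hs : (s : ZMod r)⁻¹ = ((v : ℤ) : ZMod r) := by
    refine ZMod.inv_eq_of_mul_eq_one _ _ _ ?_
    have := congrArg (Int.cast : ℤ → ZMod r) huv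
    push_cast at this
    simpa [mul_comm] using this
  have hr : (r : ZMod s)⁻¹ = ((u : ℤ) : ZMod s) := by
    refine ZMod.inv_eq_of_mul_eq_one _ _ _ ?_
    have := congrArg (Int.cast : ℤ → ZMod s) huv
    push_cast at this
    simpa [mul_comm] using this
  rw [hs, hr, map_intCast (ZMod.castHom (dvd_mul_right r s) (ZMod r)),
    map_intCast (ZMod.castHom (dvd_mul_left s r) (ZMod s)), ← Int.cast_mul, ← Int.cast_mul, ZMod.stdAddChar_coe,
    ZMod.stdAddChar_coe, ZMod.stdAddChar_coe, ← Complex.exp_add]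
  congr 1
  have hr0 : (r : ℂ) ≠ 0 := by exact_mod_cast NeZero.ne r
  have hs0 : (s : ℂ) ≠ 0 := by exact_mod_cast NeZero.ne s
  have huv' : (u : ℂ) * r + v * s = 1 := by exact_mod_cast huv
  push_cast
  field_simp
  linear_combination (-(j : ℂ)) * huv'

/-- The exponential sum over `A_q` with integral frequency `h`, twisted by `b`. -/
noncomputable def expSum (h : Fin n → ℤ) (q : ℕ) [NeZero q] (b : ZMod q) : ℂ :=
  ∑ a : Fin n → ZMod q,
    (crtSet A q).indicator (fun a => ZMod.stdAddChar (b * ∑ i, (h i : ZMod q) * a i)) a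

theorem expSum_mul (h : Fin n → ℤ) {r s : ℕ} [NeZero r] [NeZero s] [NeZero (r * s)]
    (hrs : r.Coprime s) (b : ZMod (r * s)) :
    expSum A h (r * s) b =
      expSum A h r ((s : ZMod r)⁻¹ * ZMod.castHom (dvd_mul_right r s) (ZMod r) b) *
      expSum A h s ((r : ZMod s)⁻¹ * ZMod.castHom (dvd_mul_left s r) (ZMod s) b) := by
  unfold expSum
  rw [Fintype.sum_mul_sum, ← Fintype.sum_prod_type', ← (crtEquiv n hrs).sum_comp]
  refine Fintype.sum_congr _ _ fun a => ?_
  rw [crtEquiv_apply]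
  classical
  simp only [Set.indicator_apply, mem_crtSet_mul A hrs]
  by_cases h1 : reduce (dvd_mul_right r s) a ∈ crtSet A r
  · by_cases h2 : reduce (dvd_mul_left s r) a ∈ crtSet A s
    · rw [if_pos ⟨h1, h2⟩, if_pos h1, if_pos h2, stdAddChar_mul hrs]
      simp only [map_mul, map_sum, map_intCast, reduce, mul_assoc]
    · simp [h2]
  · simp [h1]

theorem expSum_zero (h : Fin n → ℤ) (q : ℕ) [NeZero q] : expSum A h q 0 = rho A q := by
  classical
  unfold expSum rho
  simp only [zero_mul, AddChar.map_zero_eq_one, Set.indicator_apply]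
  rw [sum_boole, Set.ncard_eq_toFinset_card']
  congr 2
  ext a
  simp

theorem norm_expSum_le (h : Fin n → ℤ) (q : ℕ) [NeZero q] (b : ZMod q) :
    ‖expSum A h q b‖ ≤ rho A q := by
  classical
  have h0 : ((rho A q : ℝ) : ℂ) = rho A q := by push_cast; rfl
  have h1 : (rho A q : ℝ) = ∑ a : Fin n → ZMod q, if a ∈ crtSet A q then (1 : ℝ) else 0 := by
    rw [sum_boole, rho, Set.ncard_eq_toFinset_card']
    congr 2
    ext a
    simp
  rw [h1]
  refine (norm_sum_le _ _).trans (sum_le_sum fun a _ => ?_)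
  rw [Set.indicator_apply]
  split_ifs
  · rw [AddChar.norm_apply]
  · simp

/-- This is the twisted multiplicativity of the exponential sums at frequency and twist zero. -/
theorem rho_mul {r s : ℕ} [NeZero r] [NeZero s] (h : r.Coprime s) :
    rho A (r * s) = rho A r * rho A s := by
  have : NeZero (r * s) := ⟨mul_ne_zero (NeZero.ne r) (NeZero.ne s)⟩
  have := expSum_mul A 0 h 0
  simp only [map_zero, mul_zero, expSum_zero] at this
  exact_mod_cast this

theorem crtSet_one : crtSet A 1 = Set.univ := by
  refine Set.eq_univ_of_forall fun x p v h hp hv _ => ?_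
  exact absurd (Nat.dvd_one.1 h) (Nat.one_lt_pow (by omega) hp.one_lt).ne'

theorem rho_one : rho A 1 = 1 := by
  rw [rho, crtSet_one, Set.ncard_univ]
  simp [Nat.card_eq_fintype_card]

theorem crtSet_prime {p : ℕ} (hp : p.Prime) : crtSet A p = A p := by
  have h : ∀ m, m = p ^ 1 → crtSet A m = A m := by
    rintro _ rfl
    exact crtSet_prime_pow A hp le_rfl
  exact h p (pow_one p).symm

/-- The mean of the normalised exponential sums over the reduced residue classes modulo `q`. -/
noncomputable def meanWeyl (h : Fin n → ℤ) (q : ℕ) : ℝ :=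
  if hq : q = 0 then 0 else
    haveI : NeZero q := ⟨hq⟩
    (∑ b : (ZMod q)ˣ, ‖expSum A h q b‖) / (q.totient * rho A q)

theorem meanWeyl_eq (h : Fin n → ℤ) (q : ℕ) [NeZero q] :
    meanWeyl A h q = (∑ b : (ZMod q)ˣ, ‖expSum A h q b‖) / (q.totient * rho A q) := by
  rw [meanWeyl, dif_neg (NeZero.ne q)]

theorem meanWeyl_zero (h : Fin n → ℤ) : meanWeyl A h 0 = 0 := by simp [meanWeyl]

theorem meanWeyl_nonneg (h : Fin n → ℤ) (q : ℕ) : 0 ≤ meanWeyl A h q := by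
  unfold meanWeyl
  split_ifs
  · rfl
  · exact div_nonneg (sum_nonneg fun _ _ => norm_nonneg _) (by positivity)

theorem sum_norm_expSum_le (h : Fin n → ℤ) (q : ℕ) [NeZero q] :
    ∑ b : (ZMod q)ˣ, ‖expSum A h q b‖ ≤ q.totient * rho A q := by
  calc ∑ b : (ZMod q)ˣ, ‖expSum A h q b‖ ≤ ∑ b : (ZMod q)ˣ, (rho A q : ℝ) :=
        sum_le_sum fun b _ => norm_expSum_le A h q b
    _ = q.totient * rho A q := by simp [ZMod.card_units_eq_totient]

theorem meanWeyl_le_one (h : Fin n → ℤ) (q : ℕ) : meanWeyl A h q ≤ 1 := by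
  rcases Nat.eq_zero_or_pos q with rfl | hq
  · rw [meanWeyl_zero]; exact zero_le_one
  · have : NeZero q := ⟨hq.ne'⟩
    rw [meanWeyl_eq]
    exact div_le_one_of_le₀ (sum_norm_expSum_le A h q) (by positivity)

theorem meanWeyl_eq_zero (h : Fin n → ℤ) {q : ℕ} (hq : rho A q = 0) : meanWeyl A h q = 0 := by
  unfold meanWeyl
  split_ifs
  · rfl
  · rw [hq]; simp

theorem meanWeyl_one (h : Fin n → ℤ) : meanWeyl A h 1 = 1 := by
  rw [meanWeyl_eq, rho_one]
  have h0 : ∀ b : (ZMod 1)ˣ, ‖expSum A h 1 b‖ = 1 := fun b => by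
    rw [Subsingleton.elim (b : ZMod 1) 0, expSum_zero, rho_one]
    simp
  simp [h0]

theorem sum_units_twist (h : Fin n → ℤ) {q : ℕ} [NeZero q] {c : ℕ} (hc : c.Coprime q) :
    ∑ b : (ZMod q)ˣ, ‖expSum A h q ((c : ZMod q)⁻¹ * b)‖ = ∑ b : (ZMod q)ˣ, ‖expSum A h q b‖ := by
  have := Equiv.sum_comp (Equiv.mulLeft (ZMod.unitOfCoprime c hc)⁻¹)
    (fun b : (ZMod q)ˣ => ‖expSum A h q b‖)
  rw [← this]
  refine Fintype.sum_congr _ _ fun b => ?_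
  rw [Equiv.coe_mulLeft, Units.val_mul, ← ZMod.coe_unitOfCoprime c hc, ZMod.inv_coe_unit]

/-- Single sums are multiplicative only up to twists by inverses; these permute the units, so
averaging over units removes them. -/
theorem meanWeyl_mul (h : Fin n → ℤ) {r s : ℕ} (hrs : r.Coprime s) :
    meanWeyl A h (r * s) = meanWeyl A h r * meanWeyl A h s := by
  rcases Nat.eq_zero_or_pos r with rfl | hr
  · simp [meanWeyl_zero]
  rcases Nat.eq_zero_or_pos s with rfl | hs
  · simp [meanWeyl_zero]
  have : NeZero r := ⟨hr.ne'⟩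
  have : NeZero s := ⟨hs.ne'⟩
  have : NeZero (r * s) := ⟨mul_ne_zero hr.ne' hs.ne'⟩
  rw [meanWeyl_eq, meanWeyl_eq, meanWeyl_eq, rho_mul A hrs, Nat.totient_mul hrs, div_mul_div_comm]
  congr 1
  · rw [← sum_units_twist A h hrs.symm, ← sum_units_twist A h hrs, Fintype.sum_mul_sum,
      ← Fintype.sum_prod_type',
      ← ((Units.mapEquiv (ZMod.chineseRemainder hrs).toMulEquiv).trans
        MulEquiv.prodUnits).toEquiv.sum_comp]
    refine Fintype.sum_congr _ _ fun b => ?_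
    rw [expSum_mul A h hrs, norm_mul, ← chineseRemainder_fst hrs, ← chineseRemainder_snd hrs]
    rfl
  · push_cast
    ring

/-- Only the part of the modulus prime to `s` matters for an upper bound. -/
theorem norm_expSum_div_le (h : Fin n → ℤ) {r s : ℕ} [NeZero r] [NeZero s] [NeZero (r * s)]
    (hrs : r.Coprime s) :
    ‖expSum A h (r * s) 1‖ / rho A (r * s) ≤ ‖expSum A h r (s : ZMod r)⁻¹‖ / rho A r := by
  rw [expSum_mul A h hrs, rho_mul A hrs, norm_mul, map_one, map_one, mul_one, mul_one,
    Nat.cast_mul, mul_div_mul_comm]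
  exact mul_le_of_le_one_right (by positivity)
    (div_le_one_of_le₀ (norm_expSum_le A h s _) (by positivity))

theorem lam_le_rho (hn : 1 ≤ n) {p : ℕ} (hp : p.Prime) : lam A p ≤ rho A p := by
  obtain ⟨H, -, hH⟩ := (lam_isGreatest A hn hp).1
  have : Fact p.Prime := ⟨hp⟩
  rw [hH, rho, crtSet_prime A hp]
  exact Set.ncard_le_ncard Set.inter_subset_right (Set.toFinite _)

/-- Parseval: the second moment is `p` times the number of pairs of points of `A_p` with equal value
of the linear form `h`. Because `h` is nonzero modulo `p`, the partners of a given point lie on one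
affine hyperplane. -/
theorem sum_sq_norm_expSum_le (hn : 1 ≤ n) (h : Fin n → ℤ) {p : ℕ} [Fact p.Prime]
    (hh : ∃ i, (h i : ZMod p) ≠ 0) :
    ∑ b : ZMod p, ‖expSum A h p b‖ ^ 2 ≤ p * (rho A p * lam A p) := by
  classical
  have hp : p.Prime := Fact.out
  set ψ : AddChar (ZMod p) ℂ := ZMod.stdAddChar
  set S : Finset (Fin n → ZMod p) := univ.filter (· ∈ crtSet A p) with hS
  set f : (Fin n → ZMod p) → ZMod p := fun a => ∑ i, (h i : ZMod p) * a i with hf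
  have hE : ∀ b, expSum A h p b = ∑ a ∈ S, ψ (b * f a) := fun b => by
    rw [expSum, hS, sum_filter]
    rfl
  have hcard : S.card = rho A p := by
    rw [rho, Set.ncard_eq_toFinset_card']
    congr 1
    ext a
    simp [hS]
  have h1 : ((∑ b : ZMod p, ‖expSum A h p b‖ ^ 2 : ℝ) : ℂ)
      = ∑ x ∈ S, ∑ y ∈ S, if f x - f y = 0 then (p : ℂ) else 0 := by
    push_cast
    calc ∑ b : ZMod p, (‖expSum A h p b‖ : ℂ) ^ 2
        = ∑ b : ZMod p, ∑ x ∈ S, ∑ y ∈ S, ψ (b * (f x - f y)) := by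
          refine Fintype.sum_congr _ _ fun b => ?_
          rw [← Complex.mul_conj', hE, map_sum, sum_mul_sum]
          refine sum_congr rfl fun x _ => sum_congr rfl fun y _ => ?_
          rw [mul_sub, sub_eq_add_neg, AddChar.map_add_eq_mul, AddChar.map_neg_eq_conj]
      _ = ∑ x ∈ S, ∑ y ∈ S, ∑ b : ZMod p, ψ (b * (f x - f y)) := by
          rw [sum_comm]
          exact sum_congr rfl fun _ _ => sum_comm
      _ = _ := by
          refine sum_congr rfl fun x _ => sum_congr rfl fun y _ => ?_
          rw [AddChar.sum_mulShift _ (ZMod.isPrimitive_stdAddChar p), ZMod.card]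
          push_cast
          rfl
  have h2 : ∑ b : ZMod p, ‖expSum A h p b‖ ^ 2
      = ∑ y ∈ S, (p : ℝ) * ((S.filter fun x => f x = f y).card : ℝ) := by
    have : ((∑ b : ZMod p, ‖expSum A h p b‖ ^ 2 : ℝ) : ℂ)
        = ((∑ y ∈ S, (p : ℝ) * ((S.filter fun x => f x = f y).card : ℝ) : ℝ) : ℂ) := by
      rw [h1, sum_comm]
      push_cast
      refine sum_congr rfl fun y _ => ?_
      simp only [sub_eq_zero]
      rw [← sum_filter, sum_const, nsmul_eq_mul, mul_comm]
    exact_mod_cast this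
  rw [h2]
  have h3 : ∀ y ∈ S, (p : ℝ) * ((S.filter fun x => f x = f y).card : ℝ) ≤ p * lam A p := by
    intro y _
    gcongr
    refine (lam_isGreatest A hn hp).2 ⟨{x | f x = f y}, ⟨fun i => (h i : ZMod p), f y, ?_, rfl⟩, ?_⟩
    · obtain ⟨i, hi⟩ := hh
      exact fun h0 => hi (congrFun h0 i)
    · rw [Set.ncard_eq_toFinset_card']
      congr 1
      ext x
      simp [hS, crtSet_prime A hp, and_comm]
  refine (sum_le_sum h3).trans ?_
  rw [sum_const, hcard, nsmul_eq_mul]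
  apply le_of_eq
  ring

/-- At a prime not dividing the frequency, the mean Weyl sum has the expected saving. -/
theorem meanWeyl_prime_le (hn : 1 ≤ n) (h : Fin n → ℤ) {p : ℕ} (hp : p.Prime)
    (hh : ∃ i, ¬ (p : ℤ) ∣ h i) (hρ : 1 ≤ rho A p) :
    meanWeyl A h p ≤ 1 - (1 - (lam A p : ℝ) / rho A p) / 2 := by
  have : Fact p.Prime := ⟨hp⟩
  have h2 := sum_sq_norm_expSum_le A hn h (p := p) (by
    obtain ⟨i, hi⟩ := hh
    exact ⟨i, fun h0 => hi ((ZMod.intCast_zmod_eq_zero_iff_dvd _ _).1 h0)⟩)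
  have hρ0 : (0 : ℝ) < rho A p := by exact_mod_cast hρ
  have hlρ : (lam A p : ℝ) ≤ rho A p := by exact_mod_cast lam_le_rho A hn hp
  have hp1 : (1 : ℝ) < p := by exact_mod_cast hp.one_lt
  have h3 : ∑ u : (ZMod p)ˣ, ‖expSum A h p u‖ ^ 2 + (rho A p : ℝ) ^ 2
      ≤ ∑ b : ZMod p, ‖expSum A h p b‖ ^ 2 := by
    classical
    rw [← add_sum_erase univ _ (mem_univ (0 : ZMod p)), expSum_zero, add_comm]
    simp only [Complex.norm_natCast]
    gcongr
    refine (sum_map univ ⟨((↑) : (ZMod p)ˣ → ZMod p), Units.val_injective⟩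
      (fun b => ‖expSum A h p b‖ ^ 2)).symm.le.trans ?_
    refine sum_le_sum_of_subset_of_nonneg (fun b hb => ?_) fun _ _ _ => by positivity
    rw [mem_map] at hb
    obtain ⟨u, -, rfl⟩ := hb
    exact mem_erase.2 ⟨u.ne_zero, mem_univ _⟩
  have hcs : (∑ u : (ZMod p)ˣ, ‖expSum A h p u‖) ^ 2
      ≤ (p - 1) * ∑ u : (ZMod p)ˣ, ‖expSum A h p u‖ ^ 2 := by
    have := sq_sum_le_card_mul_sum_sq (s := (univ : Finset (ZMod p)ˣ))
      (f := fun u => ‖expSum A h p u‖)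
    rw [card_univ, ZMod.card_units, Nat.cast_sub hp.one_lt.le] at this
    simpa using this
  have hm : meanWeyl A h p = (∑ u : (ZMod p)ˣ, ‖expSum A h p u‖) / ((p - 1) * rho A p) := by
    rw [meanWeyl_eq, Nat.totient_prime hp, Nat.cast_sub hp.one_lt.le, Nat.cast_one]
  set T := ∑ u : (ZMod p)ˣ, ‖expSum A h p u‖
  -- The term `b = 0` contributes `ρ ^ 2`. Removing it and using `λ ≤ ρ` replaces the factor `p` by
  -- `p - 1`, which matches the number of units in Cauchy–Schwarz with no loss.
  have hsq : meanWeyl A h p ^ 2 ≤ (lam A p : ℝ) / rho A p := by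
    rw [hm, div_pow, div_le_div_iff₀ (by have := sub_pos.2 hp1; positivity) hρ0]
    have h4 : T ^ 2 ≤ (p - 1) * (p * (rho A p * lam A p) - rho A p ^ 2) := by
      refine hcs.trans ?_
      have := sub_pos.2 hp1
      gcongr
      linarith
    have h5 : (p : ℝ) * (rho A p * lam A p) - rho A p ^ 2 ≤ (p - 1) * (rho A p * lam A p) := by
      nlinarith
    calc T ^ 2 * rho A p ≤ ((p - 1) * ((p - 1) * (rho A p * lam A p))) * rho A p := by
          gcongr
          refine h4.trans ?_
          have := sub_pos.2 hp1
          gcongr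
      _ = _ := by ring
  -- The inequality `w ≤ (1 + w ^ 2) / 2` linearises the square root; the exponent `1/2` of the
  -- saving originates here.
  nlinarith [sq_nonneg (meanWeyl A h p - 1)]

end WeylSums

end CRTSets

/-! ### Rankin's trick for moduli with a large smooth part -/

namespace CRTSets

section Rankin

open Finset

theorem sum_le_sum_of_injOn {ι κ : Type*} {s : Finset ι} {t : Finset κ} {f : ι → ℝ} {g : κ → ℝ}
    (i : ι → κ) (hi : ∀ a ∈ s, i a ∈ t) (hinj : Set.InjOn i s) (hfg : ∀ a ∈ s, f a ≤ g (i a))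
    (hg : ∀ b ∈ t, 0 ≤ g b) : ∑ a ∈ s, f a ≤ ∑ b ∈ t, g b := by
  classical
  calc ∑ a ∈ s, f a ≤ ∑ a ∈ s, g (i a) := sum_le_sum hfg
    _ = ∑ b ∈ s.image i, g b := (sum_image hinj).symm
    _ ≤ ∑ b ∈ t, g b := sum_le_sum_of_subset_of_nonneg (image_subset_iff.2 hi) fun b hb _ => hg b hb

theorem exp_sub_one_le {t : ℝ} (h0 : 0 ≤ t) (h1 : t ≤ 1) : Real.exp t - 1 ≤ 2 * t := by
  have := Real.abs_exp_sub_one_le (x := t) (by rwa [abs_of_nonneg h0])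
  rw [abs_of_nonneg h0] at this
  exact (le_abs_self _).trans this

/-- The largest divisor of `q` composed of primes up to `z`. -/
def smoothPart (z q : ℕ) : ℕ := ∏ p ∈ q.primeFactors with p ≤ z, p ^ q.factorization p

/-- The largest divisor of `q` composed of primes larger than `z`. -/
def roughPart (z q : ℕ) : ℕ := ∏ p ∈ q.primeFactors with ¬ p ≤ z, p ^ q.factorization p

theorem smoothPart_mul_roughPart (z : ℕ) {q : ℕ} (hq : q ≠ 0) :
    smoothPart z q * roughPart z q = q := by
  rw [smoothPart, roughPart, prod_filter_mul_prod_filter_not]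
  exact Nat.prod_factorization_pow_eq_self hq

theorem smoothPart_pos (z q : ℕ) : 0 < smoothPart z q :=
  prod_pos fun _ hp => pow_pos (Nat.prime_of_mem_primeFactors (mem_filter.1 hp).1).pos _

theorem roughPart_pos (z q : ℕ) : 0 < roughPart z q :=
  prod_pos fun _ hp => pow_pos (Nat.prime_of_mem_primeFactors (mem_filter.1 hp).1).pos _

theorem smoothPart_coprime_roughPart (z q : ℕ) : (smoothPart z q).Coprime (roughPart z q) := by
  refine Nat.Coprime.prod_left fun p hp => Nat.Coprime.prod_right fun r hr => ?_
  rw [mem_filter] at hp hr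
  refine Nat.Coprime.pow _ _ ((Nat.coprime_primes (Nat.prime_of_mem_primeFactors hp.1)
    (Nat.prime_of_mem_primeFactors hr.1)).2 ?_)
  rintro rfl
  exact hr.2 hp.2

theorem siftPrimes_coprime_roughPart (r z q : ℕ) : (siftPrimes r z).Coprime (roughPart z q) := by
  refine Nat.Coprime.prod_left fun p hp => Nat.Coprime.prod_right fun r hr => ?_
  rw [mem_filter, Nat.mem_primesLE] at hp
  rw [mem_filter] at hr
  refine Nat.Coprime.pow_right _ ((Nat.coprime_primes hp.1.2
    (Nat.prime_of_mem_primeFactors hr.1)).2 ?_)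
  rintro rfl
  exact hr.2 hp.1.1

theorem smoothPart_mem_factoredNumbers (z q : ℕ) :
    smoothPart z q ∈ Nat.factoredNumbers z.primesLE := by
  refine Nat.mem_factoredNumbers_of_primeFactors_subset (smoothPart_pos z q).ne' fun r hr => ?_
  rw [Nat.mem_primeFactors] at hr
  obtain ⟨p, hp, hrp⟩ := (hr.1.prime.dvd_finsetProd_iff _).1 hr.2.1
  rw [mem_filter] at hp
  rw [(Nat.prime_dvd_prime_iff_eq hr.1 (Nat.prime_of_mem_primeFactors hp.1)).1
    (hr.1.dvd_of_dvd_pow hrp)]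
  exact Nat.mem_primesLE.2 ⟨hp.2, Nat.prime_of_mem_primeFactors hp.1⟩

theorem smoothPart_mul (z : ℕ) {a b : ℕ} (h : a.Coprime b) :
    smoothPart z (a * b) = smoothPart z a * smoothPart z b := by
  unfold smoothPart
  rw [h.primeFactors_mul, filter_union, prod_union
    (disjoint_filter_filter h.disjoint_primeFactors)]
  congr 1
  · refine prod_congr rfl fun p hp => ?_
    rw [Nat.factorization_eq_of_coprime_left h
      (Nat.mem_primeFactors_iff_mem_primeFactorsList.1 (mem_filter.1 hp).1)]
  · refine prod_congr rfl fun p hp => ?_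
    rw [Nat.factorization_eq_of_coprime_right h
      (Nat.mem_primeFactors_iff_mem_primeFactorsList.1 (mem_filter.1 hp).1)]

theorem smoothPart_one (z : ℕ) : smoothPart z 1 = 1 := by simp [smoothPart]

theorem smoothPart_le (z : ℕ) {q : ℕ} (hq : q ≠ 0) : smoothPart z q ≤ q :=
  Nat.le_of_dvd hq.bot_lt (Dvd.intro _ (smoothPart_mul_roughPart z hq))

theorem smoothPart_prime (z : ℕ) {p : ℕ} (hp : p.Prime) :
    smoothPart z p = if p ≤ z then p else 1 := by
  rw [smoothPart, hp.primeFactors, filter_singleton]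
  split_ifs <;> simp [hp.factorization_self]

theorem log_eq_sum_log_prime_pow {q : ℕ} (hq : q ≠ 0) :
    Real.log q = ∑ p ∈ q.primeFactors, Real.log ((p ^ q.factorization p : ℕ) : ℝ) := by
  rw [← Real.log_prod fun p hp => by
    exact_mod_cast (pow_pos (Nat.prime_of_mem_primeFactors hp).pos _).ne', ← Nat.cast_prod]
  congr 2
  exact (Nat.prod_factorization_pow_eq_self hq).symm

/-- A weighted count of products by means of the logarithms of the prime power components. -/
theorem sum_mul_log_le {F : ℕ → ℝ} (h0 : ∀ m, 0 ≤ F m)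
    (hmul : ∀ {m k : ℕ}, m.Coprime k → F (m * k) = F m * F k) {K : ℝ}
    (hK : ∀ Y : ℕ, ∑ d ∈ Ioc 0 Y with IsPrimePow d, F d * Real.log d ≤ K * Y) (N : ℕ) :
    ∑ q ∈ Ioc 0 N, F q * Real.log q ≤ K * N * ∑ m ∈ Ioc 0 N, F m / m := by
  have h1 : ∑ q ∈ Ioc 0 N, F q * Real.log q = ∑ x ∈ (Ioc 0 N).sigma fun q => q.primeFactors,
      F x.1 * Real.log ((x.2 ^ x.1.factorization x.2 : ℕ) : ℝ) := by
    rw [sum_sigma]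
    refine sum_congr rfl fun q hq => ?_
    rw [log_eq_sum_log_prime_pow (by rw [mem_Ioc] at hq; omega), mul_sum]
  have hlog : ∀ d : ℕ, 0 ≤ Real.log d := fun d => Real.log_natCast_nonneg d
  calc ∑ q ∈ Ioc 0 N, F q * Real.log q
      ≤ ∑ y ∈ (Ioc 0 N).sigma fun m => (Ioc 0 (N / m)).filter IsPrimePow,
          F y.1 * (F y.2 * Real.log y.2) := by
        rw [h1]
        -- Split `q` as `m * d`, where `d` is the exact power of `p` in `q`. Multiplicativity
        -- applies because `m` and `d` are coprime, and `p` is recovered as the least prime factor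
        -- of `d`.
        refine sum_le_sum_of_injOn (fun x : (_ : ℕ) × ℕ =>
          (⟨x.1 / x.2 ^ x.1.factorization x.2, x.2 ^ x.1.factorization x.2⟩ : (_ : ℕ) × ℕ))
          ?_ ?_ ?_ ?_
        · rintro ⟨q, p⟩ hx
          simp only [mem_sigma, mem_Ioc, mem_filter] at hx ⊢
          obtain ⟨⟨hq0, hqN⟩, hp⟩ := hx
          have hpp := Nat.prime_of_mem_primeFactors hp
          have hd := Nat.ordProj_dvd q p
          have hpos : 0 < p ^ q.factorization p := pow_pos hpp.pos _
          have hv : 0 < q.factorization p := hpp.factorization_pos_of_dvd hq0.ne'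
            (Nat.dvd_of_mem_primeFactors hp)
          have hm : 0 < q / p ^ q.factorization p := Nat.div_pos (Nat.le_of_dvd hq0 hd) hpos
          refine ⟨⟨hm, (Nat.div_le_self _ _).trans hqN⟩, ⟨hpos, ?_⟩,
            hpp.isPrimePow.pow hv.ne'⟩
          rw [Nat.le_div_iff_mul_le hm, Nat.mul_div_cancel' hd]
          exact hqN
        · rintro ⟨q, p⟩ hx ⟨q', p'⟩ hx' h
          simp only [coe_sigma, Set.mem_sigma_iff, mem_coe, mem_Ioc] at hx hx'
          simp only [Sigma.mk.injEq, heq_eq_eq] at h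
          have hpp := Nat.prime_of_mem_primeFactors hx.2
          have hpp' := Nat.prime_of_mem_primeFactors hx'.2
          have hv : 0 < q.factorization p := hpp.factorization_pos_of_dvd hx.1.1.ne'
            (Nat.dvd_of_mem_primeFactors hx.2)
          have hv' : 0 < q'.factorization p' := hpp'.factorization_pos_of_dvd hx'.1.1.ne'
            (Nat.dvd_of_mem_primeFactors hx'.2)
          have e1 : q = q' := by
            rw [← Nat.mul_div_cancel' (Nat.ordProj_dvd q p),
              ← Nat.mul_div_cancel' (Nat.ordProj_dvd q' p'), h.1, h.2]
          have e2 : p = p' := by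
            rw [← hpp.pow_minFac hv.ne', ← hpp'.pow_minFac hv'.ne', h.2]
          rw [e1, e2]
        · rintro ⟨q, p⟩ hx
          simp only [mem_sigma, mem_Ioc] at hx
          have hpp := Nat.prime_of_mem_primeFactors hx.2
          have hc := (Nat.coprime_ordCompl hpp hx.1.1.ne').pow_left (q.factorization p)
          dsimp only
          rw [← mul_assoc, ← hmul hc.symm, Nat.div_mul_cancel (Nat.ordProj_dvd q p)]
        · intro y _
          exact mul_nonneg (h0 _) (mul_nonneg (h0 _) (hlog _))
    _ = ∑ m ∈ Ioc 0 N, F m * ∑ d ∈ Ioc 0 (N / m) with IsPrimePow d, F d * Real.log d := by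
        rw [sum_sigma]
        exact sum_congr rfl fun m _ => by rw [mul_sum]
    _ ≤ ∑ m ∈ Ioc 0 N, F m * (K * (N / m)) := by
        refine sum_le_sum fun m _ => mul_le_mul_of_nonneg_left ((hK (N / m)).trans ?_) (h0 m)
        have hK0 : 0 ≤ K := by
          have := (sum_nonneg fun d _ => mul_nonneg (h0 d) (hlog d)).trans (hK 1)
          simpa using this
        gcongr
        exact Nat.cast_div_le
    _ = K * N * ∑ m ∈ Ioc 0 N, F m / m := by
        rw [mul_sum]
        refine sum_congr rfl fun m _ => by ring

/-- Proper prime powers contribute little to weighted Chebyshev sums. -/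
theorem sum_properPrimePow_le (Y : ℕ) :
    ∑ d ∈ Ioc 0 Y with IsPrimePow d ∧ ¬ d.Prime, (d : ℝ) ^ (-(9 / 10) : ℝ) ≤ primePowerConst := by
  calc ∑ d ∈ Ioc 0 Y with IsPrimePow d ∧ ¬ d.Prime, (d : ℝ) ^ (-(9 / 10) : ℝ)
      ≤ ∑ x ∈ (Y.primesLE).sigma fun _ => range Y, ((x.1 : ℝ) ^ (-(9 / 10) : ℝ)) ^ (x.2 + 2) := by
        have key : ∀ d ∈ (Ioc 0 Y).filter (fun d => IsPrimePow d ∧ ¬ d.Prime),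
            d.minFac.Prime ∧ 2 ≤ d.factorization d.minFac ∧
              d.minFac ^ d.factorization d.minFac = d ∧ 0 < d ∧ d ≤ Y := by
          intro d hd
          simp only [mem_filter, mem_Ioc] at hd
          have hpw := hd.2.1.minFac_pow_factorization_eq
          have hmp := Nat.minFac_prime hd.2.1.one_lt.ne'
          refine ⟨hmp, ?_, hpw, hd.1⟩
          by_contra hlt
          interval_cases h : d.factorization d.minFac
          · rw [pow_zero] at hpw
            exact hd.2.1.one_lt.ne hpw
          · rw [pow_one] at hpw
            exact hd.2.2 (hpw ▸ hmp)
        refine sum_le_sum_of_injOn (fun d : ℕ =>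
          (⟨d.minFac, d.factorization d.minFac - 2⟩ : (_ : ℕ) × ℕ)) ?_ ?_ ?_ ?_
        · intro d hd
          obtain ⟨hp, hv, hpw, hd0, hdY⟩ := key d hd
          simp only [mem_sigma, Nat.mem_primesLE, mem_range]
          refine ⟨⟨(Nat.minFac_le hd0).trans hdY, hp⟩, ?_⟩
          have := (d.factorization d.minFac).lt_pow_self hp.one_lt
          omega
        · intro d hd d' hd' h
          obtain ⟨hp, hv, hpw, -⟩ := key d hd
          obtain ⟨hp', hv', hpw', -⟩ := key d' hd'
          simp only [Sigma.mk.injEq, heq_eq_eq] at h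
          rw [← hpw, ← hpw', show d.factorization d.minFac = d'.factorization d'.minFac by omega,
            h.1]
        · intro d hd
          obtain ⟨hp, hv, hpw, -⟩ := key d hd
          dsimp only
          rw [Nat.sub_add_cancel hv, Real.rpow_pow_comm (by positivity), ← Nat.cast_pow, hpw]
        · intro x _
          positivity
    _ = ∑ p ∈ Y.primesLE, ∑ k ∈ range Y, ((p : ℝ) ^ (-(9 / 10) : ℝ)) ^ (k + 2) := sum_sigma _ _ _
    _ ≤ ∑ p ∈ Y.primesLE, 3 * (p : ℝ) ^ (-(9 / 5) : ℝ) := by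
        refine sum_le_sum fun p hp => ?_
        obtain ⟨h1, h2⟩ := tsum_geometric_tail_le (Nat.mem_primesLE.1 hp).2.two_le
        exact (h1.sum_le_tsum _ fun _ _ => by positivity).trans h2
    _ ≤ primePowerConst := sum_primePowerConst_le _

variable {n : ℕ} (A : (m : ℕ) → Set (Fin n → ZMod m))

theorem mem_modsUpTo {N q : ℕ} : q ∈ modsUpTo A (N : ℝ) ↔ (1 ≤ q ∧ q ≤ N) ∧ 1 ≤ rho A q := by
  classical
  simp [modsUpTo]

theorem mem_primesUpTo {N p : ℕ} : p ∈ primesUpTo A (N : ℝ) ↔ p ≤ N ∧ p.Prime ∧ 1 ≤ rho A p := by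
  classical
  simp only [primesUpTo, Nat.floor_natCast, mem_filter, mem_Icc]
  exact ⟨fun h => ⟨h.1.2, h.2⟩, fun h => ⟨⟨h.2.1.one_lt.le, h.1⟩, h.2⟩⟩

/-- The sum of reciprocals of the primes `p ≤ N` with `ρ(p) ≥ 1`. -/
noncomputable def recipSum (N : ℕ) : ℝ := ∑ p ∈ primesUpTo A (N : ℝ), 1 / (p : ℝ)

theorem one_le_rho_mul {r s : ℕ} (h : r.Coprime s) :
    1 ≤ rho A (r * s) ↔ 1 ≤ rho A r ∧ 1 ≤ rho A s := by
  rcases Nat.eq_zero_or_pos r with rfl | hr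
  · rw [Nat.coprime_zero_left] at h
    subst h
    simp [rho_one]
  rcases Nat.eq_zero_or_pos s with rfl | hs
  · rw [Nat.coprime_zero_right] at h
    subst h
    simp [rho_one]
  have : NeZero r := ⟨hr.ne'⟩
  have : NeZero s := ⟨hs.ne'⟩
  rw [rho_mul A h]
  constructor
  · intro h1
    exact ⟨Nat.pos_of_mul_pos_right h1, Nat.pos_of_mul_pos_left h1⟩
  · rintro ⟨h1, h2⟩
    exact Nat.mul_pos h1 h2

open Classical in
/-- Rankin's weight, on the moduli with `ρ(q) ≥ 1`. -/
noncomputable def rankinWeight (z : ℕ) (η : ℝ) (q : ℕ) : ℝ :=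
  if 1 ≤ rho A q then (smoothPart z q : ℝ) ^ η else 0

theorem rankinWeight_nonneg (z : ℕ) (η : ℝ) (q : ℕ) : 0 ≤ rankinWeight A z η q := by
  unfold rankinWeight
  split_ifs <;> positivity

theorem rankinWeight_one (z : ℕ) (η : ℝ) : rankinWeight A z η 1 = 1 := by
  simp [rankinWeight, rho_one, smoothPart_one]

theorem rankinWeight_mul (z : ℕ) (η : ℝ) {r s : ℕ} (h : r.Coprime s) :
    rankinWeight A z η (r * s) = rankinWeight A z η r * rankinWeight A z η s := by
  unfold rankinWeight
  simp only [one_le_rho_mul A h, smoothPart_mul z h]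
  by_cases h1 : 1 ≤ rho A r
  · by_cases h2 : 1 ≤ rho A s
    · rw [if_pos ⟨h1, h2⟩, if_pos h1, if_pos h2, Nat.cast_mul, Real.mul_rpow] <;> positivity
    · simp [h2]
  · simp [h1]

theorem rankinWeight_le (z : ℕ) {η : ℝ} (hη : 0 ≤ η) {q : ℕ} (hq : q ≠ 0) :
    rankinWeight A z η q ≤ (q : ℝ) ^ η := by
  unfold rankinWeight
  split_ifs
  · gcongr
    exact smoothPart_le z hq
  · positivity

/-- The exponent `1 / log z` is the largest for which `p ^ η` stays bounded for all `p ≤ z`; there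
`exp t - 1 ≤ 2 t` on `[0, 1]` isolates an excess of order `log p / log z`. -/
theorem rankinWeight_prime_le {z : ℕ} (hz : 20 ≤ Real.log z) {p : ℕ} (hp : p.Prime) :
    rankinWeight A z (Real.log z)⁻¹ p ≤ (if 1 ≤ rho A p then 1 else 0) +
      if p ≤ z then 2 * (Real.log z)⁻¹ * Real.log p else 0 := by
  have hp0 : (0 : ℝ) < p := by exact_mod_cast hp.pos
  have hlp : 0 ≤ Real.log p := Real.log_natCast_nonneg p
  unfold rankinWeight
  rw [smoothPart_prime z hp]
  split_ifs with h1 h2 h2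
  · rw [Real.rpow_def_of_pos hp0]
    have h3 : Real.log p * (Real.log z)⁻¹ ≤ 1 := by
      rw [mul_inv_le_iff₀ (by linarith), one_mul]
      exact Real.log_le_log hp0 (by exact_mod_cast h2)
    have := exp_sub_one_le (mul_nonneg hlp (by positivity)) h3
    linarith
  · simp
  · positivity
  · simp

/-- On primes the weight is at most `3` and Chebyshev's bound applies. On proper powers `20 ≤ log z`
makes the weight at most `d ^ (1/20)`; with `log d ≤ 20 d ^ (1/20)` the term is at most `20 d * d ^
(-9/10)`, whose second factor is summable over proper powers. -/
theorem rankinWeight_chebyshev {z : ℕ} (hz : 20 ≤ Real.log z) (Y : ℕ) :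
    ∑ d ∈ Ioc 0 Y with IsPrimePow d, rankinWeight A z (Real.log z)⁻¹ d * Real.log d
      ≤ (3 * Real.log 4 + 20 * primePowerConst) * Y := by
  have hη : (Real.log z)⁻¹ ≤ 1 / 20 := by
    rw [one_div]
    exact inv_anti₀ (by norm_num) hz
  have hη0 : 0 ≤ (Real.log z)⁻¹ := by positivity
  rw [← sum_filter_add_sum_filter_not _ Nat.Prime, filter_filter, filter_filter, add_mul]
  refine add_le_add ?_ ?_
  · calc ∑ d ∈ Ioc 0 Y with IsPrimePow d ∧ d.Prime, rankinWeight A z (Real.log z)⁻¹ d * Real.log d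
        ≤ ∑ p ∈ Y.primesLE, 3 * Real.log p := by
          refine sum_le_sum_of_injOn id ?_ (fun _ _ _ _ h => h) ?_ ?_
          · intro p hp
            simp only [mem_filter, mem_Ioc] at hp
            exact Nat.mem_primesLE.2 ⟨hp.1.2, hp.2.2⟩
          · intro p hp
            have hpp := (mem_filter.1 hp).2.2
            refine mul_le_mul_of_nonneg_right ((rankinWeight_prime_le A hz hpp).trans ?_)
              (Real.log_natCast_nonneg p)
            have h1 : (if 1 ≤ rho A p then (1 : ℝ) else 0) ≤ 1 := by split_ifs <;> norm_num
            have h2 : (if p ≤ z then 2 * (Real.log z)⁻¹ * Real.log p else 0) ≤ 2 := by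
              split_ifs with h
              · have h3 : (Real.log z)⁻¹ * Real.log p ≤ 1 := by
                  rw [inv_mul_le_iff₀ (by linarith), mul_one]
                  exact Real.log_le_log (by exact_mod_cast hpp.pos) (by exact_mod_cast h)
                linarith
              · norm_num
            linarith
          · intro p _
            exact mul_nonneg (by norm_num) (Real.log_natCast_nonneg p)
      _ = 3 * Chebyshev.theta Y := by rw [Chebyshev.theta_eq_sum_primesLE_log, mul_sum]
      _ ≤ 3 * Real.log 4 * Y := by
          have := Chebyshev.theta_le_log4_mul_x (x := (Y : ℝ)) (by positivity)
          linarith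
  · calc ∑ d ∈ Ioc 0 Y with IsPrimePow d ∧ ¬ d.Prime,
          rankinWeight A z (Real.log z)⁻¹ d * Real.log d
        ≤ ∑ d ∈ Ioc 0 Y with IsPrimePow d ∧ ¬ d.Prime,
          20 * Y * (d : ℝ) ^ (-(9 / 10) : ℝ) := by
          refine sum_le_sum fun d hd => ?_
          simp only [mem_filter, mem_Ioc] at hd
          have hd0 : (0 : ℝ) < d := by exact_mod_cast hd.1.1
          have hd1 : (1 : ℝ) ≤ d := by exact_mod_cast hd.1.1
          have hdY : (d : ℝ) ≤ Y := by exact_mod_cast hd.1.2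
          have h1 : rankinWeight A z (Real.log z)⁻¹ d ≤ (d : ℝ) ^ (1 / 20 : ℝ) :=
            (rankinWeight_le A z hη0 (by omega)).trans (Real.rpow_le_rpow_of_exponent_le hd1 hη)
          have h2 : Real.log d ≤ 20 * (d : ℝ) ^ (1 / 20 : ℝ) := by
            have := Real.log_natCast_le_rpow_div d (ε := 1 / 20) (by norm_num)
            linarith
          calc rankinWeight A z (Real.log z)⁻¹ d * Real.log d
              ≤ (d : ℝ) ^ (1 / 20 : ℝ) * (20 * (d : ℝ) ^ (1 / 20 : ℝ)) := by
                gcongr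
            _ = 20 * d * (d : ℝ) ^ (-(9 / 10) : ℝ) := by
                rw [mul_left_comm, ← Real.rpow_add hd0, mul_assoc, ← Real.rpow_one_add' (by positivity)
                  (by norm_num)]
                norm_num
            _ ≤ _ := by gcongr
      _ = 20 * Y * ∑ d ∈ Ioc 0 Y with IsPrimePow d ∧ ¬ d.Prime, (d : ℝ) ^ (-(9 / 10) : ℝ) := by
          rw [mul_sum]
      _ ≤ 20 * Y * primePowerConst := by
          gcongr
          exact sum_properPrimePow_le Y
      _ = _ := by ring

/-- The weight inflates the Euler product only by a constant: the excess over `1/p` sums to at most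
`(2 / log z) * (2 log z) = 4`. -/
theorem sum_rankinWeight_div_le {z : ℕ} (hz : 20 ≤ Real.log z) (N : ℕ) :
    ∑ m ∈ Ioc 0 N, rankinWeight A z (Real.log z)⁻¹ m / m
      ≤ Real.exp primePowerConst * Real.exp (recipSum A N + 4) := by
  have hz1 : 1 ≤ z := by
    rcases Nat.eq_zero_or_pos z with rfl | h
    · norm_num at hz
    · exact h
  have hη : (Real.log z)⁻¹ ≤ 1 / 20 := by
    rw [one_div]
    exact inv_anti₀ (by norm_num) hz
  have hη0 : 0 ≤ (Real.log z)⁻¹ := by positivity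
  refine (sum_factoredNumbers_le (f := fun m => rankinWeight A z (Real.log z)⁻¹ m / m)
    (fun m => div_nonneg (rankinWeight_nonneg A z _ m) (Nat.cast_nonneg m))
    (by simp [rankinWeight_one]) ?_ ?_ N.primesLE (Ioc 0 N) ?_).trans ?_
  · intro m k h
    rw [rankinWeight_mul A z _ h, Nat.cast_mul, mul_div_mul_comm]
  · intro p hp k _
    have hp0 : (0 : ℝ) < p := by exact_mod_cast hp.pos
    have hpk : (1 : ℝ) ≤ ((p ^ k : ℕ) : ℝ) := by exact_mod_cast Nat.one_le_pow _ _ hp.pos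
    have hpk0 : (0 : ℝ) < ((p ^ k : ℕ) : ℝ) := by linarith
    calc rankinWeight A z (Real.log z)⁻¹ (p ^ k) / ((p ^ k : ℕ) : ℝ)
        ≤ ((p ^ k : ℕ) : ℝ) ^ (1 / 10 : ℝ) / ((p ^ k : ℕ) : ℝ) := by
          gcongr
          exact (rankinWeight_le A z hη0 (pow_ne_zero k hp.ne_zero)).trans
            (Real.rpow_le_rpow_of_exponent_le hpk (by linarith))
      _ = ((p ^ k : ℕ) : ℝ) ^ (-(9 / 10) : ℝ) := by
          rw [← Real.rpow_sub_one hpk0.ne']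
          norm_num
      _ = ((p : ℝ) ^ (-(9 / 10) : ℝ)) ^ k := by
          rw [Nat.cast_pow, Real.rpow_pow_comm hp0.le]
  · intro m hm
    rw [mem_Ioc] at hm
    refine Nat.mem_factoredNumbers_of_primeFactors_subset (by omega) fun p hp => ?_
    exact Nat.mem_primesLE.2 ⟨(Nat.le_of_mem_primeFactors hp).trans hm.2,
      Nat.prime_of_mem_primeFactors hp⟩
  · gcongr
    rw [filter_true_of_mem fun p hp => (Nat.mem_primesLE.1 hp).2]
    calc ∑ p ∈ N.primesLE, rankinWeight A z (Real.log z)⁻¹ p / p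
        ≤ ∑ p ∈ N.primesLE, ((if 1 ≤ rho A p then 1 / (p : ℝ) else 0) +
            if p ≤ z then 2 * (Real.log z)⁻¹ * (Real.log p / p) else 0) := by
          refine sum_le_sum fun p hp => ?_
          have hp := (Nat.mem_primesLE.1 hp).2
          have hp0 : (0 : ℝ) < p := by exact_mod_cast hp.pos
          have h := rankinWeight_prime_le A hz hp
          rw [div_le_iff₀ hp0]
          refine h.trans (le_of_eq ?_)
          split_ifs <;> field_simp <;> ring
      _ ≤ recipSum A N + 4 := by
          rw [sum_add_distrib]
          refine add_le_add (le_of_eq ?_) ?_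
          · rw [← sum_filter, recipSum]
            refine sum_congr ?_ fun _ _ => rfl
            ext p
            rw [mem_filter, Nat.mem_primesLE, mem_primesUpTo]
            tauto
          · rw [← sum_filter, ← mul_sum]
            have h1 : ∑ p ∈ N.primesLE with p ≤ z, Real.log p / p
                ≤ ∑ p ∈ z.primesLE, Real.log p / p := by
              refine sum_le_sum_of_subset_of_nonneg (fun p hp => ?_) fun p _ _ =>
                div_nonneg (Real.log_natCast_nonneg p) (Nat.cast_nonneg p)
              rw [mem_filter, Nat.mem_primesLE] at hp
              exact Nat.mem_primesLE.2 ⟨hp.2, hp.1.2⟩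
            have h2 := h1.trans (sum_log_div_primesLE_le hz1)
            calc 2 * (Real.log z)⁻¹ * ∑ p ∈ N.primesLE with p ≤ z, Real.log p / p
                ≤ 2 * (Real.log z)⁻¹ * (2 * Real.log z) := by gcongr
              _ = 4 := by
                have : Real.log z ≠ 0 := by linarith
                field_simp
                norm_num

/-- The constant in the bound for moduli with a large smooth part. -/
noncomputable def rankinConst : ℝ :=
  2 * ((3 * Real.log 4 + 20 * primePowerConst) * (Real.exp primePowerConst * Real.exp 4))

theorem rankinConst_nonneg : 0 ≤ rankinConst := by
  have := primePowerConst_nonneg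
  unfold rankinConst
  positivity

/-- Few moduli have a large smooth part. -/
theorem card_large_smoothPart_le {z : ℕ} (hz : 20 ≤ Real.log z) {N : ℕ} (hN : 2 ≤ N) :
    (((modsUpTo A (N : ℝ)).filter fun q => N < smoothPart z q ^ 4).card : ℝ)
      ≤ Real.sqrt N + rankinConst * (N / Real.log N) * Real.exp (recipSum A N) *
        Real.exp (-(Real.log N / (4 * Real.log z))) := by
  have hN0 : (0 : ℝ) < N := by positivity
  have hlN : 0 < Real.log N := Real.log_pos (by exact_mod_cast hN)
  set W := rankinWeight A z (Real.log z)⁻¹ with hW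
  have hη0 : 0 ≤ (Real.log z)⁻¹ := by positivity
  have hlog : ∀ d : ℕ, 0 ≤ Real.log d := fun d => Real.log_natCast_nonneg d
  have hW0 : ∀ q, 0 ≤ W q := rankinWeight_nonneg A z _
  set E := Real.exp (-(Real.log N / (4 * Real.log z))) with hE
  have hsum := (sum_mul_log_le (F := W) hW0 (rankinWeight_mul A z _)
    (rankinWeight_chebyshev A hz) N).trans (mul_le_mul_of_nonneg_left
      (sum_rankinWeight_div_le A hz N) (by have := primePowerConst_nonneg; positivity))
  -- Moduli up to `√N` are counted trivially. For the others `log q ≥ (log N) / 2`, so a factor `2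
  -- log q / log N` can be inserted, and the smooth part exceeds `N ^ (1/4)`, so Rankin's weight
  -- exceeds `exp (log N / (4 log z))`.
  rw [← card_filter_add_card_filter_not (s := (modsUpTo A (N : ℝ)).filter
    fun q => N < smoothPart z q ^ 4) (fun q => q ^ 2 ≤ N), Nat.cast_add]
  refine add_le_add ?_ ?_
  · refine le_trans ?_ Real.nat_sqrt_le_real_sqrt
    rw [Nat.cast_le, ← Nat.card_Ioc 0 (Nat.sqrt N) |>.trans (Nat.sub_zero _)]
    refine card_le_card fun q hq => ?_
    simp only [mem_filter, mem_modsUpTo] at hq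
    exact mem_Ioc.2 ⟨hq.1.1.1.1, Nat.le_sqrt'.2 hq.2⟩
  · calc _ = ∑ q ∈ ((modsUpTo A (N : ℝ)).filter fun q => N < smoothPart z q ^ 4) with ¬ q ^ 2 ≤ N,
          (1 : ℝ) := by simp
      _ ≤ ∑ q ∈ Ioc 0 N, (2 / Real.log N * E) * (W q * Real.log q) := by
          refine sum_le_sum_of_injOn id ?_ (fun _ _ _ _ h => h) ?_ ?_
          · intro q hq
            simp only [mem_filter, mem_modsUpTo] at hq
            exact mem_Ioc.2 ⟨hq.1.1.1.1, hq.1.1.1.2⟩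
          · intro q hq
            simp only [mem_filter, mem_modsUpTo] at hq
            obtain ⟨⟨⟨-, hρ⟩, hs⟩, hq2⟩ := hq
            have h1 : Real.log N ≤ 2 * Real.log q := by
              rw [← Nat.cast_two, ← Real.log_pow]
              exact Real.log_le_log hN0 (by exact_mod_cast (not_le.1 hq2).le)
            have h2 : Real.exp (Real.log N / (4 * Real.log z)) ≤ W q := by
              rw [hW, rankinWeight, if_pos hρ, Real.rpow_def_of_pos
                (by exact_mod_cast smoothPart_pos z q), Real.exp_le_exp]
              have : Real.log N ≤ 4 * Real.log (smoothPart z q) := by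
                rw [show (4 : ℝ) = ((4 : ℕ) : ℝ) by norm_num, ← Real.log_pow]
                exact Real.log_le_log hN0 (by exact_mod_cast hs.le)
              rw [div_le_iff₀ (by linarith)]
              calc Real.log N ≤ 4 * Real.log (smoothPart z q) := this
                _ = _ := by
                  have : Real.log z ≠ 0 := by linarith
                  field_simp
            have h3 : 1 ≤ E * W q := by
              calc (1 : ℝ) = E * Real.exp (Real.log N / (4 * Real.log z)) := by
                    rw [hE, ← Real.exp_add]; simp
                _ ≤ E * W q := by gcongr
            calc (1 : ℝ) ≤ (E * W q) * (2 * Real.log q / Real.log N) :=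
                  one_le_mul_of_one_le_of_one_le h3 ((one_le_div hlN).2 h1)
              _ = _ := by simp only [id]; ring
          · intro q _
            exact mul_nonneg (by positivity) (mul_nonneg (hW0 q) (hlog q))
      _ = (2 / Real.log N * E) * ∑ q ∈ Ioc 0 N, W q * Real.log q := by rw [mul_sum]
      _ ≤ _ := mul_le_mul_of_nonneg_left hsum (by positivity)
      _ = _ := by
          rw [rankinConst, Real.exp_add]
          ring

end Rankin

end CRTSets

/-! ### Lower bound for the number of moduli -/

namespace CRTSets

section LowerBound

open Finset

variable {n : ℕ} (A : (m : ℕ) → Set (Fin n → ZMod m))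

theorem sum_log_primeFactors_le {q : ℕ} (hq : q ≠ 0) :
    ∑ p ∈ q.primeFactors, Real.log p ≤ Real.log q := by
  rw [log_eq_sum_log_prime_pow hq]
  refine sum_le_sum fun p hp => ?_
  have hpp := Nat.prime_of_mem_primeFactors hp
  refine Real.log_le_log (by exact_mod_cast hpp.pos) ?_
  have hv := hpp.factorization_pos_of_dvd hq (Nat.dvd_of_mem_primeFactors hp)
  exact_mod_cast Nat.le_self_pow hv.ne' p

-- For `m ≤ √N` the density assumption applies at `N / m ≥ √N`. Primes dividing `m` cost at most
-- `log N`, which by hypothesis is at most half of the main term.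
variable {A} in
theorem sum_log_primesUpTo_ge {α x₀ : ℝ} (hA : DensityAssumption A α x₀) {N m : ℕ} (hm : 1 ≤ m)
    (hmN : m ^ 2 ≤ N) (hx₀ : x₀ ≤ Real.sqrt N) (hlog : Real.log N ≤ α / 2 * Real.sqrt N) :
    α / 2 * N * (1 / (m : ℝ)) ≤
      ∑ p ∈ primesUpTo A ((N / m : ℕ) : ℝ) with ¬ p ∣ m, Real.log p := by
  obtain ⟨hα, -, hdens⟩ := hA
  have hm0 : (0 : ℝ) < m := by exact_mod_cast hm
  have hN0 : (0 : ℝ) < N := by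
    have : 0 < N := lt_of_lt_of_le (by positivity) hmN
    exact_mod_cast this
  have hmsq : (m : ℝ) ≤ Real.sqrt N := Real.le_sqrt_of_sq_le (by exact_mod_cast hmN)
  have hNm : Real.sqrt N ≤ (N : ℝ) / m := by
    rw [le_div_iff₀ hm0]
    calc Real.sqrt N * m ≤ Real.sqrt N * Real.sqrt N := by gcongr
      _ = N := Real.mul_self_sqrt hN0.le
  have h1 := hdens ((N : ℝ) / m) (hx₀.trans hNm)
  have h2 : primesUpTo A ((N : ℝ) / m) = primesUpTo A ((N / m : ℕ) : ℝ) := by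
    unfold primesUpTo
    rw [Nat.floor_natCast, Nat.floor_div_eq_div]
  rw [h2, ← sum_filter_add_sum_filter_not _ (· ∣ m)] at h1
  have h3 : ∑ p ∈ primesUpTo A ((N / m : ℕ) : ℝ) with p ∣ m, Real.log p ≤ Real.log N := by
    calc ∑ p ∈ primesUpTo A ((N / m : ℕ) : ℝ) with p ∣ m, Real.log p
        ≤ ∑ p ∈ m.primeFactors, Real.log p := by
          refine sum_le_sum_of_subset_of_nonneg (fun p hp => ?_) fun p _ _ =>
            Real.log_natCast_nonneg p
          rw [mem_filter, mem_primesUpTo] at hp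
          exact Nat.mem_primeFactors.2 ⟨hp.1.2.1, hp.2, by omega⟩
      _ ≤ Real.log m := sum_log_primeFactors_le (by omega)
      _ ≤ Real.log N := Real.log_le_log hm0 (by
          exact_mod_cast (Nat.le_self_pow two_ne_zero m).trans hmN)
  have h4 : α / 2 * Real.sqrt N ≤ α / 2 * (N / m) := by gcongr
  have h5 : α * (N / m) = α / 2 * (N / m) + α / 2 * (N / m) := by ring
  have h6 : α / 2 * N * (1 / (m : ℝ)) = α / 2 * (N / m) := by ring
  linarith

-- Every product `m * p` with `m ≤ √N` and `p ∤ m` is an admissible modulus up to `N`; a given `q`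
-- is weighted by at most `∑_{p ∣ q} log p ≤ log N`.
variable {A} in
theorem card_modsUpTo_mul_log_ge {α x₀ : ℝ} (hA : DensityAssumption A α x₀) {N : ℕ}
    (hx₀ : x₀ ≤ Real.sqrt N) (hlog : Real.log N ≤ α / 2 * Real.sqrt N) :
    α / 2 * N * ∑ m ∈ modsUpTo A (N.sqrt : ℝ), 1 / (m : ℝ)
      ≤ (modsUpTo A (N : ℝ)).card * Real.log N := by
  calc α / 2 * N * ∑ m ∈ modsUpTo A (N.sqrt : ℝ), 1 / (m : ℝ)
      ≤ ∑ m ∈ modsUpTo A (N.sqrt : ℝ),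
          ∑ p ∈ primesUpTo A ((N / m : ℕ) : ℝ) with ¬ p ∣ m, Real.log p := by
        rw [mul_sum]
        refine sum_le_sum fun m hm => ?_
        rw [mem_modsUpTo] at hm
        exact sum_log_primesUpTo_ge hA hm.1.1 (Nat.le_sqrt'.1 hm.1.2) hx₀ hlog
    _ = ∑ x ∈ (modsUpTo A (N.sqrt : ℝ)).sigma
          fun m => (primesUpTo A ((N / m : ℕ) : ℝ)).filter (¬ · ∣ m), Real.log x.2 :=
        (sum_sigma _ _ fun x : (_ : ℕ) × ℕ => Real.log x.2).symm
    _ ≤ ∑ y ∈ (modsUpTo A (N : ℝ)).sigma fun q => q.primeFactors, Real.log y.2 := by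
        refine sum_le_sum_of_injOn (fun x : (_ : ℕ) × ℕ => (⟨x.1 * x.2, x.2⟩ : (_ : ℕ) × ℕ))
          ?_ ?_ (fun _ _ => le_rfl) fun y _ => Real.log_natCast_nonneg _
        · rintro ⟨m, p⟩ hx
          simp only [mem_sigma, mem_modsUpTo, mem_filter, mem_primesUpTo] at hx ⊢
          obtain ⟨⟨⟨hm1, hm2⟩, hmρ⟩, ⟨hpN, hp, hpρ⟩, hpm⟩ := hx
          have hcop : m.Coprime p := ((Nat.Prime.coprime_iff_not_dvd hp).2 hpm).symm
          have hmp : 0 < m * p := Nat.mul_pos hm1 hp.pos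
          refine ⟨⟨⟨hmp, ?_⟩, (one_le_rho_mul A hcop).2 ⟨hmρ, hpρ⟩⟩,
            Nat.mem_primeFactors.2 ⟨hp, dvd_mul_left p m, hmp.ne'⟩⟩
          rw [mul_comm]
          exact (Nat.le_div_iff_mul_le hm1).1 hpN
        · rintro ⟨m, p⟩ hx ⟨m', p'⟩ hx' h
          simp only [coe_sigma, Set.mem_sigma_iff, mem_coe, mem_filter, mem_primesUpTo] at hx
          simp only [Sigma.mk.injEq, heq_eq_eq] at h
          obtain ⟨h1, rfl⟩ := h
          rw [Nat.eq_of_mul_eq_mul_right hx.2.1.2.1.pos h1]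
    _ = ∑ q ∈ modsUpTo A (N : ℝ), ∑ p ∈ q.primeFactors, Real.log p :=
        sum_sigma _ _ fun x : (_ : ℕ) × ℕ => Real.log x.2
    _ ≤ ∑ q ∈ modsUpTo A (N : ℝ), Real.log N := by
        refine sum_le_sum fun q hq => ?_
        rw [mem_modsUpTo] at hq
        refine (sum_log_primeFactors_le (by omega)).trans (Real.log_le_log ?_ ?_)
        · exact_mod_cast hq.1.1
        · exact_mod_cast hq.1.2
    _ = (modsUpTo A (N : ℝ)).card * Real.log N := by rw [sum_const, nsmul_eq_mul]

theorem one_le_rho_prod {T : Finset ℕ} (hT : ∀ p ∈ T, p.Prime ∧ 1 ≤ rho A p) :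
    1 ≤ rho A (∏ p ∈ T, p) := by
  classical
  induction T using Finset.induction_on with
  | empty => simp [rho_one]
  | insert p T hp ih =>
    rw [prod_insert hp]
    refine (one_le_rho_mul A (Nat.Coprime.prod_right fun r hr => ?_)).2
      ⟨(hT p (mem_insert_self p T)).2, ih fun r hr => hT r (mem_insert_of_mem hr)⟩
    refine (Nat.coprime_primes (hT p (mem_insert_self p T)).1
      (hT r (mem_insert_of_mem hr)).1).2 ?_
    rintro rfl
    exact hp hr

/-- For `0 ≤ t ≤ 1` one has `exp t ≤ 1 + t + t ^ 2 ≤ (1 + t) exp (t ^ 2)`, and the squares `1 / p ^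
2` sum to at most `primePowerConst`. -/
theorem exp_recipSum_le_prod (w : ℕ) :
    Real.exp (recipSum A w - primePowerConst) ≤ ∏ p ∈ primesUpTo A (w : ℝ), (1 + 1 / (p : ℝ)) := by
  have h1 : recipSum A w - primePowerConst ≤
      ∑ p ∈ primesUpTo A (w : ℝ), (1 / (p : ℝ) - (1 / (p : ℝ)) ^ 2) := by
    rw [sum_sub_distrib, recipSum]
    refine sub_le_sub_left ((sum_le_sum fun p hp => ?_).trans
      (sum_primePowerConst_le (primesUpTo A (w : ℝ)))) _
    have hp := ((mem_primesUpTo A).1 hp).2.1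
    have hp1 : (1 : ℝ) ≤ p := by exact_mod_cast hp.one_lt.le
    have h2 : (p : ℝ) ^ (-2 : ℝ) ≤ (p : ℝ) ^ (-(9 / 5) : ℝ) :=
      Real.rpow_le_rpow_of_exponent_le hp1 (by norm_num)
    have h3 : (1 / (p : ℝ)) ^ 2 = (p : ℝ) ^ (-2 : ℝ) := by
      rw [Real.rpow_neg (by positivity), one_div, inv_pow]
      norm_num
    have h4 : (0 : ℝ) ≤ (p : ℝ) ^ (-(9 / 5) : ℝ) := by positivity
    linarith
  refine (Real.exp_le_exp.2 h1).trans ?_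
  rw [Real.exp_sum]
  refine prod_le_prod (fun _ _ => (Real.exp_pos _).le) fun p hp => ?_
  have hp := ((mem_primesUpTo A).1 hp).2.1
  have hp1 : (1 : ℝ) ≤ p := by exact_mod_cast hp.one_lt.le
  set t := 1 / (p : ℝ) with ht
  have ht0 : 0 ≤ t := by positivity
  have ht1 : t ≤ 1 := by
    rw [ht, div_le_one (by linarith)]
    exact hp1
  have h2 := Real.abs_exp_sub_one_sub_id_le (x := t) (by rwa [abs_of_nonneg ht0])
  have h3 := (le_abs_self _).trans h2
  have h4 := Real.add_one_le_exp (t ^ 2)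
  rw [Real.exp_sub, div_le_iff₀ (Real.exp_pos _)]
  nlinarith [mul_nonneg ht0 (sq_nonneg t)]

/-- Squarefree smooth numbers beyond `√N` contribute at most half of an Euler product. -/
theorem sum_large_squarefree_le {w N : ℕ} (hw : 2 ≤ w) (hN : 1 ≤ N)
    (hwN : 12 * Real.log w ≤ Real.log N) :
    ∑ T ∈ (primesUpTo A (w : ℝ)).powerset with ¬ (∏ p ∈ T, p) ^ 2 ≤ N, ∏ p ∈ T, 1 / (p : ℝ)
      ≤ 1 / 2 * ∏ p ∈ primesUpTo A (w : ℝ), (1 + 1 / (p : ℝ)) := by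
  have hlw : 0 < Real.log w := Real.log_pos (by exact_mod_cast hw)
  set η := (Real.log w)⁻¹ with hη
  have hη0 : 0 < η := by positivity
  have hN0 : (0 : ℝ) < N := by exact_mod_cast hN
  set B := primesUpTo A (w : ℝ) with hB
  have hBp : ∀ p ∈ B, p.Prime ∧ p ≤ w := fun p hp =>
    ⟨((mem_primesUpTo A).1 hp).2.1, ((mem_primesUpTo A).1 hp).1⟩
  have h1 : ∀ T ∈ B.powerset.filter (fun T => ¬ (∏ p ∈ T, p) ^ 2 ≤ N),
      ∏ p ∈ T, 1 / (p : ℝ) ≤ Real.exp (-6) * ∏ p ∈ T, (p : ℝ) ^ η / p := by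
    intro T hT
    rw [mem_filter, mem_powerset, not_le] at hT
    have hprod : (0 : ℝ) < ((∏ p ∈ T, p : ℕ) : ℝ) := by
      exact_mod_cast prod_pos fun p hp => (hBp p (hT.1 hp)).1.pos
    have e1 : ∏ p ∈ T, (p : ℝ) ^ η / p = ((∏ p ∈ T, p : ℕ) : ℝ) ^ η * ∏ p ∈ T, 1 / (p : ℝ) := by
      rw [Nat.cast_prod, ← Real.finsetProd_rpow _ _ (fun _ _ => by positivity),
        ← prod_mul_distrib]
      exact prod_congr rfl fun p _ => by ring
    -- Rankin again: the product exceeds `√N ≥ w ^ 6`, which saves `exp (-6)`, whereas the weights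
    -- inflate the Euler product by at most `exp 4`; the net factor `exp (-2)` is below `1/2`.
    have e2 : Real.exp 6 ≤ ((∏ p ∈ T, p : ℕ) : ℝ) ^ η := by
      rw [Real.rpow_def_of_pos hprod, Real.exp_le_exp]
      have : Real.log N ≤ 2 * Real.log ((∏ p ∈ T, p : ℕ) : ℝ) := by
        rw [← Nat.cast_two, ← Real.log_pow]
        exact Real.log_le_log hN0 (by exact_mod_cast hT.2.le)
      rw [hη, le_mul_inv_iff₀ hlw]
      linarith
    rw [e1, ← mul_assoc]
    refine le_mul_of_one_le_left (prod_nonneg fun _ _ => by positivity) ?_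
    calc (1 : ℝ) = Real.exp (-6) * Real.exp 6 := by rw [← Real.exp_add]; simp
      _ ≤ _ := by gcongr
  have h2 : ∏ p ∈ B, (1 + (p : ℝ) ^ η / p) ≤ (∏ p ∈ B, (1 + 1 / (p : ℝ))) * Real.exp 4 := by
    calc ∏ p ∈ B, (1 + (p : ℝ) ^ η / p)
        ≤ ∏ p ∈ B, ((1 + 1 / (p : ℝ)) * Real.exp (2 * η * (Real.log p / p))) := by
          refine prod_le_prod (fun _ _ => by positivity) fun p hp => ?_
          obtain ⟨hpp, hpw⟩ := hBp p hp
          have hp0 : (0 : ℝ) < p := by exact_mod_cast hpp.pos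
          have hlp : 0 ≤ Real.log p := Real.log_natCast_nonneg p
          have e1 : (p : ℝ) ^ η - 1 ≤ 2 * (Real.log p * η) := by
            rw [Real.rpow_def_of_pos hp0]
            refine exp_sub_one_le (by positivity) ?_
            rw [hη, mul_inv_le_iff₀ hlw, one_mul]
            exact Real.log_le_log hp0 (by exact_mod_cast hpw)
          have e2 := Real.add_one_le_exp (2 * η * (Real.log p / p))
          have e3 : (p : ℝ) ^ η / p ≤ 1 / p + 2 * η * (Real.log p / p) := by
            rw [div_le_iff₀ hp0]
            have : (1 / (p : ℝ) + 2 * η * (Real.log p / p)) * p = 1 + 2 * (Real.log p * η) := by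
              field_simp
            linarith
          have e4 : 0 ≤ 1 / (p : ℝ) := by positivity
          have e5 : 0 ≤ 2 * η * (Real.log p / p) := by positivity
          nlinarith [mul_nonneg e4 e5, mul_le_mul_of_nonneg_left e2 e4]
      _ = (∏ p ∈ B, (1 + 1 / (p : ℝ))) * Real.exp (2 * η * ∑ p ∈ B, Real.log p / p) := by
          rw [prod_mul_distrib, ← Real.exp_sum, mul_sum]
      _ ≤ _ := by
          gcongr
          have h3 : ∑ p ∈ B, Real.log p / p ≤ ∑ p ∈ w.primesLE, Real.log p / p := by
            refine sum_le_sum_of_subset_of_nonneg (fun p hp => ?_) fun p _ _ =>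
              div_nonneg (Real.log_natCast_nonneg p) (Nat.cast_nonneg p)
            exact Nat.mem_primesLE.2 ⟨(hBp p hp).2, (hBp p hp).1⟩
          have h4 := h3.trans (sum_log_div_primesLE_le (by omega))
          calc 2 * η * ∑ p ∈ B, Real.log p / p ≤ 2 * η * (2 * Real.log w) := by gcongr
            _ = 4 := by
              rw [hη]
              field_simp
              norm_num
  calc ∑ T ∈ B.powerset with ¬ (∏ p ∈ T, p) ^ 2 ≤ N, ∏ p ∈ T, 1 / (p : ℝ)
      ≤ ∑ T ∈ B.powerset with ¬ (∏ p ∈ T, p) ^ 2 ≤ N, Real.exp (-6) * ∏ p ∈ T, (p : ℝ) ^ η / p :=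
        sum_le_sum h1
    _ ≤ ∑ T ∈ B.powerset, Real.exp (-6) * ∏ p ∈ T, (p : ℝ) ^ η / p :=
        sum_le_sum_of_subset_of_nonneg (filter_subset _ _) fun _ _ _ => by positivity
    _ = Real.exp (-6) * ∏ p ∈ B, (1 + (p : ℝ) ^ η / p) := by rw [← mul_sum, prod_one_add]
    _ ≤ Real.exp (-6) * ((∏ p ∈ B, (1 + 1 / (p : ℝ))) * Real.exp 4) := by gcongr
    _ = Real.exp (-2) * ∏ p ∈ B, (1 + 1 / (p : ℝ)) := by
        rw [mul_left_comm, ← Real.exp_add, mul_comm]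
        norm_num
    _ ≤ 1 / 2 * ∏ p ∈ B, (1 + 1 / (p : ℝ)) := by
        have h5 : Real.exp (-2) ≤ 1 / 2 := by
          rw [Real.exp_neg, one_div]
          refine inv_anti₀ (by norm_num) ?_
          linarith [Real.add_one_le_exp 2]
        gcongr

theorem recipSum_window_le {w N : ℕ} (hw : 2 ≤ w) (hN : 1 ≤ N) :
    recipSum A N ≤ recipSum A w + 2 * Real.log N / Real.log w := by
  unfold recipSum
  rw [← sum_filter_add_sum_filter_not (primesUpTo A (N : ℝ)) (· ≤ w)]
  refine add_le_add ?_ ((?_ : _ ≤ _).trans (sum_inv_primes_window_le hw hN))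
  · refine sum_le_sum_of_subset_of_nonneg (fun p hp => ?_) fun _ _ _ => by positivity
    rw [mem_filter, mem_primesUpTo] at hp
    exact (mem_primesUpTo A).2 ⟨hp.2, hp.1.2⟩
  · refine sum_le_sum_of_subset_of_nonneg (fun p hp => ?_) fun _ _ _ => by positivity
    rw [mem_filter, mem_primesUpTo] at hp
    rw [mem_filter, Nat.mem_primesLE]
    exact ⟨⟨hp.1.1, hp.1.2.1⟩, by omega⟩

/-- Squarefree products of admissible primes up to about `N ^ (1/12)` already suffice: at least half
of their Euler product comes from products at most `√N`, and the primes omitted lie in a logarithmic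
window of bounded length. -/
theorem sum_inv_modsUpTo_sqrt_ge {N : ℕ} (hN : 2 ^ 12 ≤ N) :
    1 / 2 * Real.exp (recipSum A N - 48 - primePowerConst) ≤
      ∑ m ∈ modsUpTo A (N.sqrt : ℝ), 1 / (m : ℝ) := by
  set w := Nat.findGreatest (fun w => w ^ 12 ≤ N) N with hwdef
  have hw2 : 2 ≤ w := Nat.le_findGreatest (le_trans (by norm_num) hN) hN
  have hwN : w ^ 12 ≤ N := Nat.findGreatest_spec (P := fun w => w ^ 12 ≤ N) (m := 2)
    (le_trans (by norm_num) hN) hN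
  have hwN' : N ≤ (w + 1) ^ 12 := by
    by_contra hlt
    have h1 : (w + 1) ^ 12 ≤ N := by omega
    have h2 : w + 1 ≤ w := Nat.le_findGreatest ((Nat.le_self_pow (by norm_num) _).trans h1) h1
    omega
  have hlw : 0 < Real.log w := Real.log_pos (by exact_mod_cast hw2)
  have hN0 : (0 : ℝ) < N := by
    have : 0 < N := lt_of_lt_of_le (by norm_num) hN
    exact_mod_cast this
  have hl1 : 12 * Real.log w ≤ Real.log N := by
    rw [show (12 : ℝ) = ((12 : ℕ) : ℝ) by norm_num, ← Real.log_pow]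
    exact Real.log_le_log (by positivity) (by exact_mod_cast hwN)
  -- Since `w` is the integer part of the twelfth root and `w + 1 ≤ w ^ 2`; the window then
  -- contributes at most `2 * 24 = 48`.
  have hl2 : Real.log N ≤ 24 * Real.log w := by
    rw [show (24 : ℝ) = ((24 : ℕ) : ℝ) by norm_num, ← Real.log_pow]
    refine Real.log_le_log hN0 ?_
    have : (w + 1) ^ 12 ≤ (w ^ 2) ^ 12 := Nat.pow_le_pow_left (by nlinarith) 12
    rw [← pow_mul] at this
    exact_mod_cast hwN'.trans this
  have hwin : recipSum A N - 48 ≤ recipSum A w := by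
    have h1 := recipSum_window_le A hw2 (N := N) (le_trans (by norm_num) hN)
    have h2 : 2 * Real.log N / Real.log w ≤ 48 := by
      rw [div_le_iff₀ hlw]
      linarith
    linarith
  have hprod := exp_recipSum_le_prod A w
  have hlarge := sum_large_squarefree_le A hw2 (N := N) (le_trans (by norm_num) hN) hl1
  have hall := prod_one_add (f := fun p : ℕ => 1 / (p : ℝ)) (primesUpTo A (w : ℝ))
  rw [← sum_filter_add_sum_filter_not _ (fun T => (∏ p ∈ T, p) ^ 2 ≤ N)] at hall
  have hsmall : ∑ T ∈ (primesUpTo A (w : ℝ)).powerset with (∏ p ∈ T, p) ^ 2 ≤ N,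
      ∏ p ∈ T, 1 / (p : ℝ) ≤ ∑ m ∈ modsUpTo A (N.sqrt : ℝ), 1 / (m : ℝ) := by
    have hT : ∀ T ∈ (primesUpTo A (w : ℝ)).powerset.filter (fun T => (∏ p ∈ T, p) ^ 2 ≤ N),
        ∀ p ∈ T, p.Prime ∧ 1 ≤ rho A p := by
      intro T hT p hp
      rw [mem_filter, mem_powerset] at hT
      exact ((mem_primesUpTo A).1 (hT.1 hp)).2
    refine sum_le_sum_of_injOn (fun T => ∏ p ∈ T, p) ?_ ?_ ?_ fun _ _ => by positivity
    · intro T hTm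
      refine (mem_modsUpTo A).2 ⟨⟨prod_pos fun p hp => (hT T hTm p hp).1.pos, ?_⟩,
        one_le_rho_prod A (hT T hTm)⟩
      exact Nat.le_sqrt'.2 (mem_filter.1 hTm).2
    · intro T hTm T' hTm' h
      rw [← Nat.primeFactors_prod fun p hp => (hT T hTm p hp).1,
        ← Nat.primeFactors_prod fun p hp => (hT T' hTm' p hp).1]
      exact congrArg Nat.primeFactors h
    · intro T _
      rw [Nat.cast_prod, one_div, ← prod_inv_distrib]
      simp
  have hexp : Real.exp (recipSum A N - 48 - primePowerConst)
      ≤ Real.exp (recipSum A w - primePowerConst) := Real.exp_le_exp.2 (by linarith)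
  linarith

/-- The constant in the lower bound for the number of moduli. -/
noncomputable def lowerConst : ℝ := Real.exp (-(48 + primePowerConst)) / 4

theorem lowerConst_pos : 0 < lowerConst := by unfold lowerConst; positivity

variable {A} in
/-- The number of moduli `q ≤ N` with `ρ(q) ≥ 1` has the expected order of magnitude. -/
theorem card_modsUpTo_ge {α x₀ : ℝ} (hA : DensityAssumption A α x₀) {N : ℕ} (hN : 2 ^ 12 ≤ N)
    (hx₀ : x₀ ≤ Real.sqrt N) (hlog : Real.log N ≤ α / 2 * Real.sqrt N) :
    lowerConst * α * (N / Real.log N) * Real.exp (recipSum A N) ≤ (modsUpTo A (N : ℝ)).card := by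
  have hN1 : 1 < N := lt_of_lt_of_le (by norm_num) hN
  have hlN : 0 < Real.log N := Real.log_pos (by exact_mod_cast hN1)
  have h1 := card_modsUpTo_mul_log_ge hA hx₀ hlog
  have h2 := sum_inv_modsUpTo_sqrt_ge A hN
  have hα := hA.1
  have h3 : α / 2 * N * (1 / 2 * Real.exp (recipSum A N - 48 - primePowerConst))
      ≤ (modsUpTo A (N : ℝ)).card * Real.log N := le_trans (by gcongr) h1
  rw [← div_le_iff₀ hlN] at h3
  refine le_trans (le_of_eq ?_) h3
  rw [lowerConst, show recipSum A N - 48 - primePowerConst =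
    recipSum A N + -(48 + primePowerConst) by ring, Real.exp_add]
  ring

end LowerBound

end CRTSets

/-! ### Mean value of the exponential sums over the moduli -/

namespace CRTSets

section MeanValue

open Finset

/-- The `k`-th smallest element of a set of positive integers is at least `k`. -/
theorem sum_inv_le_one_add_log (T : Finset ℕ) (hT : ∀ p ∈ T, 0 < p) :
    ∑ p ∈ T, 1 / (p : ℝ) ≤ harmonic T.card := by
  induction h : T.card generalizing T with
  | zero => simp [card_eq_zero.1 h]
  | succ k ih =>
    have hne : T.Nonempty := card_pos.1 (by omega)
    set M := T.max' hne
    have hM : M ∈ T := T.max'_mem hne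
    have hcard : k + 1 ≤ M := by
      rw [← h]
      calc T.card ≤ (Ioc 0 M).card :=
            card_le_card fun p hp => mem_Ioc.2 ⟨hT p hp, T.le_max' p hp⟩
        _ = M := by simp
    rw [← add_sum_erase T _ hM, harmonic_succ, add_comm]
    push_cast
    refine add_le_add (ih (T.erase M) (fun p hp => hT p (mem_of_mem_erase hp))
      (by rw [card_erase_of_mem hM, h]; rfl)) ?_
    rw [one_div]
    refine inv_anti₀ (by positivity) ?_
    exact_mod_cast hcard

/-- There are at most `2 log g` prime factors, because `log 2 ≥ 1/2`, and the harmonic bound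
exponentiates to a linear one. This measures the loss from primes dividing a coordinate of the
frequency, where no saving is available. -/
theorem exp_sum_primeFactors_le {g : ℕ} (hg : 1 ≤ g) :
    Real.exp (∑ p ∈ g.primeFactors, 1 / (p : ℝ)) ≤ Real.exp 1 * (1 + 2 * Real.log g) := by
  have hlg : 0 ≤ Real.log g := Real.log_natCast_nonneg g
  have hc : (g.primeFactors.card : ℝ) ≤ 2 * Real.log g := by
    have h1 : ∑ p ∈ g.primeFactors, (1 / 2 : ℝ) ≤ ∑ p ∈ g.primeFactors, Real.log p := by
      refine sum_le_sum fun p hp => ?_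
      have : Real.log 2 ≤ Real.log p := Real.log_le_log (by norm_num)
        (by exact_mod_cast (Nat.prime_of_mem_primeFactors hp).two_le)
      linarith [Real.log_two_gt_d9]
    rw [sum_const, nsmul_eq_mul] at h1
    linarith [h1.trans (sum_log_primeFactors_le (by omega))]
  rcases Nat.eq_zero_or_pos g.primeFactors.card with h0 | h0
  · rw [card_eq_zero.1 h0, sum_empty]
    have := Real.exp_le_exp.2 (zero_le_one (α := ℝ))
    exact this.trans (le_mul_of_one_le_right (Real.exp_pos _).le (by linarith))
  · have h1 := sum_inv_le_one_add_log g.primeFactors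
      fun p hp => (Nat.prime_of_mem_primeFactors hp).pos
    have h2 := h1.trans (harmonic_le_one_add_log _)
    refine (Real.exp_le_exp.2 h2).trans ?_
    rw [Real.exp_add, Real.exp_log (by exact_mod_cast h0)]
    gcongr
    linarith

variable {n : ℕ} (A : (m : ℕ) → Set (Fin n → ZMod m))

/-- The modulus of the normalised exponential sum. -/
noncomputable def weylNorm (h : Fin n → ℤ) (q : ℕ) : ℝ :=
  if hq : q = 0 then 0 else
    haveI : NeZero q := ⟨hq⟩
    ‖expSum A h q 1‖ / rho A q

theorem weylNorm_eq (h : Fin n → ℤ) (q : ℕ) [NeZero q] :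
    weylNorm A h q = ‖expSum A h q 1‖ / rho A q := by
  rw [weylNorm, dif_neg (NeZero.ne q)]

theorem weylNorm_nonneg (h : Fin n → ℤ) (q : ℕ) : 0 ≤ weylNorm A h q := by
  unfold weylNorm
  split_ifs <;> positivity

theorem weylNorm_le_one (h : Fin n → ℤ) (q : ℕ) : weylNorm A h q ≤ 1 := by
  unfold weylNorm
  split_ifs with hq
  · exact zero_le_one
  · have : NeZero q := ⟨hq⟩
    exact div_le_one_of_le₀ (norm_expSum_le A h q 1) (by positivity)

/-- The sum measuring the deviation of the sets `A_p` from hyperplanes. -/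
noncomputable def defect (N : ℕ) : ℝ :=
  ∑ p ∈ primesUpTo A (N : ℝ), (1 - (lam A p : ℝ) / (rho A p : ℝ)) * (1 / (p : ℝ))

/-- The summand depends only on the class of `s` modulo `r`. The sieve gives one bound for all
reduced classes, so the sum is at most that bound times the sum over all units, and inversion of
units identifies the latter with `meanWeyl`. -/
theorem sum_rough_norm_expSum_le (h : Fin n → ℤ) {r z N : ℕ} [NeZero r] (hz : 2 ≤ z)
    (hzN : z ^ 8 ≤ N) (hrN : r ^ 4 ≤ N) :
    ∑ s ∈ Ioc 0 (N / r) with r.Coprime s ∧ (siftPrimes r z).Coprime s,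
      ‖expSum A h r (s : ZMod r)⁻¹‖ / rho A r ≤ 2 * N / Real.log z * (meanWeyl A h r / r) := by
  classical
  have hr : 1 ≤ r := NeZero.one_le
  have hr0 : (0 : ℝ) < r := by exact_mod_cast hr
  have hz0 : (0 : ℝ) < z := by positivity
  have hlz : 0 < Real.log z := Real.log_pos (by exact_mod_cast hz)
  have hφ : (0 : ℝ) < r.totient := by exact_mod_cast Nat.totient_pos.2 hr
  have hφr : (r.totient : ℝ) ≤ r := by exact_mod_cast Nat.totient_le r
  set K : ℝ := 2 * N / (r * r.totient * Real.log z) with hK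
  -- This makes the sieve error `z ^ 2` no larger than its main term, using `φ(r) ≤ r` and `log z ≤
  -- z`.
  have hrz : (r : ℝ) ^ 2 * (z : ℝ) ^ 3 ≤ N := by
    have h1 : ((r : ℝ) ^ 2 * (z : ℝ) ^ 3) ^ 2 ≤ (N : ℝ) ^ 2 := by
      calc ((r : ℝ) ^ 2 * (z : ℝ) ^ 3) ^ 2 = (r : ℝ) ^ 4 * (z : ℝ) ^ 6 := by ring
        _ ≤ (N : ℝ) * (N : ℝ) := by
          gcongr
          · exact_mod_cast hrN
          · exact_mod_cast (Nat.pow_le_pow_right (by omega) (by norm_num)).trans hzN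
        _ = (N : ℝ) ^ 2 := by ring
    exact le_of_pow_le_pow_left₀ two_ne_zero (Nat.cast_nonneg N) h1
  have hcount : ∀ b : (ZMod r)ˣ, (((Ioc 0 (N / r)).filter fun s : ℕ =>
      (r.Coprime s ∧ (siftPrimes r z).Coprime s) ∧ (s : ZMod r) = b).card : ℝ) ≤ K := by
    intro b
    have h1 := card_rough_progression_le (r := r) (b := (b : ZMod r).val) (Y := N / r) (z := z) hr hz
    have h2 : (((Ioc 0 (N / r)).filter fun s : ℕ =>
      (r.Coprime s ∧ (siftPrimes r z).Coprime s) ∧ (s : ZMod r) = b).card : ℝ) ≤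
        (((Ioc 0 (N / r)).filter fun s =>
          s ≡ (b : ZMod r).val [MOD r] ∧ (siftPrimes r z).Coprime s).card : ℝ) := by
      refine Nat.cast_le.2 (card_le_card fun s hs => ?_)
      rw [mem_filter] at hs ⊢
      refine ⟨hs.1, ?_, hs.2.1.2⟩
      rw [← ZMod.natCast_eq_natCast_iff, hs.2.2, ZMod.natCast_zmod_val]
    refine (h2.trans h1).trans ?_
    have h3 : (((N / r : ℕ) : ℝ)) / (r.totient * Real.log z) ≤ N / (r * r.totient * Real.log z) := by
      calc (((N / r : ℕ) : ℝ)) / (r.totient * Real.log z) ≤ (N / r) / (r.totient * Real.log z) := by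
            gcongr
            exact Nat.cast_div_le
        _ = _ := by field_simp
    have h4 : (z : ℝ) ^ 2 ≤ N / (r * r.totient * Real.log z) := by
      rw [le_div_iff₀ (by positivity)]
      calc (z : ℝ) ^ 2 * (r * r.totient * Real.log z) ≤ (z : ℝ) ^ 2 * (r * r * z) := by
            gcongr
            exact (Real.log_le_sub_one_of_pos hz0).trans (by linarith)
        _ = (r : ℝ) ^ 2 * (z : ℝ) ^ 3 := by ring
        _ ≤ N := hrz
    calc _ ≤ (N : ℝ) / (r * r.totient * Real.log z) + N / (r * r.totient * Real.log z) :=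
          add_le_add h3 h4
      _ = K := by rw [hK]; ring
  calc ∑ s ∈ Ioc 0 (N / r) with r.Coprime s ∧ (siftPrimes r z).Coprime s,
        ‖expSum A h r (s : ZMod r)⁻¹‖ / rho A r
      = ∑ s ∈ Ioc 0 (N / r) with r.Coprime s ∧ (siftPrimes r z).Coprime s,
          ∑ b : (ZMod r)ˣ, if (s : ZMod r) = b then
            ‖expSum A h r ((b⁻¹ : (ZMod r)ˣ) : ZMod r)‖ / rho A r else 0 := by
        refine sum_congr rfl fun s hs => ?_
        have hsr : s.Coprime r := (mem_filter.1 hs).2.1.symm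
        rw [Finset.sum_eq_single (ZMod.unitOfCoprime s hsr)]
        · rw [if_pos (ZMod.coe_unitOfCoprime s hsr).symm, ← ZMod.inv_coe_unit,
            ZMod.coe_unitOfCoprime]
        · intro b _ hb
          rw [if_neg]
          intro h0
          exact hb (Units.ext (by rw [ZMod.coe_unitOfCoprime, h0]))
        · intro h0
          exact absurd (mem_univ _) h0
    _ = ∑ b : (ZMod r)ˣ, (((Ioc 0 (N / r)).filter fun s : ℕ =>
          (r.Coprime s ∧ (siftPrimes r z).Coprime s) ∧ (s : ZMod r) = b).card : ℝ) *
            (‖expSum A h r ((b⁻¹ : (ZMod r)ˣ) : ZMod r)‖ / rho A r) := by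
        rw [sum_comm]
        refine sum_congr rfl fun b _ => ?_
        rw [← sum_filter, filter_filter, sum_const, nsmul_eq_mul]
    _ ≤ ∑ b : (ZMod r)ˣ, K * (‖expSum A h r ((b⁻¹ : (ZMod r)ˣ) : ZMod r)‖ / rho A r) := by
        refine sum_le_sum fun b _ => mul_le_mul_of_nonneg_right (hcount b) (by positivity)
    _ = K * ∑ b : (ZMod r)ˣ, ‖expSum A h r (b : ZMod r)‖ / rho A r := by
        rw [← mul_sum, ← Equiv.sum_comp (Equiv.inv (ZMod r)ˣ)
          (fun b : (ZMod r)ˣ => ‖expSum A h r (b : ZMod r)‖ / (rho A r : ℝ))]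
        rfl
    _ = _ := by
        rw [← sum_div, hK, meanWeyl_eq]
        field_simp

/-- The moduli with a small smooth part. -/
theorem sum_weylNorm_small_smoothPart_le (h : Fin n → ℤ) {z N : ℕ} (hz : 2 ≤ z)
    (hzN : z ^ 8 ≤ N) :
    ∑ q ∈ modsUpTo A (N : ℝ) with smoothPart z q ^ 4 ≤ N, weylNorm A h q ≤
      2 * N / Real.log z * (Real.exp primePowerConst *
        Real.exp (∑ p ∈ z.primesLE, meanWeyl A h p / p)) := by
  classical
  have hlz : 0 < Real.log z := Real.log_pos (by exact_mod_cast hz)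
  set R := (Ioc 0 N).filter fun r => r ∈ Nat.factoredNumbers z.primesLE ∧ r ^ 4 ≤ N with hR
  set G : ℕ → ℕ → ℝ := fun r s => if hr : r = 0 then 0 else
    haveI : NeZero r := ⟨hr⟩
    ‖expSum A h r (s : ZMod r)⁻¹‖ / rho A r with hG
  have hG0 : ∀ r s, 0 ≤ G r s := by
    intro r s
    simp only [hG]
    split_ifs <;> positivity
  calc ∑ q ∈ modsUpTo A (N : ℝ) with smoothPart z q ^ 4 ≤ N, weylNorm A h q
      ≤ ∑ x ∈ R.sigma fun r =>
          (Ioc 0 (N / r)).filter fun s => r.Coprime s ∧ (siftPrimes r z).Coprime s, G x.1 x.2 := by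
        -- The factor at the rough part is discarded, but its inverse remains as the twist modulo
        -- the smooth part.
        refine sum_le_sum_of_injOn (fun q =>
          (⟨smoothPart z q, roughPart z q⟩ : (_ : ℕ) × ℕ)) ?_ ?_ ?_ fun x _ => hG0 _ _
        · intro q hq
          simp only [mem_filter, mem_modsUpTo] at hq
          have hq0 : q ≠ 0 := by omega
          have hs := smoothPart_pos z q
          have hmul := smoothPart_mul_roughPart z hq0
          simp only [hR, mem_sigma, mem_filter, mem_Ioc]
          refine ⟨⟨⟨hs, (smoothPart_le z hq0).trans hq.1.1.2⟩, smoothPart_mem_factoredNumbers z q,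
            hq.2⟩, ⟨roughPart_pos z q, ?_⟩, smoothPart_coprime_roughPart z q,
            siftPrimes_coprime_roughPart _ z q⟩
          rw [Nat.le_div_iff_mul_le hs, mul_comm, hmul]
          exact hq.1.1.2
        · intro q hq q' hq' hqq
          simp only [coe_filter, Set.mem_ofPred_eq, mem_modsUpTo] at hq hq'
          simp only [Sigma.mk.injEq, heq_eq_eq] at hqq
          rw [← smoothPart_mul_roughPart z (q := q) (by omega),
            ← smoothPart_mul_roughPart z (q := q') (by omega), hqq.1, hqq.2]
        · intro q hq
          simp only [mem_filter, mem_modsUpTo] at hq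
          have hq0 : q ≠ 0 := by omega
          have : NeZero (smoothPart z q) := ⟨(smoothPart_pos z q).ne'⟩
          have : NeZero (roughPart z q) := ⟨(roughPart_pos z q).ne'⟩
          have : NeZero (smoothPart z q * roughPart z q) :=
            ⟨mul_ne_zero (smoothPart_pos z q).ne' (roughPart_pos z q).ne'⟩
          have h1 := norm_expSum_div_le A h (smoothPart_coprime_roughPart z q)
          rw [← weylNorm_eq, smoothPart_mul_roughPart z hq0] at h1
          simp only [hG]
          rw [dif_neg (smoothPart_pos z q).ne']
          exact h1
    _ = ∑ r ∈ R, ∑ s ∈ Ioc 0 (N / r) with r.Coprime s ∧ (siftPrimes r z).Coprime s, G r s :=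
        sum_sigma _ _ fun x : (_ : ℕ) × ℕ => G x.1 x.2
    _ ≤ ∑ r ∈ R, 2 * N / Real.log z * (meanWeyl A h r / r) := by
        refine sum_le_sum fun r hr => ?_
        rw [hR, mem_filter, mem_Ioc] at hr
        have hr0 : r ≠ 0 := by omega
        have : NeZero r := ⟨hr0⟩
        refine le_trans (le_of_eq (sum_congr rfl fun s _ => ?_))
          (sum_rough_norm_expSum_le A h hz hzN hr.2.2)
        simp only [hG]
        rw [dif_neg hr0]
    _ = 2 * N / Real.log z * ∑ r ∈ R, meanWeyl A h r / r := by rw [mul_sum]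
    _ ≤ _ := by
        gcongr
        refine (sum_factoredNumbers_le (f := fun m => meanWeyl A h m / m)
          (fun m => div_nonneg (meanWeyl_nonneg A h m) (Nat.cast_nonneg m))
          (by simp [meanWeyl_one]) ?_ ?_ z.primesLE R ?_).trans ?_
        · intro m k hmk
          rw [meanWeyl_mul A h hmk, Nat.cast_mul, mul_div_mul_comm]
        · intro p hp k _
          have hp1 : (1 : ℝ) ≤ p := by exact_mod_cast hp.one_lt.le
          calc meanWeyl A h (p ^ k) / ((p ^ k : ℕ) : ℝ) ≤ 1 / ((p ^ k : ℕ) : ℝ) := by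
                gcongr
                exact meanWeyl_le_one A h _
            _ = ((p : ℝ) ^ (-1 : ℝ)) ^ k := by
                rw [Real.rpow_neg_one, Nat.cast_pow, inv_pow, one_div]
            _ ≤ _ := by
                gcongr
                norm_num
        · intro m hm
          rw [hR, mem_filter] at hm
          exact hm.2.1
        · rw [filter_true_of_mem fun p hp => (Nat.mem_primesLE.1 hp).2]

/-- One nonzero coordinate is enough: a prime not dividing it sees a nonzero frequency and enjoys
the saving, and the others are bounded trivially. As the bounds are nonnegative, the range may be
enlarged from `z` to `N`. -/
theorem sum_meanWeyl_div_le (hn : 1 ≤ n) (h : Fin n → ℤ) {i : Fin n} (hi : h i ≠ 0) {z N : ℕ}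
    (hzN : z ≤ N) :
    ∑ p ∈ z.primesLE, meanWeyl A h p / p ≤
      recipSum A N - defect A N / 2 + ∑ p ∈ (h i).natAbs.primeFactors, 1 / (p : ℝ) := by
  classical
  set κ : ℕ → ℝ := fun p => (1 - (1 - (lam A p : ℝ) / rho A p) / 2) * (1 / (p : ℝ)) with hκ
  have hκ0 : ∀ p, 0 ≤ κ p := by
    intro p
    have h1 : 0 ≤ (lam A p : ℝ) / rho A p := by positivity
    exact mul_nonneg (by linarith) (by positivity)
  calc ∑ p ∈ z.primesLE, meanWeyl A h p / p
      ≤ ∑ p ∈ z.primesLE, ((if 1 ≤ rho A p then κ p else 0) +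
          if p ∈ (h i).natAbs.primeFactors then 1 / (p : ℝ) else 0) := by
        refine sum_le_sum fun p hp => ?_
        have hpp := (Nat.mem_primesLE.1 hp).2
        have hz0 : 0 ≤ (if p ∈ (h i).natAbs.primeFactors then 1 / (p : ℝ) else 0) := by
          split_ifs <;> positivity
        by_cases hρ : 1 ≤ rho A p
        · rw [if_pos hρ]
          by_cases hd : p ∈ (h i).natAbs.primeFactors
          · rw [if_pos hd]
            have h1 : meanWeyl A h p / p ≤ 1 / p := by
              gcongr
              exact meanWeyl_le_one A h p
            linarith [hκ0 p]
          · have hnd : ¬ (p : ℤ) ∣ h i := by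
              intro h1
              exact hd (Nat.mem_primeFactors.2 ⟨hpp, Int.natCast_dvd.1 h1, Int.natAbs_ne_zero.2 hi⟩)
            have h1 := meanWeyl_prime_le A hn h hpp ⟨i, hnd⟩ hρ
            have h2 : meanWeyl A h p / p ≤ κ p := by
              simp only [hκ]
              rw [div_eq_mul_one_div]
              gcongr
            linarith
        -- Here `ρ(p) = 0` and division by zero makes `meanWeyl` vanish, so only admissible primes
        -- enter the Euler product.
        · rw [meanWeyl_eq_zero A h (by omega), zero_div, if_neg hρ, zero_add]
          exact hz0
    _ = ∑ p ∈ z.primesLE with 1 ≤ rho A p, κ p +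
          ∑ p ∈ z.primesLE with p ∈ (h i).natAbs.primeFactors, 1 / (p : ℝ) := by
        rw [sum_add_distrib, sum_filter, sum_filter]
    _ ≤ ∑ p ∈ primesUpTo A (N : ℝ), κ p + ∑ p ∈ (h i).natAbs.primeFactors, 1 / (p : ℝ) := by
        refine add_le_add ?_ ?_
        · refine sum_le_sum_of_subset_of_nonneg (fun p hp => ?_) fun p _ _ => hκ0 p
          rw [mem_filter, Nat.mem_primesLE] at hp
          exact (mem_primesUpTo A).2 ⟨hp.1.1.trans hzN, hp.1.2, hp.2⟩
        · refine sum_le_sum_of_subset_of_nonneg (fun p hp => (mem_filter.1 hp).2)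
            fun p _ _ => by positivity
    _ = _ := by
        rw [recipSum, defect, sum_div, ← sum_sub_distrib]
        congr 1
        refine sum_congr rfl fun p _ => ?_
        simp only [hκ]
        ring

/-- The constant in the mean value bound for Weyl sums. -/
noncomputable def meanConst : ℝ := 2 * (Real.exp primePowerConst * Real.exp 1)

theorem meanConst_pos : 0 < meanConst := by unfold meanConst; positivity

/-- The mean value of Weyl sums over the moduli `q ≤ N`. -/
theorem sum_weylNorm_le (hn : 1 ≤ n) {h : Fin n → ℤ} (hh : h ≠ 0) {H : ℕ}
    (hH : ∀ i, (h i).natAbs ≤ H) {z N : ℕ} (hz : 20 ≤ Real.log z) (hzN : z ^ 8 ≤ N) :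
    ∑ q ∈ modsUpTo A (N : ℝ), weylNorm A h q ≤
      meanConst * (N / Real.log z) * Real.exp (recipSum A N - defect A N / 2) *
        (1 + 2 * Real.log H) +
      (Real.sqrt N + rankinConst * (N / Real.log N) * Real.exp (recipSum A N) *
        Real.exp (-(Real.log N / (4 * Real.log z)))) := by
  have hz2 : 2 ≤ z := by
    by_contra hlt
    have : z = 0 ∨ z = 1 := by omega
    rcases this with rfl | rfl <;> norm_num at hz
  have hN2 : 2 ≤ N := (hz2.trans (Nat.le_self_pow (by norm_num) z)).trans hzN
  obtain ⟨i, hi⟩ : ∃ i, h i ≠ 0 := Function.ne_iff.1 hh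
  have hlz : 0 < Real.log z := by linarith
  rw [← sum_filter_add_sum_filter_not _ (fun q => smoothPart z q ^ 4 ≤ N)]
  refine add_le_add ?_ ?_
  · refine (sum_weylNorm_small_smoothPart_le A h hz2 hzN).trans ?_
    have h1 := sum_meanWeyl_div_le A hn h hi ((Nat.le_self_pow (by norm_num) z).trans hzN)
    have hg : 1 ≤ (h i).natAbs := Int.natAbs_pos.2 hi
    have h2 := exp_sum_primeFactors_le hg
    have h3 : Real.log (h i).natAbs ≤ Real.log H :=
      Real.log_le_log (by exact_mod_cast hg) (by exact_mod_cast hH i)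
    calc 2 * N / Real.log z * (Real.exp primePowerConst *
          Real.exp (∑ p ∈ z.primesLE, meanWeyl A h p / p))
        ≤ 2 * N / Real.log z * (Real.exp primePowerConst *
          (Real.exp (recipSum A N - defect A N / 2) * (Real.exp 1 * (1 + 2 * Real.log H)))) := by
          gcongr
          refine (Real.exp_le_exp.2 h1).trans ?_
          rw [Real.exp_add]
          gcongr
          exact h2.trans (by gcongr)
      _ = _ := by
          rw [meanConst]
          ring
  · refine le_trans ?_ (card_large_smoothPart_le A hz hN2)
    calc ∑ q ∈ modsUpTo A (N : ℝ) with ¬ smoothPart z q ^ 4 ≤ N, weylNorm A h q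
        ≤ ∑ q ∈ modsUpTo A (N : ℝ) with ¬ smoothPart z q ^ 4 ≤ N, (1 : ℝ) :=
          sum_le_sum fun q _ => weylNorm_le_one A h q
      _ = _ := by
          rw [sum_const, nsmul_eq_mul, mul_one]
          simp only [not_le]

end MeanValue

end CRTSets

/-! ### Trigonometric majorants of arcs -/

namespace CRTSets

section ArcMajorant

open Finset

/-- The periodised second Bernoulli polynomial. -/
noncomputable def perBern (y : ℝ) : ℝ := Int.fract y ^ 2 - Int.fract y + 6⁻¹

theorem hasSum_perBern (y : ℝ) :
    HasSum (fun k : ℕ => 1 / (k : ℝ) ^ 2 * Real.cos (2 * Real.pi * (k * y)))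
      (Real.pi ^ 2 * perBern y) := by
  have h := hasSum_one_div_nat_pow_mul_cos one_ne_zero (x := Int.fract y)
    ⟨Int.fract_nonneg y, (Int.fract_lt_one y).le⟩
  have h2 : (Polynomial.map (algebraMap ℚ ℝ) (Polynomial.bernoulli (2 * 1))).eval (Int.fract y)
      = perBern y := by
    rw [perBern, ← bernoulliFun_two]
    rfl
  rw [h2] at h
  convert h using 1
  · funext k
    rw [mul_one]
    congr 1
    rw [← Real.cos_sub_int_mul_two_pi _ (k * ⌊y⌋)]
    congr 1
    rw [Int.fract]
    push_cast
    ring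
  · rw [show (2 * 1 : ℕ).factorial = 2 from rfl]
    push_cast
    ring

theorem perBern_add_sub {ε : ℝ} (h0 : 0 < ε) (h1 : ε ≤ 1) (y : ℝ) :
    perBern (y + ε) - perBern y =
      2 * ε * Int.fract y + ε ^ 2 - ε - 2 * max (Int.fract y + ε - 1) 0 := by
  have ha := Int.fract_nonneg y
  have hb := Int.fract_lt_one y
  have hy : y = ⌊y⌋ + Int.fract y := (Int.floor_add_fract y).symm
  unfold perBern
  rcases lt_or_ge (Int.fract y + ε) 1 with h | h
  · have : Int.fract (y + ε) = Int.fract y + ε := by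
      rw [Int.fract_eq_iff]
      exact ⟨by linarith, h, ⌊y⌋, by linarith⟩
    rw [this, max_eq_right (by linarith)]
    ring
  · have : Int.fract (y + ε) = Int.fract y + ε - 1 := by
      rw [Int.fract_eq_iff]
      exact ⟨by linarith, by linarith, ⌊y⌋ + 1, by push_cast; linarith⟩
    rw [this, max_eq_left (by linarith)]
    ring

/-- The periodised trapezoidal function attached to an arc `[s, t]`. -/
noncomputable def trapezoid (s t ε x : ℝ) : ℝ :=
  t - s + ε - 1 / (2 * ε) * (perBern (x - s + ε) - perBern (x - s) - perBern (x - t) +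
    perBern (x - t - ε))

/-- Here `j` counts the translates of `x` in `[s, t + ε)`. The first `max` adds the rising ramp on
`[s - ε, s)` and the second cuts off the falling ramp on `[t, t + ε)`; both come from the
wrap-around in `perBern_add_sub`. Translates may overlap, so values above `1` are possible. -/
theorem trapezoid_eq {s t ε : ℝ} (h0 : 0 < ε) (h1 : ε ≤ 1) (hst : s ≤ t)
    (x : ℝ) : ∃ j : ℤ, 0 ≤ j ∧ Int.fract (x - t - ε) = Int.fract (x - s) - (t - s) - ε + j ∧
      trapezoid s t ε x = j + max (Int.fract (x - s) + ε - 1) 0 / ε -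
        max (Int.fract (x - t - ε) + ε - 1) 0 / ε := by
  refine ⟨⌊x - s⌋ - ⌊x - t - ε⌋, ?_, ?_, ?_⟩
  · rw [sub_nonneg]
    exact Int.floor_mono (by linarith)
  · simp only [Int.fract]
    push_cast
    ring
  · have e1 := perBern_add_sub h0 h1 (x - s)
    have e2 := perBern_add_sub h0 h1 (x - t - ε)
    rw [sub_add_cancel] at e2
    rw [trapezoid, show perBern (x - s + ε) - perBern (x - s) - perBern (x - t) +
      perBern (x - t - ε) = (perBern (x - s + ε) - perBern (x - s)) -
        (perBern (x - t) - perBern (x - t - ε)) by ring, e1, e2]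
    have e3 : Int.fract (x - t - ε) = Int.fract (x - s) - (t - s) - ε +
        ((⌊x - s⌋ - ⌊x - t - ε⌋ : ℤ) : ℝ) := by
      simp only [Int.fract]
      push_cast
      ring
    have e4 : ((⌊x - s⌋ - ⌊x - t - ε⌋ : ℤ) : ℝ) =
        Int.fract (x - t - ε) - Int.fract (x - s) + (t - s) + ε := by linarith
    rw [e4]
    field_simp
    ring

/-- The falling ramp subtracts at most `1`, and it vanishes when `j = 0`. -/
theorem trapezoid_nonneg {s t ε : ℝ} (h0 : 0 < ε) (h1 : ε ≤ 1) (hst : s ≤ t)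
    (x : ℝ) : 0 ≤ trapezoid s t ε x := by
  obtain ⟨j, hj, hw, he⟩ := trapezoid_eq h0 h1 hst x
  have ha := Int.fract_lt_one (x - s)
  have hb := Int.fract_lt_one (x - t - ε)
  have hm : 0 ≤ max (Int.fract (x - s) + ε - 1) 0 / ε := by positivity
  rw [he]
  rcases hj.eq_or_lt with rfl | hj
  · rw [max_eq_right (a := Int.fract (x - t - ε) + ε - 1) (by
      rw [hw]; push_cast; linarith), zero_div]
    push_cast
    linarith
  · have hj1 : (1 : ℝ) ≤ j := by exact_mod_cast hj
    have : max (Int.fract (x - t - ε) + ε - 1) 0 / ε ≤ 1 := by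
      rw [div_le_one h0]
      exact max_le (by linarith) h0.le
    linarith

/-- On the arc `j ≥ 1`. If `j = 1`, the fractional part of `x - t - ε` is at most `1 - ε` and the
falling ramp vanishes; if `j ≥ 2`, losing `1` does no harm. -/
theorem one_le_trapezoid {s t ε : ℝ} (h0 : 0 < ε) (h1 : ε ≤ 1) (hst : s ≤ t)
    {x : ℝ} {m : ℤ} (hs : s ≤ x + m) (ht : x + m ≤ t) : 1 ≤ trapezoid s t ε x := by
  obtain ⟨j, hj, hw, he⟩ := trapezoid_eq h0 h1 hst x
  have hb0 := Int.fract_nonneg (x - t - ε)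
  have hb := Int.fract_lt_one (x - t - ε)
  have hm : 0 ≤ max (Int.fract (x - s) + ε - 1) 0 / ε := by positivity
  have hfr : Int.fract (x - s) ≤ t - s := by
    have e : Int.fract (x - s) = Int.fract (x - s + m) := (Int.fract_add_intCast _ _).symm
    rw [e]
    have : 0 ≤ (⌊x - s + m⌋ : ℝ) := by exact_mod_cast Int.floor_nonneg.2 (by linarith)
    rw [Int.fract]
    linarith
  rw [he]
  have hj0 : (0 : ℝ) < j := by linarith
  have hj0 : 0 < j := by exact_mod_cast hj0
  rcases (show j = 1 ∨ 2 ≤ j by omega) with rfl | hj2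
  · rw [max_eq_right (a := Int.fract (x - t - ε) + ε - 1) (by
      rw [hw]; push_cast; linarith), zero_div]
    push_cast
    linarith
  · have hj2 : (2 : ℝ) ≤ j := by exact_mod_cast hj2
    have : max (Int.fract (x - t - ε) + ε - 1) 0 / ε ≤ 1 := by
      rw [div_le_one h0]
      exact max_le (by linarith) h0.le
    linarith

theorem abs_hasSum_sub_le {g : ℕ → ℝ} {S : ℝ} (hS : HasSum g S) (h0 : g 0 = 0)
    (hg : ∀ k, |g k| ≤ 4 * ((k : ℝ) ^ 2)⁻¹) {H : ℕ} (hH : 1 ≤ H) :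
    |S - ∑ k ∈ Ioc 0 H, g k| ≤ 4 / H := by
  have ht := (hS.tendsto_sum_nat.comp (Filter.tendsto_add_atTop_nat 1)).sub_const
    (∑ k ∈ Ioc 0 H, g k)
  refine le_of_tendsto ht.abs (Filter.eventually_atTop.2 ⟨H, fun N hN => ?_⟩)
  have h1 : ∑ k ∈ range (N + 1), g k = ∑ k ∈ Ioc 0 H, g k + ∑ k ∈ Ioc H N, g k := by
    rw [sum_Ioc_consecutive _ (Nat.zero_le H) hN]
    symm
    refine sum_subset (fun k hk => ?_) fun k hk hk' => ?_
    · rw [mem_Ioc] at hk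
      exact mem_range.2 (by omega)
    · rw [mem_range] at hk
      rw [mem_Ioc] at hk'
      rw [show k = 0 by omega, h0]
  rw [Function.comp_apply, h1, add_sub_cancel_left]
  calc |∑ k ∈ Ioc H N, g k| ≤ ∑ k ∈ Ioc H N, 4 * ((k : ℝ) ^ 2)⁻¹ :=
        (abs_sum_le_sum_abs _ _).trans (sum_le_sum fun k _ => hg k)
    _ ≤ 4 * ((H : ℝ)⁻¹ - (N : ℝ)⁻¹) := by
        rw [← mul_sum]
        gcongr
        exact sum_Ioc_inv_sq_le_sub (by omega) hN
    _ ≤ 4 / H := by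
        have : 0 ≤ (N : ℝ)⁻¹ := by positivity
        rw [div_eq_mul_inv]
        linarith

/-- A trigonometric polynomial majorising the indicator function of the arc `[s, t]`. -/
noncomputable def arcMajorant (s t : ℝ) (M : ℕ) (x : ℝ) : ℝ :=
  t - s + 2 / M - M / (2 * Real.pi ^ 2) * ∑ k ∈ Ioc 0 (M ^ 2),
    (1 / (k : ℝ) ^ 2 * Real.cos (2 * Real.pi * (k * (x - s + 1 / M)))
      - 1 / (k : ℝ) ^ 2 * Real.cos (2 * Real.pi * (k * (x - s)))
      - 1 / (k : ℝ) ^ 2 * Real.cos (2 * Real.pi * (k * (x - t)))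
      + 1 / (k : ℝ) ^ 2 * Real.cos (2 * Real.pi * (k * (x - t - 1 / M))))

/-- Truncating the Fourier series at `M ^ 2` changes the trapezoid of ramp `1 / M` by at most `2 /
(π ^ 2 M) ≤ 1 / M`. Raising the constant term from `t - s + 1 / M` to `t - s + 2 / M` compensates
for this. -/
theorem trapezoid_le_arcMajorant (s t : ℝ) {M : ℕ} (hM : 1 ≤ M) (x : ℝ) :
    trapezoid s t (1 / M) x ≤ arcMajorant s t M x := by
  have hM0 : (0 : ℝ) < M := by exact_mod_cast hM
  have hS := (((hasSum_perBern (x - s + 1 / M)).sub (hasSum_perBern (x - s))).sub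
    (hasSum_perBern (x - t))).add (hasSum_perBern (x - t - 1 / M))
  have hb := abs_hasSum_sub_le hS (by simp) (fun k => by
    have hc : ∀ y : ℝ, |1 / (k : ℝ) ^ 2 * Real.cos y| ≤ ((k : ℝ) ^ 2)⁻¹ := by
      intro y
      rw [abs_mul, one_div, abs_of_nonneg (by positivity : 0 ≤ ((k : ℝ) ^ 2)⁻¹)]
      exact mul_le_of_le_one_right (by positivity) (Real.abs_cos_le_one y)
    refine (abs_add_le _ _).trans ?_
    refine (add_le_add ((abs_sub _ _).trans (add_le_add ((abs_sub _ _).trans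
      (add_le_add (hc _) (hc _))) (hc _))) (hc _)).trans (le_of_eq (by ring)))
    (H := M ^ 2) (Nat.one_le_pow _ _ hM)
  have hb1 := (abs_le.1 hb).2
  rw [trapezoid, arcMajorant]
  set P := ∑ k ∈ Ioc 0 (M ^ 2),
    (1 / (k : ℝ) ^ 2 * Real.cos (2 * Real.pi * (k * (x - s + 1 / M)))
      - 1 / (k : ℝ) ^ 2 * Real.cos (2 * Real.pi * (k * (x - s)))
      - 1 / (k : ℝ) ^ 2 * Real.cos (2 * Real.pi * (k * (x - t)))
      + 1 / (k : ℝ) ^ 2 * Real.cos (2 * Real.pi * (k * (x - t - 1 / M)))) with hP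
  have hb2 := (abs_le.1 hb).1
  have hpi : (1 : ℝ) ≤ Real.pi ^ 2 := by nlinarith [Real.pi_gt_three]
  have hpi2 : (2 : ℝ) ≤ Real.pi ^ 2 := by nlinarith [Real.pi_gt_three]
  set B := perBern (x - s + 1 / M) - perBern (x - s) - perBern (x - t) +
    perBern (x - t - 1 / M) with hB
  have hb3 : P ≤ Real.pi ^ 2 * B + 4 / (M ^ 2 : ℕ) := by
    rw [hB]
    linarith
  have h5 : (M : ℝ) / (2 * Real.pi ^ 2) * P ≤ M / (2 * Real.pi ^ 2) * (Real.pi ^ 2 * B +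
      4 / (M ^ 2 : ℕ)) := by gcongr
  have h6 : (M : ℝ) / (2 * Real.pi ^ 2) * (Real.pi ^ 2 * B + 4 / (M ^ 2 : ℕ))
      = 1 / (2 * (1 / (M : ℝ))) * B + 2 / Real.pi ^ 2 * (1 / M) := by
    push_cast
    field_simp
    ring
  have h7 : 2 / Real.pi ^ 2 * (1 / (M : ℝ)) ≤ 1 * (1 / M) := by
    gcongr
    rw [div_le_one (by positivity)]
    exact hpi2
  have h8 : (2 : ℝ) / M = 1 / M + 1 / M := by ring
  linarith

theorem arcMajorant_nonneg {s t : ℝ} (hst : s ≤ t) {M : ℕ} (hM : 1 ≤ M)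
    (x : ℝ) : 0 ≤ arcMajorant s t M x := by
  have hM1 : (1 : ℝ) ≤ M := by exact_mod_cast hM
  refine (trapezoid_nonneg (ε := 1 / M) (by positivity) ?_ hst x).trans
    (trapezoid_le_arcMajorant s t hM x)
  rw [div_le_one (by linarith)]
  exact hM1

theorem one_le_arcMajorant {s t : ℝ} (hst : s ≤ t) {M : ℕ} (hM : 1 ≤ M)
    {x : ℝ} {m : ℤ} (hs : s ≤ x + m) (ht : x + m ≤ t) : 1 ≤ arcMajorant s t M x := by
  have hM1 : (1 : ℝ) ≤ M := by exact_mod_cast hM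
  refine (one_le_trapezoid (ε := 1 / M) (by positivity) ?_ hst hs ht).trans
    (trapezoid_le_arcMajorant s t hM x)
  rw [div_le_one (by linarith)]
  exact hM1

/-- The function `e(x) = exp(2πix)`. -/
noncomputable def unitExp (x : ℝ) : ℂ := Complex.exp (Complex.I * ((2 * Real.pi * x : ℝ) : ℂ))

theorem unitExp_add (x y : ℝ) : unitExp (x + y) = unitExp x * unitExp y := by
  rw [unitExp, unitExp, unitExp, ← Complex.exp_add]
  congr 1
  push_cast
  ring

theorem norm_unitExp (x : ℝ) : ‖unitExp x‖ = 1 := Complex.norm_exp_I_mul_ofReal _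

theorem norm_unitExp_sub_one_le (x : ℝ) : ‖unitExp x - 1‖ ≤ 2 * Real.pi * |x| := by
  refine Real.norm_exp_I_mul_ofReal_sub_one_le.trans (le_of_eq ?_)
  rw [Real.norm_eq_abs, abs_mul, abs_of_pos (by positivity)]

theorem unitExp_add_neg (x : ℝ) :
    unitExp x + unitExp (-x) = 2 * (Real.cos (2 * Real.pi * x) : ℂ) := by
  rw [unitExp, unitExp, Complex.ofReal_cos, Complex.two_cos]
  congr 2 <;> push_cast <;> ring

/-- The Fourier coefficients of `arcMajorant`. -/
noncomputable def arcCoeff (s t : ℝ) (M : ℕ) (k : ℤ) : ℂ :=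
  if k = 0 then ((t - s + 2 / M : ℝ) : ℂ) else
    -((M / (4 * Real.pi ^ 2 * (k : ℝ) ^ 2) : ℝ) : ℂ) *
      (unitExp (k * (-s + 1 / M)) - unitExp (k * (-s)) - unitExp (k * (-t)) +
        unitExp (k * (-t - 1 / M)))

theorem arcCoeff_zero (s t : ℝ) (M : ℕ) : arcCoeff s t M 0 = ((t - s + 2 / M : ℝ) : ℂ) := by
  simp [arcCoeff]

/-- Pairing the exponentials into differences of step `1 / M` gains `|k| / M`, which cancels the
factor `M` and leaves the decay of an interval, uniformly in `M`. -/
theorem norm_arcCoeff_le (s t : ℝ) {M : ℕ} (hM : 1 ≤ M) {k : ℤ} (hk : k ≠ 0) :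
    ‖arcCoeff s t M k‖ ≤ 1 / |(k : ℝ)| := by
  have hM0 : (0 : ℝ) < M := by exact_mod_cast hM
  have hk0 : (0 : ℝ) < |(k : ℝ)| := abs_pos.2 (by exact_mod_cast hk)
  rw [arcCoeff, if_neg hk, norm_mul, norm_neg, Complex.norm_real, Real.norm_eq_abs,
    abs_of_nonneg (by positivity)]
  have h1 : ‖unitExp (k * (-s + 1 / M)) - unitExp (k * (-s)) - unitExp (k * (-t)) +
      unitExp (k * (-t - 1 / M))‖ ≤ 4 * Real.pi * (|(k : ℝ)| / M) := by
    have a1 : unitExp (k * (-s + 1 / M)) = unitExp (k * (-s)) * unitExp (k / M) := by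
      rw [← unitExp_add]
      congr 1
      ring
    have a2 : unitExp (k * (-t - 1 / M)) = unitExp (k * (-t)) * unitExp (-(k / M)) := by
      rw [← unitExp_add]
      congr 1
      ring
    have e1 : unitExp (k * (-s + 1 / M)) - unitExp (k * (-s)) - unitExp (k * (-t)) +
        unitExp (k * (-t - 1 / M)) = unitExp (k * (-s)) * (unitExp (k / M) - 1) +
          unitExp (k * (-t)) * (unitExp (-(k / M)) - 1) := by
      rw [a1, a2]
      ring
    rw [e1]
    refine (norm_add_le _ _).trans ?_
    rw [norm_mul, norm_mul, norm_unitExp, norm_unitExp, one_mul, one_mul]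
    refine (add_le_add (norm_unitExp_sub_one_le _) (norm_unitExp_sub_one_le _)).trans
      (le_of_eq ?_)
    rw [abs_neg, abs_div, abs_of_pos hM0]
    ring
  calc (M : ℝ) / (4 * Real.pi ^ 2 * (k : ℝ) ^ 2) * _
      ≤ (M : ℝ) / (4 * Real.pi ^ 2 * (k : ℝ) ^ 2) * (4 * Real.pi * (|(k : ℝ)| / M)) := by
        gcongr
    _ = 1 / Real.pi * (1 / |(k : ℝ)|) := by
        rw [← sq_abs (k : ℝ)]
        field_simp
    _ ≤ 1 * (1 / |(k : ℝ)|) := by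
        gcongr
        rw [div_le_one Real.pi_pos]
        linarith [Real.pi_gt_three]
    _ = _ := one_mul _

theorem sum_Icc_neg_eq (F : ℤ → ℂ) (H : ℕ) :
    ∑ k ∈ Icc (-(H : ℤ)) H, F k = F 0 + ∑ k ∈ Ioc 0 H, (F k + F (-k)) := by
  induction H with
  | zero => simp
  | succ H ih =>
    have h1 : Icc (-((H + 1 : ℕ) : ℤ)) ((H + 1 : ℕ) : ℤ) =
        insert ((H + 1 : ℕ) : ℤ) (insert (-((H + 1 : ℕ) : ℤ)) (Icc (-(H : ℤ)) H)) := by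
      ext k
      simp only [mem_Icc, mem_insert]
      push_cast
      omega
    rw [h1, sum_insert (by
      simp only [mem_insert, mem_Icc]
      push_cast
      omega), sum_insert (by
      simp only [mem_Icc]
      push_cast
      omega), ih, sum_Ioc_succ_top (Nat.zero_le H)]
    push_cast
    ring

theorem sum_arcCoeff_eq (s t : ℝ) (M : ℕ) (x : ℝ) :
    ∑ k ∈ Icc (-((M ^ 2 : ℕ) : ℤ)) ((M ^ 2 : ℕ) : ℤ), arcCoeff s t M k * unitExp (k * x)
      = (arcMajorant s t M x : ℂ) := by
  rw [sum_Icc_neg_eq, arcCoeff_zero, arcMajorant, Complex.ofReal_sub,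
    sub_eq_add_neg ((t - s + 2 / M : ℝ) : ℂ), Complex.ofReal_mul, Complex.ofReal_sum, ← neg_mul,
    mul_sum]
  congr 1
  · simp [unitExp]
  refine sum_congr rfl fun k hk => ?_
  have hk0 : (k : ℤ) ≠ 0 := by
    rw [mem_Ioc] at hk
    omega
  rw [arcCoeff, if_neg hk0, arcCoeff, if_neg (neg_ne_zero.2 hk0)]
  have key : ∀ c : ℝ, unitExp (((k : ℤ) : ℝ) * c) * unitExp (((k : ℤ) : ℝ) * x) +
      unitExp (((-(k : ℤ) : ℤ) : ℝ) * c) * unitExp (((-(k : ℤ) : ℤ) : ℝ) * x) =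
      2 * (Real.cos (2 * Real.pi * (k * (x + c))) : ℂ) := by
    intro c
    rw [← unitExp_add, ← unitExp_add, ← unitExp_add_neg]
    congr 2 <;> push_cast <;> ring
  have k1 := key (-s + 1 / M)
  have k2 := key (-s)
  have k3 := key (-t)
  have k4 := key (-t - 1 / M)
  rw [show x + (-s + 1 / (M : ℝ)) = x - s + 1 / M by ring] at k1
  rw [← sub_eq_add_neg] at k2 k3
  rw [show x + (-t - 1 / (M : ℝ)) = x - t - 1 / M by ring] at k4
  have hsq : (((-(k : ℤ) : ℤ) : ℝ)) ^ 2 = (k : ℝ) ^ 2 := by push_cast; ring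
  have hsq' : (((k : ℤ) : ℝ)) ^ 2 = (k : ℝ) ^ 2 := by push_cast; ring
  rw [hsq, hsq']
  push_cast at k1 k2 k3 k4 ⊢
  linear_combination (-((M : ℂ) / (4 * (Real.pi : ℂ) ^ 2 * (k : ℂ) ^ 2))) * (k1 - k2 - k3 + k4)

end ArcMajorant

end CRTSets

/-! ### From exponential sums to box discrepancy -/

namespace CRTSets

section Discrepancy

open Finset

variable {n : ℕ}

/-- The arc of the circle that is the image of `[s, t]`. -/
def arc (s t : ℝ) : Set UnitAddCircle := (fun x : ℝ => (x : UnitAddCircle)) '' Set.Icc s t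

theorem mem_arc {s t x : ℝ} : (x : UnitAddCircle) ∈ arc s t ↔ ∃ m : ℤ, s ≤ x + m ∧ x + m ≤ t := by
  constructor
  · rintro ⟨y, ⟨h1, h2⟩, hy⟩
    have h3 := QuotientAddGroup.eq_iff_sub_mem.1 hy
    obtain ⟨m, hm⟩ := AddSubgroup.mem_zmultiples_iff.1 h3
    simp only [zsmul_eq_mul, mul_one] at hm
    exact ⟨m, by linarith, by linarith⟩
  · rintro ⟨m, h1, h2⟩
    refine ⟨x + m, ⟨h1, h2⟩, QuotientAddGroup.eq_iff_sub_mem.2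
      (AddSubgroup.mem_zmultiples_iff.2 ⟨m, ?_⟩)⟩
    simp

theorem measurableSet_arc (s t : ℝ) : MeasurableSet (arc s t) :=
  (isCompact_Icc.image (AddCircle.continuous_mk' 1)).isClosed.measurableSet

theorem volume_arc {s t : ℝ} (hst1 : t - s ≤ 1) :
    volume (arc s t) = ENNReal.ofReal (t - s) := by
  rw [← (UnitAddCircle.measurePreserving_mk s).measure_preimage
    (measurableSet_arc s t).nullMeasurableSet,
    Measure.restrict_apply ((UnitAddCircle.measurePreserving_mk s).measurable
      (measurableSet_arc s t)), ← Real.volume_Ioc]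
  refine le_antisymm ?_ ?_
  -- The fundamental domain is `(s, s + 1]`, where the endpoint `s` of the arc is represented by `s
  -- + 1`, a null set.
  · calc _ ≤ volume (Set.Ioc s t ∪ {s + 1}) := by
          refine measure_mono ?_
          rintro y ⟨hy, h1, h2⟩
          obtain ⟨m, hm1, hm2⟩ := mem_arc.1 hy
          by_cases hm : 0 ≤ m
          · have : (0 : ℝ) ≤ m := by exact_mod_cast hm
            exact Or.inl ⟨h1, by linarith⟩
          · have : (m : ℝ) ≤ -1 := by exact_mod_cast (show m ≤ -1 by omega)
            exact Or.inr (le_antisymm h2 (by linarith))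
      _ ≤ volume (Set.Ioc s t) + volume {s + 1} := measure_union_le _ _
      _ = volume (Set.Ioc s t) := by simp
  · refine measure_mono fun y hy => ⟨mem_arc.2 ⟨0, ?_, ?_⟩, hy.1, ?_⟩
    · simpa using hy.1.le
    · simpa using hy.2
    · linarith [hy.2]

theorem image_proj_eq (s t : Fin n → ℝ) :
    proj '' (Set.univ.pi fun i => Set.Icc (s i) (t i)) = Set.univ.pi fun i => arc (s i) (t i) := by
  ext x
  constructor
  · rintro ⟨y, hy, rfl⟩ i _
    exact ⟨y i, hy i trivial, rfl⟩
  · intro hx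
    choose y hy hyx using fun i => hx i trivial
    exact ⟨y, fun i _ => hy i, funext hyx⟩

theorem measurableSet_pi_arc (s t : Fin n → ℝ) :
    MeasurableSet (Set.univ.pi fun i => arc (s i) (t i)) :=
  MeasurableSet.univ_pi fun i => measurableSet_arc (s i) (t i)

theorem volume_real_pi_arc {s t : Fin n → ℝ} (hst : ∀ i, s i ≤ t i) (hst1 : ∀ i, t i - s i ≤ 1) :
    (volume : Measure (Torus n)).real (Set.univ.pi fun i => arc (s i) (t i))
      = ∏ i, (t i - s i) := by
  rw [measureReal_def, volume_pi_pi, ENNReal.toReal_prod]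
  refine prod_congr rfl fun i _ => ?_
  rw [volume_arc (hst1 i), ENNReal.toReal_ofReal (sub_nonneg.2 (hst i))]

variable (A : (m : ℕ) → Set (Fin n → ZMod m))

open Classical in
/-- The set `A_q` as a finite set. -/
noncomputable def crtFinset (q : ℕ) [NeZero q] : Finset (Fin n → ZMod q) :=
  univ.filter (· ∈ crtSet A q)

theorem card_crtFinset (q : ℕ) [NeZero q] : (crtFinset A q).card = rho A q := by
  classical
  rw [rho, Set.ncard_eq_toFinset_card']
  congr 1
  ext a
  simp [crtFinset]

theorem delta_real_eq (q : ℕ) [NeZero q] {B : Set (Torus n)} (hB : MeasurableSet B) :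
    (Delta A q).real B =
      (∑ a ∈ crtFinset A q, B.indicator (fun _ => (1 : ℝ)) (torusPoint q a)) / rho A q := by
  classical
  have h1 : (Measure.sum fun a : crtSet A q =>
      Measure.dirac (torusPoint q (a : Fin n → ZMod q))) B =
      ∑ a ∈ crtFinset A q, B.indicator (fun _ => (1 : ENNReal)) (torusPoint q a) := by
    rw [Measure.sum_apply _ hB, tsum_fintype]
    simp_rw [Measure.dirac_apply' _ hB]
    exact (Finset.sum_subtype (crtFinset A q) (p := (· ∈ crtSet A q))
      (fun a => by simp [crtFinset])
      fun a => B.indicator (fun _ => (1 : ENNReal)) (torusPoint q a)).symm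
  rw [measureReal_def, Delta, Measure.smul_apply, h1, smul_eq_mul, ENNReal.toReal_mul,
    ENNReal.toReal_inv, ENNReal.toReal_natCast, ENNReal.toReal_sum, inv_mul_eq_div]
  · congr 1
    refine sum_congr rfl fun a _ => ?_
    by_cases ha : torusPoint q a ∈ B <;> simp [ha]
  · intro a _
    by_cases ha : torusPoint q a ∈ B <;> simp [ha]

theorem stdAddChar_intCast_mul (q : ℕ) [NeZero q] (k : ℤ) (a : ZMod q) :
    ZMod.stdAddChar ((k : ZMod q) * a) = unitExp (k * ((a.val : ℝ) / q)) := by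
  have ha : (k : ZMod q) * a = ((k * (a.val : ℤ) : ℤ) : ZMod q) := by
    push_cast
    rw [ZMod.natCast_zmod_val]
  rw [ha, ZMod.stdAddChar_coe, unitExp]
  congr 1
  push_cast
  ring

theorem addChar_sum_eq_prod {q : ℕ} (ψ : AddChar (ZMod q) ℂ) {ι : Type*} (s : Finset ι)
    (x : ι → ZMod q) : ψ (∑ i ∈ s, x i) = ∏ i ∈ s, ψ (x i) := by
  classical
  induction s using Finset.induction_on with
  | empty => simp
  | insert i s hi ih => rw [sum_insert hi, prod_insert hi, AddChar.map_add_eq_mul, ih]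

/-- Frequencies used in the bound for the discrepancy. -/
noncomputable def frequencies (n M : ℕ) : Finset (Fin n → ℤ) :=
  Fintype.piFinset fun _ => Icc (-((M ^ 2 : ℕ) : ℤ)) ((M ^ 2 : ℕ) : ℤ)

/-- The weight of a frequency in one dimension. -/
noncomputable def freqWeight (k : ℤ) : ℝ := if k = 0 then 3 else 1 / |(k : ℝ)|

theorem freqWeight_nonneg (k : ℤ) : 0 ≤ freqWeight k := by
  unfold freqWeight
  split_ifs <;> positivity

/-- The bound for the excess of points in boxes. -/
noncomputable def boxError (M q : ℕ) : ℝ :=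
  4 ^ n * (2 / M) + ∑ k ∈ (frequencies n M).erase 0, (∏ i, freqWeight (k i)) * weylNorm A k q

theorem boxError_nonneg (M q : ℕ) : 0 ≤ boxError A M q :=
  add_nonneg (by positivity) (sum_nonneg fun k _ =>
    mul_nonneg (prod_nonneg fun _ _ => freqWeight_nonneg _) (weylNorm_nonneg A k q))

theorem prod_add_le {ι : Type*} (s : Finset ι) {ℓ : ι → ℝ} (h0 : ∀ i, 0 ≤ ℓ i) (h1 : ∀ i, ℓ i ≤ 1)
    {d : ℝ} (hd : 0 ≤ d) (hd2 : d ≤ 2) :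
    ∏ i ∈ s, (ℓ i + d) ≤ ∏ i ∈ s, ℓ i + 4 ^ s.card * d := by
  classical
  induction s using Finset.induction_on with
  | empty => simpa using hd
  | insert i s hi ih =>
    rw [prod_insert hi, prod_insert hi, card_insert_of_notMem hi]
    have hQ : ∏ j ∈ s, ℓ j ≤ 1 := prod_le_one (fun j _ => h0 j) fun j _ => h1 j
    have hQ0 : 0 ≤ ∏ j ∈ s, ℓ j := prod_nonneg fun j _ => h0 j
    have h4 : (1 : ℝ) ≤ 4 ^ s.card := one_le_pow₀ (by norm_num)
    calc (ℓ i + d) * ∏ j ∈ s, (ℓ j + d) ≤ (ℓ i + d) * (∏ j ∈ s, ℓ j + 4 ^ s.card * d) := by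
          have := h0 i
          gcongr
      _ = ℓ i * ∏ j ∈ s, ℓ j + d * ∏ j ∈ s, ℓ j + (ℓ i + d) * (4 ^ s.card * d) := by ring
      _ ≤ ℓ i * ∏ j ∈ s, ℓ j + d * 4 ^ s.card + 3 * (4 ^ s.card * d) := by
          have := h1 i
          gcongr
          · linarith
          · linarith
      _ = _ := by ring

theorem sum_prod_arcMajorant_eq (q : ℕ) [NeZero q] (s t : Fin n → ℝ) (M : ℕ) :
    ((∑ a ∈ crtFinset A q, ∏ i, arcMajorant (s i) (t i) M (((a i).val : ℝ) / q) : ℝ) : ℂ) =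
      ∑ k ∈ frequencies n M, (∏ i, arcCoeff (s i) (t i) M (k i)) * expSum A k q 1 := by
  classical
  push_cast
  calc ∑ a ∈ crtFinset A q, ∏ i, (arcMajorant (s i) (t i) M (((a i).val : ℝ) / q) : ℂ)
      = ∑ a ∈ crtFinset A q, ∑ k ∈ frequencies n M,
          (∏ i, arcCoeff (s i) (t i) M (k i)) * ZMod.stdAddChar (∑ i, (k i : ZMod q) * a i) := by
        refine sum_congr rfl fun a _ => ?_
        simp_rw [← sum_arcCoeff_eq]
        rw [prod_univ_sum]
        refine sum_congr rfl fun k _ => ?_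
        rw [prod_mul_distrib, addChar_sum_eq_prod]
        congr 1
        exact prod_congr rfl fun i _ => (stdAddChar_intCast_mul q (k i) (a i)).symm
    _ = ∑ k ∈ frequencies n M, (∏ i, arcCoeff (s i) (t i) M (k i)) *
          ∑ a ∈ crtFinset A q, ZMod.stdAddChar (∑ i, (k i : ZMod q) * a i) := by
        rw [sum_comm]
        simp_rw [mul_sum]
    _ = _ := by
        refine sum_congr rfl fun k _ => ?_
        congr 1
        rw [crtFinset, sum_filter, expSum]
        simp only [one_mul]
        rfl

/-- The product of the nonnegative arc majorants majorises the box. Its zero frequency yields the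
volume up to `4 ^ n * (2 / M)`, and the others yield the weighted exponential sums. -/
theorem delta_real_pi_arc_le {q : ℕ} [NeZero q] (hρ : 1 ≤ rho A q) {M : ℕ} (hM : 1 ≤ M)
    {s t : Fin n → ℝ} (hst : ∀ i, s i ≤ t i) (hst1 : ∀ i, t i - s i ≤ 1) :
    (Delta A q).real (Set.univ.pi fun i => arc (s i) (t i)) ≤
      ∏ i, (t i - s i) + boxError A M q := by
  classical
  have hρ0 : (0 : ℝ) < rho A q := by exact_mod_cast hρ
  have hM0 : (0 : ℝ) < M := by exact_mod_cast hM
  have hM1 : (1 : ℝ) ≤ M := by exact_mod_cast hM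
  have hd2 : (2 : ℝ) / M ≤ 2 := div_le_self (by norm_num) hM1
  rw [delta_real_eq A q (measurableSet_pi_arc s t), div_le_iff₀ hρ0]
  set F : (Fin n → ZMod q) → ℝ := fun a => ∏ i, arcMajorant (s i) (t i) M (((a i).val : ℝ) / q)
  have hF0 : ∀ a, 0 ≤ F a := fun a => prod_nonneg fun i _ => arcMajorant_nonneg (hst i) hM _
  have h1 : ∑ a ∈ crtFinset A q,
      (Set.univ.pi fun i => arc (s i) (t i)).indicator (fun _ => (1 : ℝ)) (torusPoint q a)
        ≤ ∑ a ∈ crtFinset A q, F a := by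
    refine sum_le_sum fun a _ => ?_
    rw [Set.indicator_apply]
    split_ifs with ha
    · rw [← prod_const_one (ι := Fin n) (s := univ)]
      refine prod_le_prod (fun _ _ => zero_le_one) fun i _ => ?_
      obtain ⟨m, hm1, hm2⟩ := mem_arc.1 (ha i trivial)
      exact one_le_arcMajorant (hst i) hM hm1 hm2
    · exact hF0 a
  -- Being nonnegative, the sum equals its norm, so the triangle inequality applies after Fourier
  -- expansion.
  have h2 : ∑ a ∈ crtFinset A q, F a =
      ‖∑ k ∈ frequencies n M, (∏ i, arcCoeff (s i) (t i) M (k i)) * expSum A k q 1‖ := by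
    rw [← sum_prod_arcMajorant_eq, Complex.norm_real, Real.norm_of_nonneg]
    exact sum_nonneg fun a _ => hF0 a
  have h0mem : (0 : Fin n → ℤ) ∈ frequencies n M := by
    simp [frequencies, Fintype.mem_piFinset]
  have hc0 : ∀ i, ‖arcCoeff (s i) (t i) M 0‖ = t i - s i + 2 / M := fun i => by
    rw [arcCoeff_zero, Complex.norm_real, Real.norm_of_nonneg]
    have := sub_nonneg.2 (hst i)
    positivity
  have hcw : ∀ i k, ‖arcCoeff (s i) (t i) M k‖ ≤ freqWeight k := by
    intro i k
    unfold freqWeight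
    split_ifs with hk
    · rw [hk, hc0]
      linarith [hst1 i]
    · exact norm_arcCoeff_le _ _ hM hk
  refine h1.trans ?_
  rw [h2]
  refine (norm_sum_le _ _).trans ?_
  rw [← add_sum_erase _ _ h0mem, boxError, ← add_assoc, add_mul]
  refine add_le_add ?_ ?_
  · rw [norm_mul]
    refine mul_le_mul ?_ (norm_expSum_le A 0 q 1) (norm_nonneg _) ?_
    · rw [norm_prod]
      simp only [Pi.zero_apply, hc0]
      simpa using prod_add_le univ (fun i => sub_nonneg.2 (hst i)) hst1
        (d := 2 / (M : ℝ)) (by positivity) hd2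
    · exact add_nonneg (prod_nonneg fun i _ => sub_nonneg.2 (hst i)) (by positivity)
  · rw [sum_mul]
    refine sum_le_sum fun k _ => ?_
    rw [norm_mul, norm_prod, mul_assoc, weylNorm_eq, div_mul_cancel₀ _ hρ0.ne']
    gcongr
    exact hcw _ _

theorem delta_real_univ {q : ℕ} [NeZero q] (hρ : 1 ≤ rho A q) :
    (Delta A q).real Set.univ = 1 := by
  have hρ0 : (rho A q : ℝ) ≠ 0 := by
    have : (1 : ℝ) ≤ rho A q := by exact_mod_cast hρ
    positivity
  rw [delta_real_eq A q MeasurableSet.univ]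
  simp [card_crtFinset, hρ0]

/-- The lower endpoint of the `j`-th side of the `i`-th box in a cover of the complement of the box
with sides `[s j, t j]`. -/
noncomputable def coverLeft (s t : Fin n → ℝ) (i j : Fin n) : ℝ :=
  if j < i then s j else if j = i then t j else 0

/-- The upper endpoint of the `j`-th side of the `i`-th box in a cover of the complement of the box
with sides `[s j, t j]`. -/
noncomputable def coverRight (s t : Fin n → ℝ) (i j : Fin n) : ℝ :=
  if j < i then t j else if j = i then s j + 1 else 1

theorem coverLeft_le_coverRight {s t : Fin n → ℝ} (hst : ∀ i, s i ≤ t i)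
    (hst1 : ∀ i, t i - s i ≤ 1) (i j : Fin n) : coverLeft s t i j ≤ coverRight s t i j := by
  unfold coverLeft coverRight
  split_ifs
  · exact hst j
  · linarith [hst1 j]
  · exact zero_le_one

theorem coverRight_sub_coverLeft_le {s t : Fin n → ℝ} (hst : ∀ i, s i ≤ t i)
    (hst1 : ∀ i, t i - s i ≤ 1) (i j : Fin n) : coverRight s t i j - coverLeft s t i j ≤ 1 := by
  unfold coverLeft coverRight
  split_ifs
  · exact hst1 j
  · linarith [hst j]
  · simp

/-- The cover sorts points by the first coordinate that leaves the box, and the volumes telescope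
accordingly; the later coordinates are unrestricted and contribute `1`. -/
theorem sum_prod_cover_eq (s t : Fin n → ℝ) :
    ∑ i, ∏ j, (coverRight s t i j - coverLeft s t i j) = 1 - ∏ j, (t j - s j) := by
  classical
  have h := prod_one_sub_ordered (univ : Finset (Fin n)) fun i => 1 - (t i - s i)
  simp only [sub_sub_cancel] at h
  rw [h, sub_sub_cancel]
  refine sum_congr rfl fun i _ => ?_
  rw [← mul_prod_erase univ _ (mem_univ i)]
  congr 1
  · simp [coverLeft, coverRight]
    ring
  · rw [prod_filter, ← mul_prod_erase univ (fun j => if j < i then t j - s j else 1) (mem_univ i)]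
    rw [if_neg (lt_irrefl i), one_mul]
    refine prod_congr rfl fun j hj => ?_
    have hji := ne_of_mem_erase hj
    unfold coverLeft coverRight
    split_ifs <;> simp

theorem mem_arc_or (s t : ℝ) (x : UnitAddCircle) : x ∈ arc s t ∨ x ∈ arc t (s + 1) := by
  induction x using QuotientAddGroup.induction_on with
  | H y =>
    have h1 := Int.fract_nonneg (y - s)
    have h2 := Int.fract_lt_one (y - s)
    have h3 : y + ((-⌊y - s⌋ : ℤ) : ℝ) = s + Int.fract (y - s) := by
      rw [Int.fract]
      push_cast
      ring
    rcases le_total (s + Int.fract (y - s)) t with h | h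
    · exact Or.inl (mem_arc.2 ⟨-⌊y - s⌋, by rw [h3]; linarith, by rw [h3]; exact h⟩)
    · exact Or.inr (mem_arc.2 ⟨-⌊y - s⌋, by rw [h3]; exact h, by rw [h3]; linarith⟩)

theorem exists_mem_cover (s t : Fin n → ℝ) (x : Torus n)
    (hx : x ∉ Set.univ.pi fun i => arc (s i) (t i)) :
    ∃ i, x ∈ Set.univ.pi fun j => arc (coverLeft s t i j) (coverRight s t i j) := by
  classical
  have hne : (univ.filter fun i => x i ∉ arc (s i) (t i)).Nonempty := by
    by_contra hcon
    rw [not_nonempty_iff_eq_empty, filter_eq_empty_iff] at hcon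
    exact hx fun i _ => not_not.1 (hcon (mem_univ i))
  set i := (univ.filter fun i => x i ∉ arc (s i) (t i)).min' hne
  have hi : x i ∉ arc (s i) (t i) := (mem_filter.1 (min'_mem _ hne)).2
  refine ⟨i, fun j _ => ?_⟩
  change x j ∈ arc (coverLeft s t i j) (coverRight s t i j)
  unfold coverLeft coverRight
  split_ifs with h1 h2
  · by_contra hj
    exact absurd (min'_le _ j (mem_filter.2 ⟨mem_univ j, hj⟩)) (not_le.2 h1)
  · rw [h2]
    exact (mem_arc_or (s i) (t i) (x i)).resolve_left hi
  · rcases mem_arc_or 0 0 (x j) with ⟨y, hy, hyx⟩ | h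
    · exact ⟨y, ⟨hy.1, hy.2.trans zero_le_one⟩, hyx⟩
    · simpa using h

/-- Products of minorants need not be minorants, so the lower bound comes from the upper bound for
the `n` boxes covering the complement, whose volumes add up to exactly the complementary volume.
This costs the factor `n`. -/
theorem disc_le (hn : 1 ≤ n) {q : ℕ} [NeZero q] (hρ : 1 ≤ rho A q) {M : ℕ} (hM : 1 ≤ M) :
    disc (Delta A q) ≤ n * boxError A M q := by
  classical
  have hE := boxError_nonneg A M q
  have hn1 : (1 : ℝ) ≤ n := by exact_mod_cast hn
  have hρ0 : (0 : ℝ) < rho A q := by exact_mod_cast hρ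
  refine Real.sSup_le ?_ (by positivity)
  rintro r ⟨B, ⟨s, t, hst, hst1, rfl⟩, rfl⟩
  rw [image_proj_eq, volume_real_pi_arc hst hst1, abs_le]
  constructor
  · have h1 : (Delta A q).real Set.univ ≤
        (Delta A q).real (Set.univ.pi fun i => arc (s i) (t i)) +
          ∑ i, (Delta A q).real
            (Set.univ.pi fun j => arc (coverLeft s t i j) (coverRight s t i j)) := by
      rw [delta_real_eq A q MeasurableSet.univ, delta_real_eq A q (measurableSet_pi_arc s t)]
      simp_rw [delta_real_eq A q (measurableSet_pi_arc (coverLeft s t _) (coverRight s t _))]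
      rw [← sum_div, ← add_div, sum_comm, ← sum_add_distrib]
      gcongr with a
      rw [Set.indicator_of_mem (Set.mem_univ _)]
      have hnn : ∀ i, 0 ≤ (Set.univ.pi fun j =>
          arc (coverLeft s t i j) (coverRight s t i j)).indicator (fun _ => (1 : ℝ))
          (torusPoint q a) := fun i => Set.indicator_nonneg (fun _ _ => zero_le_one) _
      by_cases ha : torusPoint q a ∈ Set.univ.pi fun i => arc (s i) (t i)
      · rw [Set.indicator_of_mem ha]
        exact le_add_of_nonneg_right (sum_nonneg fun i _ => hnn i)
      · obtain ⟨i, hi⟩ := exists_mem_cover s t _ ha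
        rw [Set.indicator_of_notMem ha, zero_add]
        refine le_trans (by rw [Set.indicator_of_mem hi])
          (single_le_sum (fun i _ => hnn i) (mem_univ i))
    have h2 : ∑ i, (Delta A q).real
            (Set.univ.pi fun j => arc (coverLeft s t i j) (coverRight s t i j)) ≤
        ∑ i, (∏ j, (coverRight s t i j - coverLeft s t i j) + boxError A M q) :=
      sum_le_sum fun i _ => delta_real_pi_arc_le A hρ hM (coverLeft_le_coverRight hst hst1 i)
        (coverRight_sub_coverLeft_le hst hst1 i)
    rw [sum_add_distrib, sum_prod_cover_eq, sum_const, card_univ, Fintype.card_fin,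
      nsmul_eq_mul] at h2
    rw [delta_real_univ A hρ] at h1
    linarith
  · have h := delta_real_pi_arc_le A hρ hM hst hst1
    nlinarith

end Discrepancy

end CRTSets

/-! ### Choice of parameters and conclusion -/

namespace CRTSets

section Average

open Finset

variable {n : ℕ}

theorem modsUpTo_floor (A : (m : ℕ) → Set (Fin n → ZMod m)) (x : ℝ) :
    modsUpTo A x = modsUpTo A ((⌊x⌋₊ : ℕ) : ℝ) := by
  simp [modsUpTo]

theorem primesUpTo_floor (A : (m : ℕ) → Set (Fin n → ZMod m)) (x : ℝ) :
    primesUpTo A x = primesUpTo A ((⌊x⌋₊ : ℕ) : ℝ) := by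
  simp [primesUpTo]

/-- Chebyshev's bound at `x₀`. It serves to put a factor `2 / α ≥ 1` on the smoothing term, which
never meets the lower bound for the number of moduli. -/
theorem DensityAssumption.le_two {A : (m : ℕ) → Set (Fin n → ZMod m)} {α x₀ : ℝ}
    (hA : DensityAssumption A α x₀) : α ≤ 2 := by
  obtain ⟨-, hx, h⟩ := hA
  have hx0 : 0 < x₀ := by linarith
  have h1 : ∑ p ∈ primesUpTo A x₀, Real.log p ≤ Chebyshev.theta x₀ := by
    rw [Chebyshev.theta]
    refine sum_le_sum_of_subset_of_nonneg (fun p hp => ?_) fun p _ _ => Real.log_natCast_nonneg p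
    simp only [primesUpTo, mem_filter, mem_Icc, mem_Ioc] at hp ⊢
    exact ⟨⟨hp.1.1, hp.1.2⟩, hp.2.1⟩
  have h2 := Chebyshev.theta_le_log4_mul_x hx0.le
  have h3 : Real.log 4 ≤ 2 := by
    rw [show (4 : ℝ) = 2 ^ 2 by norm_num, Real.log_pow]
    have := Real.log_two_lt_d9
    push_cast
    linarith
  have h4 := (h x₀ le_rfl).trans (h1.trans h2)
  exact (le_of_mul_le_mul_right h4 hx0).trans h3

variable (A : (m : ℕ) → Set (Fin n → ZMod m))

theorem defect_nonneg (hn : 1 ≤ n) (N : ℕ) : 0 ≤ defect A N := by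
  refine sum_nonneg fun p hp => ?_
  obtain ⟨-, hp, hρ⟩ := (mem_primesUpTo A).1 hp
  have hρ0 : (0 : ℝ) < rho A p := by exact_mod_cast hρ
  have := div_le_one_of_le₀ (show (lam A p : ℝ) ≤ rho A p by exact_mod_cast lam_le_rho A hn hp)
    hρ0.le
  exact mul_nonneg (by linarith) (by positivity)

theorem defect_le_recipSum (N : ℕ) : defect A N ≤ recipSum A N := by
  refine sum_le_sum fun p _ => mul_le_of_le_one_left (by positivity) ?_
  have : 0 ≤ (lam A p : ℝ) / rho A p := by positivity
  linarith

/-- A logarithm of `N` beyond which `recipSum A N` is a small multiple of `log N`. -/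
noncomputable def logThreshold : ℝ := 336 * ((⌈Real.exp 672⌉₊ : ℕ) + 1)

/-- Cutting at `w` with `log w ≥ 672` makes the large primes contribute at most `(log N) / 336`, and
the threshold absorbs `w + 1` into an equal amount. The target `168 = 8 * 21` is what forces `log z
≥ 20` later. -/
theorem recipSum_add_one_le {N : ℕ} (hN : 1 ≤ N) (hlog : logThreshold ≤ Real.log N) :
    recipSum A N + 1 ≤ Real.log N / 168 := by
  set w := ⌈Real.exp 672⌉₊ with hw
  have hwe : Real.exp 672 ≤ w := Nat.le_ceil _
  have hlw : 672 ≤ Real.log w := by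
    rw [Real.le_log_iff_exp_le (lt_of_lt_of_le (Real.exp_pos _) hwe)]
    exact hwe
  have hw2 : 2 ≤ w := by
    by_contra hlt
    have : w = 0 ∨ w = 1 := by omega
    rcases this with h | h <;> rw [h] at hlw <;> norm_num at hlw
  have h1 : recipSum A N ≤ ∑ p ∈ N.primesLE, 1 / (p : ℝ) := by
    refine sum_le_sum_of_subset_of_nonneg (fun p hp => ?_) fun p _ _ => by positivity
    obtain ⟨h1, h2, -⟩ := (mem_primesUpTo A).1 hp
    exact Nat.mem_primesLE.2 ⟨h1, h2⟩
  have h2 := sum_inv_primesLE_le hw2 hN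
  have h3 : 2 * Real.log N / Real.log w ≤ 2 * Real.log N / 672 := by
    have := Real.log_natCast_nonneg N
    gcongr
  rw [logThreshold, ← hw] at hlog
  linarith

/-- The constant in the bound for the mean of the normalised Weyl sums. -/
noncomputable def weylConst : ℝ := 80 * meanConst + 2 + rankinConst

theorem weylConst_pos : 0 < weylConst := by
  have := meanConst_pos
  have := rankinConst_nonneg
  unfold weylConst
  positivity

theorem log_le_two_mul_sqrt {N : ℝ} (hN : 0 < N) : Real.log N ≤ 2 * Real.sqrt N := by
  have h := Real.log_le_sub_one_of_pos (Real.sqrt_pos.2 hN)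
  rw [Real.log_sqrt hN.le] at h
  linarith

/-- All three error sources are brought to one shape. The two factors `S + 1` come from `1 / log z`
and from `1 + 2 log H`. -/
theorem sum_weylNorm_le_mul_exp (hn : 1 ≤ n) {h : Fin n → ℤ} (hh : h ≠ 0) {H : ℕ}
    (hH : ∀ i, (h i).natAbs ≤ H) {N : ℕ} (hN : 1 ≤ N) (hlog : logThreshold ≤ Real.log N)
    (hlH : Real.log H ≤ 2 * (defect A N + 1)) :
    ∑ q ∈ modsUpTo A (N : ℝ), weylNorm A h q ≤
      weylConst * (defect A N + 1) ^ 2 * (N / Real.log N * Real.exp (recipSum A N)) *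
        Real.exp (-(defect A N / 2)) := by
  have hS := defect_nonneg A hn N
  have hSL := defect_le_recipSum A N
  have hL := recipSum_add_one_le A hN hlog
  set S := defect A N
  set L := recipSum A N
  set ℓ := Real.log N with hℓ
  have hN0 : (0 : ℝ) < N := by exact_mod_cast hN
  have hℓ0 : 0 < ℓ := by linarith
  -- With `log z` between `T - 1` and `T`, `8 T ≤ ℓ` ensures `z ^ 8 ≤ N`, and Rankin's exponent is
  -- at least `ℓ / (4 T) = 2 (S + 1)`, more than the required `S / 2`.
  set T := ℓ / (8 * (S + 1)) with hT
  have hT21 : 21 ≤ T := by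
    rw [hT, le_div_iff₀ (by positivity)]
    linarith
  set z := ⌊Real.exp T⌋₊ with hz
  have hzle : (z : ℝ) ≤ Real.exp T := Nat.floor_le (Real.exp_pos _).le
  have hzge : Real.exp (T - 1) ≤ z := by
    have h1 := Nat.lt_floor_add_one (Real.exp T)
    have h2 : Real.exp T = Real.exp (T - 1) * Real.exp 1 := by
      rw [← Real.exp_add, sub_add_cancel]
    have h3 : 2 ≤ Real.exp 1 := by linarith [Real.add_one_le_exp (1 : ℝ)]
    have h4 : 1 ≤ Real.exp (T - 1) := Real.one_le_exp (by linarith)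
    nlinarith
  have hz0 : (0 : ℝ) < z := lt_of_lt_of_le (Real.exp_pos _) hzge
  have hlzle : Real.log z ≤ T := (Real.log_le_iff_le_exp hz0).2 hzle
  have hlzge : T - 1 ≤ Real.log z := (Real.le_log_iff_exp_le hz0).2 hzge
  have hlz20 : 20 ≤ Real.log z := by linarith
  have hz8 : z ^ 8 ≤ N := by
    have : (z : ℝ) ^ 8 ≤ N := by
      calc (z : ℝ) ^ 8 ≤ Real.exp T ^ 8 := by gcongr
        _ = Real.exp (8 * T) := by
          rw [← Real.exp_nat_mul]
          norm_num
        _ ≤ Real.exp ℓ := by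
          refine Real.exp_le_exp.2 ?_
          rw [hT, ← mul_div_assoc, div_le_iff₀ (by positivity)]
          nlinarith
        _ = N := Real.exp_log hN0
    exact_mod_cast this
  refine (sum_weylNorm_le A hn hh hH hlz20 hz8).trans ?_
  have hE : Real.exp (L - S / 2) = Real.exp L * Real.exp (-(S / 2)) := by
    rw [← Real.exp_add, sub_eq_add_neg]
  have hu : 1 ≤ (S + 1) ^ 2 := one_le_pow₀ (by linarith)
  have hm := meanConst_pos
  have hr := rankinConst_nonneg
  have t1 : meanConst * (N / Real.log z) * Real.exp (L - S / 2) * (1 + 2 * Real.log H) ≤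
      80 * meanConst * (S + 1) ^ 2 * (N / ℓ * Real.exp L) * Real.exp (-(S / 2)) := by
    have e1 : N / Real.log z ≤ 16 * (S + 1) * (N / ℓ) := by
      calc (N : ℝ) / Real.log z ≤ N / (T / 2) := by gcongr; linarith
        _ = 16 * (S + 1) * (N / ℓ) := by
          rw [hT]
          field_simp
          ring
    have e2 : 1 + 2 * Real.log H ≤ 5 * (S + 1) := by linarith
    have e3 : 0 ≤ 1 + 2 * Real.log H := by
      have := Real.log_natCast_nonneg H
      positivity
    calc _ ≤ meanConst * (16 * (S + 1) * (N / ℓ)) * Real.exp (L - S / 2) * (5 * (S + 1)) := by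
          gcongr
      _ = _ := by
          rw [hE]
          ring
  have t2 : Real.sqrt N ≤
      2 * (S + 1) ^ 2 * (N / ℓ * Real.exp L) * Real.exp (-(S / 2)) := by
    have e1 : Real.sqrt N ≤ 2 * (N / ℓ) := by
      rw [← mul_div_assoc, le_div_iff₀ hℓ0]
      nlinarith [log_le_two_mul_sqrt hN0, Real.sqrt_nonneg N, Real.mul_self_sqrt hN0.le]
    have e2 : 1 ≤ Real.exp (L - S / 2) := Real.one_le_exp (by linarith)
    calc Real.sqrt N ≤ 2 * (N / ℓ) := e1
      _ = 2 * 1 * (N / ℓ) * 1 := by ring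
      _ ≤ 2 * (S + 1) ^ 2 * (N / ℓ) * Real.exp (L - S / 2) := by gcongr
      _ = _ := by
          rw [hE]
          ring
  have t3 : rankinConst * (N / ℓ) * Real.exp L * Real.exp (-(ℓ / (4 * Real.log z))) ≤
      rankinConst * (S + 1) ^ 2 * (N / ℓ * Real.exp L) * Real.exp (-(S / 2)) := by
    have e1 : S / 2 ≤ ℓ / (4 * Real.log z) := by
      calc S / 2 ≤ 2 * (S + 1) := by linarith
        _ = ℓ / (4 * T) := by
          rw [hT]
          field_simp
          ring
        _ ≤ _ := by gcongr
    calc _ ≤ rankinConst * (N / ℓ) * Real.exp L * Real.exp (-(S / 2)) := by gcongr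
      _ = rankinConst * 1 * (N / ℓ * Real.exp L) * Real.exp (-(S / 2)) := by ring
      _ ≤ _ := by gcongr
  rw [weylConst]
  linarith

theorem sum_freqWeight_le (K : ℕ) :
    ∑ k ∈ Icc (-(K : ℤ)) K, freqWeight k ≤ 5 + 2 * Real.log K := by
  have hsub : Icc (-(K : ℤ)) K ⊆ {0} ∪ ((Icc 1 K).image (fun j : ℕ => (j : ℤ)) ∪
      (Icc 1 K).image (fun j : ℕ => -(j : ℤ))) := by
    intro k hk
    rw [mem_Icc] at hk
    simp only [mem_union, mem_singleton, mem_image, mem_Icc]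
    rcases lt_trichotomy k 0 with h | h | h
    · exact Or.inr (Or.inr ⟨k.natAbs, by omega, by omega⟩)
    · exact Or.inl h
    · exact Or.inr (Or.inl ⟨k.natAbs, by omega, by omega⟩)
  have hpos : ∑ j ∈ Icc 1 K, (1 : ℝ) / j ≤ 1 + Real.log K := by
    have h := harmonic_le_one_add_log K
    rw [harmonic_eq_sum_Icc] at h
    push_cast at h
    simpa [one_div] using h
  have hw : ∀ j ∈ Icc 1 K, freqWeight (j : ℤ) = 1 / j ∧ freqWeight (-(j : ℤ)) = 1 / j := by
    intro j hj
    have hj0 : j ≠ 0 := by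
      have := (mem_Icc.1 hj).1
      omega
    constructor <;> simp [freqWeight, hj0]
  refine (sum_le_sum_of_subset_of_nonneg hsub fun k _ _ => freqWeight_nonneg k).trans ?_
  have hunion : ∀ s t : Finset ℤ,
      ∑ k ∈ s ∪ t, freqWeight k ≤ ∑ k ∈ s, freqWeight k + ∑ k ∈ t, freqWeight k := fun s t => by
    rw [← sum_union_inter]
    exact le_add_of_nonneg_right (sum_nonneg fun k _ => freqWeight_nonneg k)
  have h1 : ∑ k ∈ (Icc 1 K).image (fun j : ℕ => (j : ℤ)), freqWeight k =
      ∑ j ∈ Icc 1 K, (1 : ℝ) / j := by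
    rw [sum_image fun a _ b _ h => by simpa using h]
    exact sum_congr rfl fun j hj => (hw j hj).1
  have h2 : ∑ k ∈ (Icc 1 K).image (fun j : ℕ => -(j : ℤ)), freqWeight k =
      ∑ j ∈ Icc 1 K, (1 : ℝ) / j := by
    rw [sum_image fun a _ b _ h => by simpa using h]
    exact sum_congr rfl fun j hj => (hw j hj).2
  have h3 : freqWeight 0 = 3 := if_pos rfl
  have h4 := hunion {0} ((Icc 1 K).image (fun j : ℕ => (j : ℤ)) ∪
      (Icc 1 K).image (fun j : ℕ => -(j : ℤ)))
  have h5 := hunion ((Icc 1 K).image (fun j : ℕ => (j : ℤ)))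
      ((Icc 1 K).image (fun j : ℕ => -(j : ℤ)))
  rw [sum_singleton] at h4
  linarith

theorem sum_prod_freqWeight_le (M : ℕ) :
    ∑ k ∈ (frequencies n M).erase 0, ∏ i, freqWeight (k i) ≤ (5 + 4 * Real.log M) ^ n := by
  classical
  calc ∑ k ∈ (frequencies n M).erase 0, ∏ i, freqWeight (k i)
      ≤ ∑ k ∈ frequencies n M, ∏ i, freqWeight (k i) :=
        sum_le_sum_of_subset_of_nonneg (erase_subset _ _) fun k _ _ =>
          prod_nonneg fun i _ => freqWeight_nonneg _
    _ = ∏ _i : Fin n, ∑ k ∈ Icc (-((M ^ 2 : ℕ) : ℤ)) ((M ^ 2 : ℕ) : ℤ), freqWeight k := by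
        rw [prod_univ_sum, frequencies]
    _ = (∑ k ∈ Icc (-((M ^ 2 : ℕ) : ℤ)) ((M ^ 2 : ℕ) : ℤ), freqWeight k) ^ n := by simp
    _ ≤ _ := by
        have h := sum_freqWeight_le (M ^ 2)
        have h0 : 0 ≤ ∑ k ∈ Icc (-((M ^ 2 : ℕ) : ℤ)) ((M ^ 2 : ℕ) : ℤ), freqWeight k :=
          sum_nonneg fun k _ => freqWeight_nonneg k
        refine pow_le_pow_left₀ h0 (h.trans (le_of_eq ?_)) n
        push_cast
        rw [Real.log_pow]
        push_cast
        ring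

theorem sum_disc_le (hn : 1 ≤ n) {N : ℕ} (hN : 1 ≤ N) (hlog : logThreshold ≤ Real.log N) :
    ∑ q ∈ modsUpTo A (N : ℝ), disc (Delta A q) ≤
      n * (4 ^ n * 2 * (modsUpTo A (N : ℝ)).card * Real.exp (-defect A N) +
        9 ^ n * weylConst * (defect A N + 1) ^ (n + 2) *
          (N / Real.log N * Real.exp (recipSum A N)) * Real.exp (-(defect A N / 2))) := by
  have hS := defect_nonneg A hn N
  set S := defect A N
  -- Large enough for the smoothing error `2 / M` to be at most `2 exp (-S)`, small enough for `log
  -- M ≤ S + 1`, so that the weights sum to at most `(9 (S + 1)) ^ n`.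
  set M := ⌈Real.exp S⌉₊ with hMdef
  have hMge : Real.exp S ≤ M := Nat.le_ceil _
  have hM0 : (0 : ℝ) < M := lt_of_lt_of_le (Real.exp_pos _) hMge
  have hM : 1 ≤ M := by exact_mod_cast hM0
  have hlM : Real.log M ≤ S + 1 := by
    rw [Real.log_le_iff_le_exp hM0, Real.exp_add]
    have h1 := Nat.ceil_lt_add_one (Real.exp_pos S).le
    have h2 : 2 ≤ Real.exp 1 := by linarith [Real.add_one_le_exp (1 : ℝ)]
    have h3 : 1 ≤ Real.exp S := Real.one_le_exp hS
    nlinarith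
  have hlM0 : 0 ≤ Real.log M := Real.log_natCast_nonneg M
  have hK : 0 ≤ weylConst * (S + 1) ^ 2 * (N / Real.log N * Real.exp (recipSum A N)) *
      Real.exp (-(S / 2)) := by
    have := weylConst_pos
    have := Real.log_natCast_nonneg N
    positivity
  calc ∑ q ∈ modsUpTo A (N : ℝ), disc (Delta A q)
      ≤ ∑ q ∈ modsUpTo A (N : ℝ), n * boxError A M q := by
        refine sum_le_sum fun q hq => ?_
        obtain ⟨⟨h1, -⟩, h2⟩ := (mem_modsUpTo A).1 hq
        have : NeZero q := ⟨by omega⟩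
        exact disc_le A hn h2 hM
    _ = n * ((modsUpTo A (N : ℝ)).card * (4 ^ n * (2 / M)) +
          ∑ k ∈ (frequencies n M).erase 0, (∏ i, freqWeight (k i)) *
            ∑ q ∈ modsUpTo A (N : ℝ), weylNorm A k q) := by
        simp_rw [boxError]
        rw [← mul_sum, sum_add_distrib, sum_comm, sum_const, nsmul_eq_mul]
        simp_rw [mul_sum]
    _ ≤ n * ((modsUpTo A (N : ℝ)).card * (4 ^ n * (2 * Real.exp (-S))) +
          (9 * (S + 1)) ^ n * (weylConst * (S + 1) ^ 2 *
            (N / Real.log N * Real.exp (recipSum A N)) * Real.exp (-(S / 2)))) := by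
        gcongr
        · rw [Real.exp_neg, div_eq_mul_inv]
          gcongr
        · refine (sum_le_sum fun k hk => mul_le_mul_of_nonneg_left
            (sum_weylNorm_le_mul_exp A hn (ne_of_mem_erase hk) (H := M ^ 2) ?_ hN hlog ?_)
            (prod_nonneg fun i _ => freqWeight_nonneg _)).trans ?_
          · intro i
            have := mem_Icc.1 (Fintype.mem_piFinset.1 (mem_of_mem_erase hk) i)
            omega
          · push_cast
            rw [Real.log_pow]
            push_cast
            linarith
          · rw [← sum_mul]
            gcongr
            refine (sum_prod_freqWeight_le M).trans ?_
            gcongr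
            linarith
    _ = _ := by
        rw [mul_pow]
        ring

/-- Spend `exp (S / 6)` on the polynomial factor: `1/2 - 1/6 = 1/3`. -/
theorem pow_mul_exp_neg_le {S : ℝ} (hS : 0 ≤ S) (k : ℕ) :
    (S + 1) ^ k * Real.exp (-(S / 2)) ≤ 3 * (6 ^ k * k.factorial) * Real.exp (-(1 / 3) * S) := by
  have h1 := Real.pow_div_factorial_le_exp ((S + 1) / 6) (by positivity) k
  rw [div_le_iff₀ (by positivity), div_pow, div_le_iff₀ (by positivity)] at h1
  have h2 : Real.exp (1 / 6) ≤ 3 :=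
    (Real.exp_le_exp.2 (by norm_num)).trans Real.exp_one_lt_three.le
  calc (S + 1) ^ k * Real.exp (-(S / 2))
      ≤ Real.exp ((S + 1) / 6) * k.factorial * 6 ^ k * Real.exp (-(S / 2)) := by gcongr
    _ = Real.exp (1 / 6) * (6 ^ k * k.factorial) * Real.exp (-(1 / 3) * S) := by
        have : Real.exp ((S + 1) / 6) * Real.exp (-(S / 2)) =
            Real.exp (1 / 6) * Real.exp (-(1 / 3) * S) := by
          rw [← Real.exp_add, ← Real.exp_add]
          ring_nf
        linear_combination (k.factorial * 6 ^ k : ℝ) * this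
    _ ≤ _ := by gcongr

/-- The constant in the bound for the mean discrepancy. -/
noncomputable def discConst (n : ℕ) : ℝ :=
  n * (4 ^ n * 4 + 9 ^ n * weylConst * (3 * (6 ^ (n + 2) * (n + 2).factorial)) / lowerConst)

theorem discConst_pos (hn : 1 ≤ n) : 0 < discConst n := by
  have := weylConst_pos
  have := lowerConst_pos
  have : (0 : ℝ) < n := by exact_mod_cast hn
  unfold discConst
  positivity

theorem mean_disc_le (hn : 1 ≤ n) {α x₀ : ℝ} (hA : DensityAssumption A α x₀) {N : ℕ}
    (hN : 2 ^ 12 ≤ N) (hx₀ : x₀ ≤ Real.sqrt N) (hlogα : Real.log N ≤ α / 2 * Real.sqrt N)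
    (hlog : logThreshold ≤ Real.log N) :
    1 / ((modsUpTo A (N : ℝ)).card : ℝ) * ∑ q ∈ modsUpTo A (N : ℝ), disc (Delta A q) ≤
      discConst n / α * Real.exp (-(1 / 3) * defect A N) := by
  have hα := hA.1
  have hα2 := hA.le_two
  have hS := defect_nonneg A hn N
  have hc := lowerConst_pos
  have hw := weylConst_pos
  have hN1 : 1 < N := lt_of_lt_of_le (by norm_num) hN
  have hlN : 0 < Real.log N := Real.log_pos (by exact_mod_cast hN1)
  have hcard := card_modsUpTo_ge hA hN hx₀ hlogα
  have hsum := sum_disc_le A hn hN1.le hlog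
  have hpow := pow_mul_exp_neg_le hS (n + 2)
  set S := defect A N
  set Q : ℝ := ((modsUpTo A (N : ℝ)).card : ℝ)
  set K := N / Real.log N * Real.exp (recipSum A N) with hK
  have hK0 : 0 < K := by
    have : (0 : ℝ) < N := by exact_mod_cast (by omega : 0 < N)
    positivity
  have hKQ : K ≤ Q / (lowerConst * α) := by
    rw [le_div_iff₀ (by positivity)]
    linarith
  have hQ0 : 0 < Q := lt_of_lt_of_le (by positivity) hcard
  rw [one_div, inv_mul_le_iff₀ hQ0]
  refine hsum.trans ?_
  have e1 : Real.exp (-S) ≤ 2 / α * Real.exp (-(1 / 3) * S) := by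
    have : 1 ≤ 2 / α := by rwa [one_le_div hα]
    calc Real.exp (-S) ≤ Real.exp (-(1 / 3) * S) := Real.exp_le_exp.2 (by linarith)
      _ ≤ _ := le_mul_of_one_le_left (Real.exp_pos _).le this
  calc _ = n * (4 ^ n * 2 * Q * Real.exp (-S) +
        9 ^ n * weylConst * K * ((S + 1) ^ (n + 2) * Real.exp (-(S / 2)))) := by ring
    _ ≤ n * (4 ^ n * 2 * Q * (2 / α * Real.exp (-(1 / 3) * S)) +
        9 ^ n * weylConst * (Q / (lowerConst * α)) *
          (3 * (6 ^ (n + 2) * (n + 2).factorial) * Real.exp (-(1 / 3) * S))) := by gcongr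
    _ = _ := by
        rw [discConst]
        field_simp
        ring

theorem exists_threshold (α x₀ : ℝ) : ∃ X : ℝ, 0 < α → ∀ x : ℝ, X ≤ x →
    2 ^ 12 ≤ ⌊x⌋₊ ∧ x₀ ≤ Real.sqrt ⌊x⌋₊ ∧ Real.log ⌊x⌋₊ ≤ α / 2 * Real.sqrt ⌊x⌋₊ ∧
      logThreshold ≤ Real.log ⌊x⌋₊ := by
  by_cases hα : 0 < α
  · have hcast : Filter.Tendsto (fun N : ℕ => (N : ℝ)) Filter.atTop Filter.atTop :=
      tendsto_natCast_atTop_atTop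
    have h2 := (Real.tendsto_sqrt_atTop.comp hcast).eventually_ge_atTop x₀
    have h3 := hcast.eventually ((isLittleO_log_rpow_atTop (r := 1 / 2) (by norm_num)).bound
      (half_pos hα))
    have h4 := (Real.tendsto_log_atTop.comp hcast).eventually_ge_atTop logThreshold
    obtain ⟨N₀, hN₀⟩ := Filter.eventually_atTop.1
      (((Filter.eventually_ge_atTop (2 ^ 12)).and h2).and (h3.and h4))
    refine ⟨N₀, fun _ x hx => ?_⟩
    obtain ⟨⟨a1, a2⟩, a3, a4⟩ := hN₀ ⌊x⌋₊ (Nat.le_floor hx)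
    refine ⟨a1, a2, ?_, a4⟩
    rw [← Real.sqrt_eq_rpow, Real.norm_of_nonneg (Real.sqrt_nonneg _)] at a3
    exact (Real.le_norm_self _).trans a3
  · exact ⟨0, fun h => absurd h hα⟩

end Average

end CRTSets

theorem theorem2 :
    ∃ X : ℝ → ℝ → ℝ, ∀ n : ℕ, 1 ≤ n → ∃ C : ℝ, 0 < C ∧
      ∀ (A : (m : ℕ) → Set (Fin n → ZMod m)) (α x₀ : ℝ), CRTSets.DensityAssumption A α x₀ →
        ∀ x : ℝ, X α x₀ ≤ x →
          (1 / ((CRTSets.modsUpTo A x).card : ℝ)) *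
              ∑ q ∈ CRTSets.modsUpTo A x, CRTSets.disc (CRTSets.Delta A q) ≤
            C / α * Real.exp (-(1 / 3) *
              ∑ p ∈ CRTSets.primesUpTo A x,
                (1 - (CRTSets.lam A p : ℝ) / (CRTSets.rho A p : ℝ)) * (1 / (p : ℝ))) := by
  -- The threshold is fixed before `n` and `A`, so it depends on `α` and `x₀` only.
  choose X hX using CRTSets.exists_threshold
  refine ⟨X, fun n hn => ⟨CRTSets.discConst n, CRTSets.discConst_pos hn, fun A α x₀ hA x hx => ?_⟩⟩
  obtain ⟨h1, h2, h3, h4⟩ := hX α x₀ hA.1 x hx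
  rw [CRTSets.modsUpTo_floor A x, CRTSets.primesUpTo_floor A x]
  exact CRTSets.mean_disc_le A hn hA h1 h2 h3 h4
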